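/- Let $\mathcal A$ be a unital AF-algebra, i.e. a unital C*-algebra that is the closure of the union of an increasing sequence of finite-dimensional unital $*$-subalgebras. Suppose that the space of bounded tracial linear functionals on $\mathcal A$ has dimension $n$, and let $\varphi_1,\dots,\varphi_n$ be the extreme points of the set of tracial states of $\mathcal A$. Let $\Gamma\colon K_0(\mathcal A)\to\mathbb R^n$ be the homomorphism $\Gamma(g)=(\varphi_1^*(g),\dots,\varphi_n^*(g))$, where $\varphi_i^*([p])=(\mathrm{Tr}\otimes\varphi_i)(p)$ for projections $p$ in matrix algebras over $\mathcal A$. Suppose that $K_0(\mathcal A)$ is embedded in $\mathbb R^n$: $\Gamma$ is injective, $\Gamma([1_{\mathcal A}])=(1,\dots,1)$, and for all $g\in K_0(\mathcal A)$ one has $g\in K_0(\mathcal A)^+$ if and only if $\Gamma(g)\in\mathbb R^n_+$. Here $\mathbb R^n_+$ may be either the strict cone $\{x : x_i>0 \text{ for all } i\}\cup\{0\}$ or the coordinatewise cone $\{x: x_i\ge 0\text{ for all } i\}$. Let $F(\mathcal A)$ be the fundamental group of $\mathcal A$: the set of all matrices $M\in M_n(\mathbb C)$ for which there are $k\in\mathbb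 N$, a full projection $p\in M_k(\mathcal A)$ and a $*$-isomorphism $\Phi\colon\mathcal A\to pM_k(\mathcal A)p$ such that $(\mathrm{Tr}\otimes\varphi_j)\circ\Phi=\sum_{i=1}^n M_{ij}\,\varphi_i$ for $j=1,\dots,n$. Let $D$ be an $n\times n$ diagonal matrix with positive real diagonal entries and let $U$ be an $n\times n$ permutation matrix. Then, with $DU$ acting on row vectors from the right, $$\Gamma(K_0(\mathcal A))\,DU=\Gamma(K_0(\mathcal A))\quad\Longleftrightarrow\quad DU\in F(\mathcal A).$$ -/

import Mathlib

noncomputable section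

/-! ### Murray-von Neumann equivalence of matrix projections -/

/-- Murray-von Neumann equivalence of two square matrices over a star ring, possibly of different
sizes: `p = v* v` and `q = v v*` for a rectangular matrix `v`. -/
def MvNEquiv {A : Type*} [Ring A] [StarRing A] {m n : Type*} [Fintype m] [Fintype n]
    (p : Matrix m m A) (q : Matrix n n A) : Prop :=
  ∃ v : Matrix n m A, v.conjTranspose * v = p ∧ v * v.conjTranspose = q

/-- The orthogonal (block diagonal) sum of two square matrices. -/
def blockSum {A : Type*} [Zero A] {m n : Type*} (p : Matrix m m A) (q : Matrix n n A) :
    Matrix (m ⊕ n) (m ⊕ n) A :=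
  Matrix.fromBlocks p 0 0 q

section Lemmas

set_option linter.unusedSectionVars false

variable {A : Type*} [Ring A] [StarRing A] {k l m n : Type*}
  [Fintype k] [Fintype l] [Fintype m] [Fintype n]

theorem MvNEquiv.symm {p : Matrix m m A} {q : Matrix n n A} (h : MvNEquiv p q) :
    MvNEquiv q p := by
  obtain ⟨v, h1, h2⟩ := h
  exact ⟨v.conjTranspose, by simpa using h2, by simpa using h1⟩

theorem MvNEquiv.trans {p : Matrix l l A} {q : Matrix m m A} {r : Matrix n n A}
    (hp : IsStarProjection p) (hr : IsStarProjection r)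
    (h : MvNEquiv p q) (h' : MvNEquiv q r) : MvNEquiv p r := by
  obtain ⟨v, h1, h2⟩ := h
  obtain ⟨w, h3, h4⟩ := h'
  refine ⟨w * v, ?_, ?_⟩
  · rw [Matrix.conjTranspose_mul]
    calc v.conjTranspose * w.conjTranspose * (w * v)
        = v.conjTranspose * (w.conjTranspose * w) * v := by simp only [Matrix.mul_assoc]
      _ = (v.conjTranspose * v) * (v.conjTranspose * v) := by
          rw [h3, ← h2]; simp only [Matrix.mul_assoc]
      _ = p := by rw [h1]; exact hp.isIdempotentElem
  · rw [Matrix.conjTranspose_mul]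
    calc w * v * (v.conjTranspose * w.conjTranspose)
        = w * (v * v.conjTranspose) * w.conjTranspose := by simp only [Matrix.mul_assoc]
      _ = (w * w.conjTranspose) * (w * w.conjTranspose) := by
          rw [h2, ← h3]; simp only [Matrix.mul_assoc]
      _ = r := by rw [h4]; exact hr.isIdempotentElem

theorem mvNEquiv_reindex {p : Matrix m m A} (hp : IsStarProjection p) (e : m ≃ n) :
    MvNEquiv p (Matrix.reindex e e p) := by
  have h1 : p.conjTranspose = p := hp.isSelfAdjoint
  have h2 : p * p = p := hp.isIdempotentElem
  refine ⟨p.submatrix e.symm id, ?_, ?_⟩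
  · rw [Matrix.conjTranspose_submatrix, h1, Matrix.submatrix_mul_equiv p p id e.symm id, h2,
      Matrix.submatrix_id_id]
  · rw [Matrix.conjTranspose_submatrix, h1, Matrix.reindex_apply]
    rw [← Matrix.submatrix_mul p p e.symm id e.symm Function.bijective_id, h2]

theorem MvNEquiv.refl {p : Matrix m m A} (hp : IsStarProjection p) : MvNEquiv p p :=
  mvNEquiv_reindex hp (Equiv.refl m)

theorem MvNEquiv.blockSum {p : Matrix k k A} {p' : Matrix l l A} {q : Matrix m m A}
    {q' : Matrix n n A} (h : MvNEquiv p p') (h' : MvNEquiv q q') :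
    MvNEquiv (blockSum p q) (blockSum p' q') := by
  obtain ⟨v, h1, h2⟩ := h
  obtain ⟨w, h3, h4⟩ := h'
  refine ⟨Matrix.fromBlocks v 0 0 w, ?_, ?_⟩ <;>
    simp [_root_.blockSum, Matrix.fromBlocks_conjTranspose, Matrix.fromBlocks_multiply,
      h1, h2, h3, h4]

theorem isStarProjection_reindex {p : Matrix m m A} (hp : IsStarProjection p) (e : m ≃ n) :
    IsStarProjection (Matrix.reindex e e p) := by
  have h1 : p.conjTranspose = p := hp.isSelfAdjoint
  have h2 : p * p = p := hp.isIdempotentElem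
  refine ⟨?_, ?_⟩
  · change Matrix.reindex e e p * Matrix.reindex e e p = _
    rw [Matrix.reindex_apply, Matrix.submatrix_mul_equiv, h2]
  · change (Matrix.reindex e e p).conjTranspose = _
    rw [Matrix.conjTranspose_reindex, h1]

theorem isStarProjection_blockSum {p : Matrix m m A} {q : Matrix n n A}
    (hp : IsStarProjection p) (hq : IsStarProjection q) : IsStarProjection (blockSum p q) := by
  have h1 : p.conjTranspose = p := hp.isSelfAdjoint
  have h2 : p * p = p := hp.isIdempotentElem
  have h3 : q.conjTranspose = q := hq.isSelfAdjoint
  have h4 : q * q = q := hq.isIdempotentElem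
  refine ⟨?_, ?_⟩
  · change blockSum p q * blockSum p q = _
    simp [blockSum, Matrix.fromBlocks_multiply, h2, h4]
  · change (blockSum p q).conjTranspose = _
    simp [blockSum, Matrix.fromBlocks_conjTranspose, h1, h3]

theorem blockSum_comm_reindex (p : Matrix m m A) (q : Matrix n n A) :
    Matrix.reindex (Equiv.sumComm m n) (Equiv.sumComm m n) (blockSum p q) = blockSum q p := by
  ext i j
  rcases i with i | i <;> rcases j with j | j <;> rfl

theorem blockSum_assoc_reindex (p : Matrix l l A) (q : Matrix m m A) (r : Matrix n n A) :
    Matrix.reindex (Equiv.sumAssoc l m n) (Equiv.sumAssoc l m n) (blockSum (blockSum p q) r) =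
      blockSum p (blockSum q r) := by
  ext i j
  rcases i with i | i | i <;> rcases j with j | j | j <;> rfl

theorem blockSum_empty_reindex [IsEmpty m] (p : Matrix m m A) (q : Matrix n n A) :
    Matrix.reindex (Equiv.emptySum m n) (Equiv.emptySum m n) (blockSum p q) = q := by
  ext i j
  rfl

end Lemmas

/-! ### The monoid of classes of projections and the ordered group `K₀` -/

/-- A projection in `M_k(A)` for some natural number `k`. -/
structure MatProj (A : Type*) [Ring A] [StarRing A] where
  size : ℕ
  val : Matrix (Fin size) (Fin size) A
  isProj : IsStarProjection val

namespace MatProj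

variable {A : Type*} [Ring A] [StarRing A]

/-- Projections in matrix algebras over `A`, up to Murray-von Neumann equivalence. -/
instance setoid (A : Type*) [Ring A] [StarRing A] : Setoid (MatProj A) where
  r p q := MvNEquiv p.val q.val
  iseqv :=
    { refl := fun p => MvNEquiv.refl p.isProj
      symm := fun h => h.symm
      trans := fun {p _ r} h h' => h.trans p.isProj r.isProj h' }

/-- The orthogonal sum `p ⊕ q`, a projection in `M_{k + l}(A)`. -/
def add (p q : MatProj A) : MatProj A where
  size := p.size + q.size
  val := Matrix.reindex finSumFinEquiv finSumFinEquiv (blockSum p.val q.val)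
  isProj := isStarProjection_reindex (isStarProjection_blockSum p.isProj q.isProj) _

/-- The projection of size zero. -/
def zero (A : Type*) [Ring A] [StarRing A] : MatProj A where
  size := 0
  val := 0
  isProj := IsStarProjection.zero _

/-- The unit of `A`, as a projection in `M_1(A)`. -/
def one (A : Type*) [Ring A] [StarRing A] : MatProj A where
  size := 1
  val := 1
  isProj := IsStarProjection.one _

theorem blockSum_equiv_add (p q : MatProj A) :
    MvNEquiv (blockSum p.val q.val) (p.add q).val :=
  mvNEquiv_reindex (isStarProjection_blockSum p.isProj q.isProj) _

theorem trace_add (p q : MatProj A) :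
    Matrix.trace (p.add q).val = p.val.trace + q.val.trace := by
  change ∑ i : Fin (p.size + q.size), Matrix.reindex finSumFinEquiv finSumFinEquiv
    (blockSum p.val q.val) i i = ∑ i, p.val i i + ∑ i, q.val i i
  rw [← finSumFinEquiv.sum_comp, Fintype.sum_sum_type]
  simp [blockSum]

theorem add_congr {p p' q q' : MatProj A} (h : p ≈ p') (h' : q ≈ q') :
    p.add q ≈ p'.add q' :=
  MvNEquiv.trans (p.add q).isProj (p'.add q').isProj (blockSum_equiv_add p q).symm
    (MvNEquiv.trans (isStarProjection_blockSum p.isProj q.isProj) (p'.add q').isProj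
      (MvNEquiv.blockSum h h') (blockSum_equiv_add p' q'))

theorem add_comm_equiv (p q : MatProj A) : p.add q ≈ q.add p := by
  have hpq := isStarProjection_blockSum p.isProj q.isProj
  have h := mvNEquiv_reindex hpq (Equiv.sumComm _ _)
  rw [blockSum_comm_reindex] at h
  exact MvNEquiv.trans (p.add q).isProj (q.add p).isProj (blockSum_equiv_add p q).symm
    (MvNEquiv.trans hpq (q.add p).isProj h (blockSum_equiv_add q p))

theorem add_assoc_equiv (p q r : MatProj A) : (p.add q).add r ≈ p.add (q.add r) := by
  have hl := isStarProjection_blockSum (isStarProjection_blockSum p.isProj q.isProj) r.isProj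
  have h := mvNEquiv_reindex hl (Equiv.sumAssoc _ _ _)
  rw [blockSum_assoc_reindex] at h
  have hL : MvNEquiv (blockSum (blockSum p.val q.val) r.val) ((p.add q).add r).val :=
    MvNEquiv.trans hl ((p.add q).add r).isProj
      (MvNEquiv.blockSum (blockSum_equiv_add p q) (MvNEquiv.refl r.isProj))
      (blockSum_equiv_add (p.add q) r)
  have hr := isStarProjection_blockSum p.isProj (isStarProjection_blockSum q.isProj r.isProj)
  have hR : MvNEquiv (blockSum p.val (blockSum q.val r.val)) (p.add (q.add r)).val :=
    MvNEquiv.trans hr (p.add (q.add r)).isProj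
      (MvNEquiv.blockSum (MvNEquiv.refl p.isProj) (blockSum_equiv_add q r))
      (blockSum_equiv_add p (q.add r))
  exact MvNEquiv.trans ((p.add q).add r).isProj (p.add (q.add r)).isProj hL.symm
    (MvNEquiv.trans hl (p.add (q.add r)).isProj h hR)

theorem zero_add_equiv (p : MatProj A) : (zero A).add p ≈ p := by
  have hl := isStarProjection_blockSum (zero A).isProj p.isProj
  have : IsEmpty (Fin (zero A).size) := inferInstanceAs (IsEmpty (Fin 0))
  have h := mvNEquiv_reindex hl (Equiv.emptySum _ _)
  rw [blockSum_empty_reindex] at h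
  exact MvNEquiv.trans ((zero A).add p).isProj p.isProj (blockSum_equiv_add _ p).symm h

end MatProj

/-- `V(A)`: the classes of projections in matrix algebras over `A`. -/
def ProjClass (A : Type*) [Ring A] [StarRing A] : Type _ := Quotient (MatProj.setoid A)

namespace ProjClass

variable {A : Type*} [Ring A] [StarRing A]

/-- The class of a projection. -/
def mk (p : MatProj A) : ProjClass A := Quotient.mk (MatProj.setoid A) p

instance : Add (ProjClass A) :=
  ⟨Quotient.map₂ MatProj.add fun _ _ h _ _ h' => MatProj.add_congr h h'⟩

instance : Zero (ProjClass A) := ⟨mk (MatProj.zero A)⟩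

theorem zero_add' (x : ProjClass A) : 0 + x = x := by
  induction x using Quotient.inductionOn
  exact Quotient.sound (MatProj.zero_add_equiv _)

theorem add_comm' (x y : ProjClass A) : x + y = y + x := by
  induction x, y using Quotient.inductionOn₂
  exact Quotient.sound (MatProj.add_comm_equiv _ _)

instance : AddCommMonoid (ProjClass A) where
  add_assoc x y z := by
    induction x, y, z using Quotient.inductionOn₃
    exact Quotient.sound (MatProj.add_assoc_equiv _ _ _)
  zero_add := zero_add'
  add_zero x := by rw [add_comm', zero_add']
  add_comm := add_comm'
  nsmul := nsmulRec

end ProjClass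

/-- `K₀(A)` of a unital star ring: the Grothendieck group of `V(A)`. -/
abbrev KZero (A : Type*) [Ring A] [StarRing A] : Type _ :=
  Algebra.GrothendieckAddGroup (ProjClass A)

/-- The class `[p]` in `K₀(A)` of a projection `p`. -/
def KZero.cls {A : Type*} [Ring A] [StarRing A] (p : MatProj A) : KZero A :=
  Algebra.GrothendieckAddGroup.of (ProjClass.mk p)

/-- `K₀(A)⁺`: the classes of projections. -/
def KZero.positiveCone (A : Type*) [Ring A] [StarRing A] : Set (KZero A) :=
  Set.range KZero.cls

/-! ### Traces -/

/-- The value of `Tr ⊗ τ` on a square matrix over `A`. -/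
def matTrace {A : Type*} [Ring A] [Algebra ℂ A] {m : Type*} [Fintype m] (τ : A →ₗ[ℂ] ℂ)
    (x : Matrix m m A) : ℂ :=
  τ x.trace

/-- The map induced on projection classes by a tracial functional `τ`: the class of `p` is sent
to the real part of `(Tr ⊗ τ)(p)`. (For a tracial state the value is already real.) -/
def traceOnClasses {A : Type*} [Ring A] [StarRing A] [Algebra ℂ A] (τ : A →ₗ[ℂ] ℂ)
    (hτ : ∀ a b, τ (a * b) = τ (b * a)) : ProjClass A →+ ℝ where
  toFun := Quotient.lift (fun p : MatProj A => (matTrace τ p.val).re) (by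
    rintro p q ⟨v, h1, h2⟩
    have : matTrace τ p.val = matTrace τ q.val := by
      rw [← h1, ← h2]
      simp only [matTrace, Matrix.trace, Matrix.diag, Matrix.mul_apply, map_sum]
      rw [Finset.sum_comm]
      exact Finset.sum_congr rfl fun i _ => Finset.sum_congr rfl fun j _ => hτ _ _
    simp only [this])
  map_zero' := by
    change (τ (Matrix.trace (0 : Matrix (Fin 0) (Fin 0) A))).re = 0
    rw [Matrix.trace_zero, map_zero, Complex.zero_re]
  map_add' x y := by
    induction x, y using Quotient.inductionOn₂ with
    | h p q =>
      change (matTrace τ (p.add q).val).re = (matTrace τ p.val).re + (matTrace τ q.val).re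
      rw [matTrace, MatProj.trace_add, map_add, Complex.add_re, matTrace, matTrace]

/-- The homomorphism `τ* : K₀(A) → ℝ` induced by a tracial functional `τ`. -/
def traceOnKZero {A : Type*} [Ring A] [StarRing A] [Algebra ℂ A] (τ : A →ₗ[ℂ] ℂ)
    (hτ : ∀ a b, τ (a * b) = τ (b * a)) : KZero A →+ ℝ :=
  Algebra.GrothendieckAddGroup.lift (traceOnClasses τ hτ)

section CStar

variable (A : Type*) [CStarAlgebra A]

/-- The space of bounded tracial linear functionals on `A`. -/
def traceSpace : Submodule ℂ (A →L[ℂ] ℂ) where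
  carrier := {τ | ∀ a b, τ (a * b) = τ (b * a)}
  zero_mem' := by simp
  add_mem' {σ τ} hσ hτ a b := by simp [hσ a b, hτ a b]
  smul_mem' c τ hτ a b := by simp [hτ a b]

open scoped ComplexOrder in
/-- The set of tracial states of `A`. -/
def tracialStates : Set (A →L[ℂ] ℂ) :=
  {τ | τ ∈ traceSpace A ∧ (∀ a, 0 ≤ τ (star a * a)) ∧ τ 1 = 1}

/-- The extreme points of the convex set of tracial states of `A`. -/
abbrev ExtremalTrace : Type _ :=
  ((tracialStates A).extremePoints ℝ : Set (A →L[ℂ] ℂ))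

/-- A unital C*-algebra is AF if it is the closure of the union of an increasing sequence of
finite-dimensional star subalgebras (containing the unit). -/
def IsAFAlgebra : Prop :=
  ∃ S : ℕ → StarSubalgebra ℂ A, Monotone S ∧ (∀ j, FiniteDimensional ℂ (S j)) ∧
    Dense (⋃ j, (S j : Set A))

end CStar

section Embedding

variable {A : Type*} [CStarAlgebra A] {n : ℕ}

/-- The map `Γ : K₀(A) → ℝⁿ`, `Γ(g) = (φ₁*(g), …, φₙ*(g))`, for an enumeration `φ` of the
extremal tracial states. -/
def gammaMap (φ : Fin n ≃ ExtremalTrace A) : KZero A →+ (Fin n → ℝ) :=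
  AddMonoidHom.mk' (fun g i => traceOnKZero ((φ i).1 : A →ₗ[ℂ] ℂ) (φ i).2.1.1 g)
    (fun g h => by ext i; simp)

/-- The strict order on `ℝⁿ`: the nonzero positive elements have all coordinates positive. -/
def strictCone (n : ℕ) : Set (Fin n → ℝ) := {x | ∀ i, 0 < x i} ∪ {0}

/-- The coordinatewise order on `ℝⁿ`. -/
def coordinatewiseCone (n : ℕ) : Set (Fin n → ℝ) := {x | ∀ i, 0 ≤ x i}

/-- `Γ` is an isomorphism of `(K₀(A), K₀(A)⁺, [1])` onto an ordered subgroup with unit of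
`(ℝⁿ, C, (1, …, 1))`. -/
def IsEmbeddingOn (φ : Fin n ≃ ExtremalTrace A) (C : Set (Fin n → ℝ)) : Prop :=
  Function.Injective (gammaMap φ) ∧
    (∀ g, g ∈ KZero.positiveCone A ↔ gammaMap φ g ∈ C) ∧
    gammaMap φ (KZero.cls (MatProj.one A)) = 1

/-- `Φ : A → M_k(A)` is a star isomorphism of `A` onto the corner `p M_k(A) p`. -/
def IsCornerIso {k : ℕ} (p : Matrix (Fin k) (Fin k) A)
    (Φ : A →⋆ₙₐ[ℂ] Matrix (Fin k) (Fin k) A) : Prop :=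
  Function.Injective Φ ∧ Set.range Φ = {x | p * x * p = x}

/-- The linear functional `T(τ) = (Tr ⊗ τ) ∘ Φ` on `A`. -/
def transferTrace {k : ℕ} (Φ : A →⋆ₙₐ[ℂ] Matrix (Fin k) (Fin k) A) (τ : A →ₗ[ℂ] ℂ) :
    A →ₗ[ℂ] ℂ where
  toFun a := matTrace τ (Φ a)
  map_add' a b := by simp [matTrace]
  map_smul' c a := by simp [matTrace]

/-- The fundamental group `F(A)`, as a set of complex matrices: the matrices, with respect to the
extremal tracial states `φ₁, …, φₙ`, of the maps `T : τ ↦ (Tr ⊗ τ) ∘ Φ` on the trace space, where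
`Φ` runs through the star isomorphisms of `A` onto corners `p M_k(A) p` by full projections `p`.
The `j`-th column of the matrix holds the coefficients of `T(φ_j)`. In the unital algebra `M_k(A)`
a projection is full as soon as the two-sided ideal which it generates algebraically is `M_k(A)`. -/
def fundamentalGroup (φ : Fin n ≃ ExtremalTrace A) : Set (Matrix (Fin n) (Fin n) ℂ) :=
  {M | ∃ (k : ℕ) (p : Matrix (Fin k) (Fin k) A) (Φ : A →⋆ₙₐ[ℂ] Matrix (Fin k) (Fin k) A),
    IsStarProjection p ∧ TwoSidedIdeal.span {p} = ⊤ ∧ IsCornerIso p Φ ∧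
    ∀ j, transferTrace Φ ((φ j).1 : A →ₗ[ℂ] ℂ) = ∑ i, M i j • ((φ i).1 : A →ₗ[ℂ] ℂ)}

end Embedding

end

/-! Two facts make trace vectors a complete invariant of projections over `A`. An element of a
finite-dimensional algebra has finite spectrum, so a small scalar shift makes it invertible; hence
invertibles are dense in an AF algebra, equivalent projections have equivalent complements
(`IsAFChain.projEquiv_one_sub`), and orthogonal summands cancel (`MvNEquiv.cancel`). Equality in
`K₀` is therefore Murray-von Neumann equivalence. As `Γ` is injective, projections with equal trace
vectors are equivalent (`IsEmbeddingOn.mvNEquiv`); the order condition realises every vector of the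
cone in `Γ(K₀)` by a projection (`IsEmbeddingOn.exists_realTraceVector_eq`).

Write `M = DU`. It preserves each of the two cones in both directions and sends strictly positive
vectors to strictly positive ones. If `M` preserves `Γ(K₀)`, then `(1, …, 1)M` is the trace vector
of a projection `p`, which may be chosen inside a finite stage of the matrix algebra, so that its
corner is again AF. Give `A` the vector trace `a ↦ τ(a)M` and the corner its own traces. Both
determine projections up to equivalence, and a partition of the unit on either side is matched by
one with the same traces on the other. Elliott's intertwining argument
(`exists_starAlgEquiv_of_traces`) then produces an isomorphism of `A` onto the corner with trace
matrix `M`. The projection `p` is full because its traces are strictly positive, so `1` lies under a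
multiple of `p`.

The intertwining is exact. A trace preserving map from a finite stage of one algebra into the other
has a left inverse on a finite stage, obtained from any trace preserving map back by a unitary
correction (`exists_tracePreserving_leftInverse`). Alternating left inverses gives homomorphisms
that extend one another; the closure of the union of their graphs in `A × B` is the graph of the
isomorphism.

Conversely, applying a corner isomorphism `Φ` entrywise to projections over `A` multiplies trace
vectors by `M`, so `Γ(K₀)M` lies in `Γ(K₀)`. Equality holds because every projection `q` lies, up to
equivalence, under a multiple of `p`, hence is equivalent to a projection over `pM_k(A)p = Φ(A)`. -/

noncomputable section

/-! ### Equivalence of projections in C*-algebras -/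

/-- Murray-von Neumann equivalence of two elements of a star ring. -/
def ProjEquiv {A : Type*} [Ring A] [StarRing A] (e f : A) : Prop :=
  ∃ v : A, star v * v = e ∧ v * star v = f

/-! ### Finiteness of spectra in finite-dimensional algebras -/

section Spectrum

/-- Spectral values are roots of the minimal polynomial. With a finite spectrum every real function
is continuous on it, which opens the continuous functional calculus to step functions. -/
theorem spectrum_finite_of_finiteDimensional {F : Type*} [Ring F] [Algebra ℂ F]
    [FiniteDimensional ℂ F] (x : F) : (spectrum ℂ x).Finite := by
  have hx : IsIntegral ℂ x := Algebra.IsIntegral.isIntegral x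
  refine ((minpoly ℂ x).roots.toFinset.finite_toSet).subset fun z hz => ?_
  have h := spectrum.subset_polynomial_aeval x (minpoly ℂ x) ⟨z, hz, rfl⟩
  rw [minpoly.aeval] at h
  cases subsingleton_or_nontrivial F
  · simp at h
  · rw [spectrum.zero_eq] at h
    simpa [minpoly.ne_zero hx] using h

theorem spectrum_real_finite_of_finiteDimensional {F : Type*} [Ring F] [Algebra ℂ F]
    [FiniteDimensional ℂ F] (x : F) : (spectrum ℝ x).Finite := by
  rw [← spectrum.preimage_algebraMap ℂ]
  exact (spectrum_finite_of_finiteDimensional x).preimage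
    (FaithfulSMul.algebraMap_injective ℝ ℂ).injOn

end Spectrum

/-! ### Algebraic identities for idempotents and corners -/

section RingIdentities

variable {R : Type*} [Ring R]

theorem mul_add_one_sub_eq {e a : R} (he : e * e = e) (ha : e * a = a) :
    e * (a + (1 - e)) = a := by
  simp only [mul_sub, mul_add, mul_one]; grind

theorem add_one_sub_mul_eq {e a : R} (he : e * e = e) (ha : a * e = a) :
    (a + (1 - e)) * e = a := by
  simp only [sub_mul, add_mul, one_mul]; grind

/-- Invertibility in the corner of `e` is handled in the ambient ring: adding `1 - e` completes an
element of the corner, and the cross terms vanish. -/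
theorem mul_add_one_sub_eq_one {a b e : R} (he : e * e = e) (hea : e * a = a) (hae : a * e = a)
    (heb : e * b = b) (hbe : b * e = b) (hab : a * b = e) :
    (a + (1 - e)) * (b + (1 - e)) = 1 := by
  simp only [sub_mul, add_mul, mul_sub, mul_add, one_mul, mul_one]; grind

theorem mul_inv_comm_of_comm {e z zi : R} (hzi : z * zi = 1) (hiz : zi * z = 1)
    (hez : e * z = z * e) : e * zi = zi * e := by
  calc e * zi = zi * (z * e) * zi := by grind
    _ = zi * e * (z * zi) := by rw [← hez]; simp only [mul_assoc]
    _ = zi * e := by rw [hzi, mul_one]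

/-- The Schur complement of an invertible corner of an invertible element is invertible. -/
theorem schur_complement_inverse {e f x c xi : R} (he : e * e = e) (hf : f * f = f)
    (hxi : x * xi = 1) (hix : xi * x = 1) (hec : e * c = c) (hcf : c * f = c)
    (hcxe : c * x * e = e) (hfxc : f * x * c = f) :
    (1 - f) * (x - x * c * x) * (1 - e) * ((1 - e) * xi * (1 - f)) = 1 - f ∧
    (1 - e) * xi * (1 - f) * ((1 - f) * (x - x * c * x) * (1 - e)) = 1 - e := by
  -- The Schur complement kills `e` on the right and `f` on the left, so the inner factors `1 - e`
  -- and `1 - f` of the products can be dropped.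
  have hA : (x - x * c * x) * e = 0 := by simp only [sub_mul]; grind
  have hB : f * (x - x * c * x) = 0 := by simp only [mul_sub]; grind
  have he' : (1 - e) * (1 - e) = 1 - e := by simp only [sub_mul, mul_sub, one_mul, mul_one]; grind
  have hf' : (1 - f) * (1 - f) = 1 - f := by simp only [sub_mul, mul_sub, one_mul, mul_one]; grind
  constructor
  · calc (1 - f) * (x - x * c * x) * (1 - e) * ((1 - e) * xi * (1 - f))
        = (1 - f) * (x - x * c * x) * ((1 - e) * (1 - e)) * xi * (1 - f) := by grind
      _ = (1 - f) * (x - x * c * x - (x - x * c * x) * e) * xi * (1 - f) := by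
        rw [he', mul_assoc (1 - f), mul_sub (x - x * c * x), mul_one]
      _ = (1 - f) * (x - x * c * x) * xi * (1 - f) := by rw [hA, sub_zero]
      _ = 1 - f := by simp only [sub_mul, mul_sub, one_mul, mul_one]; grind
  · calc (1 - e) * xi * (1 - f) * ((1 - f) * (x - x * c * x) * (1 - e))
        = (1 - e) * xi * ((1 - f) * (1 - f)) * (x - x * c * x) * (1 - e) := by grind
      _ = (1 - e) * xi * (x - x * c * x - f * (x - x * c * x)) * (1 - e) := by
        rw [hf', mul_assoc ((1 - e) * xi), sub_mul 1 f, one_mul]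
      _ = (1 - e) * xi * (x - x * c * x) * (1 - e) := by rw [hB, sub_zero]
      _ = 1 - e := by simp only [sub_mul, mul_sub, one_mul, mul_one]; grind

/-- Here `s` plays the role of `star v` for a partial isometry `v` from `e` to `f`, and `x` is near
`v`. The element `s * x * e` is then invertible in the corner of `e`, and composing its inverse with
`s` inverts the compression `f * x * e`. This is the element `c` that `schur_complement_inverse`
needs. -/
theorem corner_inverse {v s e f x z zi : R} (he : e * e = e) (hes : e * s = s)
    (hsf : s * f = s) (hve : v * e = v) (hvs : v * s = f) (hzi : z * zi = 1)
    (hiz : zi * z = 1) (hz : z = s * x * e + (1 - e)) :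
    e * (zi * s) = zi * s ∧ zi * s * f = zi * s ∧ zi * s * x * e = e ∧ f * x * (zi * s) = f := by
  have hze : z * e = s * x * e := by
    rw [hz]; exact add_one_sub_mul_eq he (by grind)
  have hez : e * z = z * e := by
    rw [hze, hz]; exact mul_add_one_sub_eq he (by rw [← mul_assoc, ← mul_assoc, hes])
  have hezi := mul_inv_comm_of_comm hzi hiz hez
  have hec : e * (zi * s) = zi * s := by rw [← mul_assoc, hezi, mul_assoc, hes]
  refine ⟨hec, by rw [mul_assoc, hsf], ?_, ?_⟩
  · calc zi * s * x * e = zi * (s * x * e) := by simp only [mul_assoc]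
      _ = e := by rw [← hze, ← mul_assoc, hiz, one_mul]
  · calc f * x * (zi * s) = v * (s * x * e) * (zi * s) := by
          conv_lhs => rw [← hvs, ← hec]
          simp only [mul_assoc]
      _ = v * (e * (z * zi) * s) := by rw [← hze, ← hez]; simp only [mul_assoc]
      _ = f := by rw [hzi, mul_one, hes, hvs]

theorem one_sub_mul_mul_one_sub {e : R} (a f : R) (he : e * e = e) :
    (1 - e) * ((1 - e) * a * f) = (1 - e) * a * f := by
  have : (1 - e) * (1 - e) = 1 - e := by simp only [sub_mul, mul_sub, one_mul, mul_one]; grind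
  grind

theorem mul_one_sub_mul_one_sub {e : R} (a f : R) (he : e * e = e) :
    (f * a * (1 - e)) * (1 - e) = f * a * (1 - e) := by
  have : (1 - e) * (1 - e) = 1 - e := by simp only [sub_mul, mul_sub, one_mul, mul_one]; grind
  grind

theorem mul_mul_mul_sub_eq {e f : R} (he : e * e = e) (hf : f * f = f) :
    e * f * (f * e) - e = e * (f - e) * e := by
  simp only [sub_mul, mul_sub]; grind

theorem mul_sub_mul_eq {s v x e : R} (he : e * e = e) (hsv : s * v = e) (hve : v * e = v) :
    s * x * e - e = s * (x - v) * e := by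
  simp only [sub_mul, mul_sub]; grind

/-- Polar decomposition in algebraic form: `z` stands for the inverse square root of `y` and `s` for
`star x`, so `x * z` has initial projection `e`. -/
theorem conj_eq_of_comm {z y e s x : R} (hzzy : z * (z * y) = 1) (hzy : z * y = y * z)
    (hze : z * e = e * z) (hye : y * e = s * x) : z * s * (x * z) = e := by
  calc z * s * (x * z) = z * (s * x) * z := by grind
    _ = e := by rw [← hye]; grind

theorem star_sub_mul_sub_eq_zero {v s e : R} (he : e * e = e) (h : s * v = e) :
    (e * s - s) * (v * e - v) = 0 := by
  simp only [mul_sub, sub_mul]; grind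

end RingIdentities

/-! ### Constructing equivalences of projections by polar decomposition -/

section CStarEquiv

variable {A : Type*} [CStarAlgebra A]

theorem IsStarProjection.norm_le_one' {e : A} (he : IsStarProjection e) : ‖e‖ ≤ 1 := by
  have h := CStarRing.norm_star_mul_self (x := e)
  rw [he.isSelfAdjoint.star_eq, he.isIdempotentElem] at h
  nlinarith [norm_nonneg e]

/-- The C*-identity applies to `v * e - v`, since its star times itself expands to zero. -/
theorem mul_eq_of_star_mul_self_eq {v e : A} (he : IsStarProjection e) (hv : star v * v = e) :
    v * e = v := by
  have h : star (v * e - v) * (v * e - v) = 0 := by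
    have h2 : e * e = e := he.isIdempotentElem
    simp only [star_sub, star_mul, he.isSelfAdjoint.star_eq]
    exact star_sub_mul_sub_eq_zero h2 hv
  exact sub_eq_zero.mp (CStarRing.star_mul_self_eq_zero_iff _ |>.mp h)

theorem eq_mul_of_mul_star_self_eq {v f : A} (hf : IsStarProjection f) (hv : v * star v = f) :
    f * v = v := by
  have h := mul_eq_of_star_mul_self_eq (v := star v) hf (by simpa using hv)
  simpa [hf.isSelfAdjoint.star_eq] using congrArg star h

theorem isStarProjection_mul_star_self {v e : A} (he : IsStarProjection e)
    (hv : star v * v = e) : IsStarProjection (v * star v) := by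
  have h := mul_eq_of_star_mul_self_eq he hv
  refine ⟨?_, by simp [IsSelfAdjoint]⟩
  change v * star v * (v * star v) = _
  rw [mul_assoc, ← mul_assoc (star v), hv, ← mul_assoc, h]

theorem ProjEquiv.symm {e f : A} (h : ProjEquiv e f) : ProjEquiv f e := by
  obtain ⟨v, h1, h2⟩ := h
  exact ⟨star v, by simpa using h2, by simpa using h1⟩

theorem ProjEquiv.refl {e : A} (he : IsStarProjection e) : ProjEquiv e e :=
  ⟨e, by rw [he.isSelfAdjoint.star_eq, he.isIdempotentElem],
    by rw [he.isSelfAdjoint.star_eq, he.isIdempotentElem]⟩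

theorem ProjEquiv.trans {e f g : A} (he : IsStarProjection e) (hg : IsStarProjection g)
    (h : ProjEquiv e f) (h' : ProjEquiv f g) : ProjEquiv e g := by
  obtain ⟨v, h1, h2⟩ := h
  obtain ⟨w, h3, h4⟩ := h'
  have h5 := mul_eq_of_star_mul_self_eq he h1
  have h6 := eq_mul_of_mul_star_self_eq hg h4
  refine ⟨w * v, ?_, ?_⟩ <;> simp only [star_mul]
  · rw [mul_assoc, ← mul_assoc (star w), h3, ← h2, mul_assoc, h1, h5, h1]
  · rw [mul_assoc, ← mul_assoc v, h2, ← h3, mul_assoc, h4, ← mul_assoc, h4]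
    exact hg.isIdempotentElem

theorem isUnit_add_one_sub_of_norm_lt {a e : A} (h : ‖a - e‖ < 1) : IsUnit (a + (1 - e)) := by
  have := isUnit_one_sub_of_norm_lt_one (x := e - a) (by rwa [norm_sub_rev])
  convert this using 1
  abel

/-- The two unit hypotheses say that `star x * x` and `x * star x` are invertible in the corners of
`e` and `f`. The partial isometry is the polar part of `x`, namely `x` times the inverse square root
of `star x * x + (1 - e)`. -/
theorem projEquiv_of_isUnit {x e f : A} (he : IsStarProjection e)
    (hf : IsStarProjection f) (hfx : f * x = x) (hxe : x * e = x)
    (h1 : IsUnit (star x * x + (1 - e))) (h2 : IsUnit (x * star x + (1 - f))) :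
    ProjEquiv e f := by
  let _ := CStarAlgebra.spectralOrder A
  have _ := CStarAlgebra.spectralOrderedRing A
  have he1 := he.isSelfAdjoint.star_eq
  have he2 : e * e = e := he.isIdempotentElem
  have hf1 := hf.isSelfAdjoint.star_eq
  have hf2 : f * f = f := hf.isIdempotentElem
  have hex : e * star x = star x := by simpa [he1] using congrArg star hxe
  have hxf : star x * f = star x := by simpa [hf1] using congrArg star hfx
  set y := star x * x + (1 - e) with hy
  have hey : e * y = star x * x := mul_add_one_sub_eq he2 (by rw [← mul_assoc, hex])
  have hye : y * e = star x * x := add_one_sub_mul_eq he2 (by rw [mul_assoc, hxe])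
  have hy0 : 0 ≤ y := add_nonneg (star_mul_self_nonneg x) he.one_sub.nonneg
  -- Positivity together with invertibility keeps the spectrum away from `0`, where the inverse
  -- square root is discontinuous.
  have hpos : ∀ t ∈ spectrum ℝ y, 0 < t := fun t ht =>
    lt_of_le_of_ne (spectrum_nonneg_of_nonneg hy0 ht) fun h0 =>
      spectrum.zero_notMem ℝ h1 (h0 ▸ ht)
  set z := cfc (fun t : ℝ => (√t)⁻¹) y with hz
  have hc : ContinuousOn (fun t : ℝ => (√t)⁻¹) (spectrum ℝ y) :=
    ContinuousOn.inv₀ (by fun_prop) fun t ht => (Real.sqrt_pos.mpr (hpos t ht)).ne'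
  have hzs : star z = z := (cfc_predicate _ y : IsSelfAdjoint z).star_eq
  have hze : z * e = e * z := Commute.cfc_real (show Commute y e by
    rw [Commute, SemiconjBy, hey, hye]) _
  have hys : IsSelfAdjoint y := .of_nonneg hy0
  have hzzy : z * (z * y) = 1 := by
    have h3 : cfc (fun t : ℝ => (√t)⁻¹ * ((√t)⁻¹ * t)) y = z * (z * y) := by
      rw [cfc_mul (fun t : ℝ => (√t)⁻¹) (fun t => (√t)⁻¹ * t) y hc (hc.mul continuousOn_id),
        cfc_mul (fun t : ℝ => (√t)⁻¹) (fun t => t) y hc continuousOn_id, cfc_id' ℝ y hys]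
    rw [← h3, ← cfc_const_one ℝ y]
    refine cfc_congr fun t ht => ?_
    have := (Real.sqrt_pos.mpr (hpos t ht)).ne'
    field_simp
    rw [Real.sq_sqrt (hpos t ht).le]
  have hzy : z * y = y * z := Commute.cfc_real (Commute.refl y) _
  refine ⟨x * z, ?_, ?_⟩
  · rw [star_mul, hzs]
    exact conj_eq_of_comm hzzy hzy hze hye
  · rw [star_mul, hzs]
    obtain ⟨u, hu⟩ := h2
    -- The final projection `g` fixes `x` from the left, and `f` is a right multiple of `x` because
    -- `x * star x` is invertible in the corner of `f`. Hence `g * f = f`, while `g * f = g` is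
    -- immediate.
    set g := x * z * (z * star x) with hg
    have hgx : g * x = x := by
      calc g * x = x * (z * (z * (star x * x))) := by simp only [hg, mul_assoc]
        _ = x := by rw [← hye, ← mul_assoc z y e, ← mul_assoc z, hzzy, one_mul, hxe]
    have hgf : g * f = g := by simp only [hg, mul_assoc, hxf]
    have hfu : f = x * star x * (↑u⁻¹ : A) := by
      have : f * (u : A) = x * star x := by
        rw [hu]; exact mul_add_one_sub_eq hf2 (by rw [← mul_assoc, hfx])
      rw [← this, mul_assoc, Units.mul_inv, mul_one]
    calc g = g * f := hgf.symm
      _ = f := by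
        conv_lhs => rw [hfu, ← mul_assoc, ← mul_assoc, hgx]
        exact hfu.symm

theorem projEquiv_of_norm_lt {x e f : A} (he : IsStarProjection e)
    (hf : IsStarProjection f) (hfx : f * x = x) (hxe : x * e = x)
    (h1 : ‖star x * x - e‖ < 1) (h2 : ‖x * star x - f‖ < 1) : ProjEquiv e f :=
  projEquiv_of_isUnit he hf hfx hxe (isUnit_add_one_sub_of_norm_lt h1)
    (isUnit_add_one_sub_of_norm_lt h2)

theorem norm_mul_mul_le_of_proj {a e f : A} (he : IsStarProjection e) (hf : IsStarProjection f) :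
    ‖f * a * e‖ ≤ ‖a‖ := by
  calc ‖f * a * e‖ ≤ ‖f‖ * ‖a‖ * ‖e‖ := by
        grw [norm_mul_le, norm_mul_le]
    _ ≤ 1 * ‖a‖ * 1 := by
        gcongr
        · exact hf.norm_le_one'
        · exact he.norm_le_one'
    _ = ‖a‖ := by ring

/-- For `x = f * e` the element `star x * x` differs from `e` by the compression of `f - e` to the
corner of `e`, and symmetrically for `f`. -/
theorem projEquiv_of_norm_sub_lt {e f : A} (he : IsStarProjection e)
    (hf : IsStarProjection f) (h : ‖e - f‖ < 1) : ProjEquiv e f := by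
  have he1 := he.isSelfAdjoint.star_eq
  have he2 : e * e = e := he.isIdempotentElem
  have hf1 := hf.isSelfAdjoint.star_eq
  have hf2 : f * f = f := hf.isIdempotentElem
  refine projEquiv_of_norm_lt (x := f * e) he hf (by rw [← mul_assoc, hf2])
    (by rw [mul_assoc, he2]) ?_ ?_
  · have : star (f * e) * (f * e) - e = e * (f - e) * e := by
      rw [star_mul, he1, hf1, mul_mul_mul_sub_eq he2 hf2]
    rw [this]
    exact (norm_mul_mul_le_of_proj he he).trans_lt (by rwa [norm_sub_rev])
  · have : f * e * star (f * e) - f = f * (e - f) * f := by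
      rw [star_mul, he1, hf1, mul_mul_mul_sub_eq hf2 he2]
    rw [this]
    exact (norm_mul_mul_le_of_proj hf hf).trans_lt h

/-- Elements that are mutually inverse between two projections make these equivalent. -/
theorem projEquiv_of_mul_eq {a b e f : A} (he : IsStarProjection e)
    (hf : IsStarProjection f) (hfa : f * a = a) (hae : a * e = a) (heb : e * b = b)
    (hbf : b * f = b) (hab : a * b = f) (hba : b * a = e) : ProjEquiv e f := by
  have he1 := he.isSelfAdjoint.star_eq
  have he2 : e * e = e := he.isIdempotentElem
  have hf1 := hf.isSelfAdjoint.star_eq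
  have hf2 : f * f = f := hf.isIdempotentElem
  have h1 := congrArg star hfa
  have h2 := congrArg star hae
  have h3 := congrArg star heb
  have h4 := congrArg star hbf
  have h5 := congrArg star hab
  have h6 := congrArg star hba
  simp only [star_mul, he1, hf1] at h1 h2 h3 h4 h5 h6
  -- In the corner of `e` the elements `star a * a` and `b * star b` are inverse to each other, and
  -- so are `a * star a` and `star b * b` in the corner of `f`. The polar part of `a` is thus
  -- available.
  have h7 : star a * a * (b * star b) = e := by
    rw [mul_assoc, ← mul_assoc a, hab, ← mul_assoc, h1, h6]
  have h8 : b * star b * (star a * a) = e := by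
    rw [mul_assoc, ← mul_assoc (star b), h5, ← mul_assoc, hbf, hba]
  have h9 : a * star a * (star b * b) = f := by
    rw [mul_assoc, ← mul_assoc (star a), h6, ← mul_assoc, hae, hab]
  have h10 : star b * b * (a * star a) = f := by
    rw [mul_assoc, ← mul_assoc b, hba, ← mul_assoc, h3, h5]
  have k1 : e * (star a * a) = star a * a := by rw [← mul_assoc, h2]
  have k2 : star a * a * e = star a * a := by rw [mul_assoc, hae]
  have k3 : e * (b * star b) = b * star b := by rw [← mul_assoc, heb]
  have k4 : b * star b * e = b * star b := by rw [mul_assoc, h3]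
  have k5 : f * (a * star a) = a * star a := by rw [← mul_assoc, hfa]
  have k6 : a * star a * f = a * star a := by rw [mul_assoc, h1]
  have k7 : f * (star b * b) = star b * b := by rw [← mul_assoc, h4]
  have k8 : star b * b * f = star b * b := by rw [mul_assoc, hbf]
  exact projEquiv_of_isUnit he hf hfa hae
    (isUnit_iff_exists.mpr ⟨b * star b + (1 - e), mul_add_one_sub_eq_one he2 k1 k2 k3 k4 h7,
      mul_add_one_sub_eq_one he2 k3 k4 k1 k2 h8⟩)
    (isUnit_iff_exists.mpr ⟨star b * b + (1 - f), mul_add_one_sub_eq_one hf2 k5 k6 k7 k8 h9,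
      mul_add_one_sub_eq_one hf2 k7 k8 k5 k6 h10⟩)

/-- If a partial isometry can be approximated by an invertible element, then the complements of
its initial and final projections are equivalent. -/
theorem ProjEquiv.one_sub_of_isUnit {v x e f : A} (he : IsStarProjection e)
    (hf : IsStarProjection f) (h1 : star v * v = e) (h2 : v * star v = f) (hx : IsUnit x)
    (hxv : ‖x - v‖ < 1) : ProjEquiv (1 - e) (1 - f) := by
  have he1 := he.isSelfAdjoint.star_eq
  have he2 : e * e = e := he.isIdempotentElem
  have hf1 := hf.isSelfAdjoint.star_eq
  have hf2 : f * f = f := hf.isIdempotentElem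
  have hve := mul_eq_of_star_mul_self_eq he h1
  have hfv := eq_mul_of_mul_star_self_eq hf h2
  have hev : e * star v = star v := by simpa [he1] using congrArg star hve
  have hvf : star v * f = star v := by simpa [hf1] using congrArg star hfv
  have hvn : ‖star v‖ ≤ 1 := by
    have h := CStarRing.norm_star_mul_self (x := v)
    rw [h1] at h
    rw [norm_star]
    nlinarith [norm_nonneg v, he.norm_le_one']
  have hz : IsUnit (star v * x * e + (1 - e)) := by
    apply isUnit_add_one_sub_of_norm_lt
    have : star v * x * e - e = star v * (x - v) * e := mul_sub_mul_eq he2 h1 hve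
    rw [this]
    calc ‖star v * (x - v) * e‖ ≤ ‖star v‖ * ‖x - v‖ * ‖e‖ := by
          grw [norm_mul_le, norm_mul_le]
      _ ≤ 1 * ‖x - v‖ * 1 := by gcongr; exact he.norm_le_one'
      _ < 1 := by linarith
  obtain ⟨z, hz⟩ := hz
  obtain ⟨x, rfl⟩ := hx
  -- The corner of `x` from `e` to `f` is invertible, being close to `v`. Its Schur complement in
  -- the unit `x` is inverse to the opposite corner of the inverse of `x`, which links `1 - e` with
  -- `1 - f`.
  obtain ⟨hec, hcf, hcxe, hfxc⟩ := corner_inverse he2 hev hvf hve h2 z.mul_inv z.inv_mul hz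
  obtain ⟨h3, h4⟩ := schur_complement_inverse he2 hf2 x.mul_inv x.inv_mul hec hcf hcxe hfxc
  exact projEquiv_of_mul_eq he.one_sub hf.one_sub (one_sub_mul_mul_one_sub _ _ hf2)
    (mul_one_sub_mul_one_sub _ _ he2) (one_sub_mul_mul_one_sub _ _ he2)
    (mul_one_sub_mul_one_sub _ _ hf2) h3 h4

end CStarEquiv

/-! ### Projections in algebras with a dense union of finite-dimensional subalgebras -/

section FiniteDimensional

variable {F : Type*} [CStarAlgebra F] [FiniteDimensional ℂ F]

theorem continuousOn_spectrum_of_finiteDimensional (x : F) (h : ℝ → ℝ) :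
    ContinuousOn h (spectrum ℝ x) :=
  (spectrum_real_finite_of_finiteDimensional x).continuousOn h

/-- The projection is the spectral projection of `x` for `(1/2, ∞)`, a legitimate functional
calculus since the spectrum is finite. Writing it as a multiple `x * h = h * x` keeps it inside any
corner that contains `x`. -/
theorem exists_isStarProjection_near {x : F} (hx : IsSelfAdjoint x) {ε : ℝ}
    (hε : ε < 1 / 4) (hxε : ‖x * x - x‖ ≤ ε) :
    ∃ h : F, IsStarProjection (x * h) ∧ x * h = h * x ∧ ‖x * h - x‖ ≤ 2 * ε := by
  have hc := continuousOn_spectrum_of_finiteDimensional x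
  have hε0 : 0 ≤ ε := (norm_nonneg _).trans hxε
  have hmul (k l : ℝ → ℝ) : cfc (fun t => k t * l t) x = cfc k x * cfc l x :=
    cfc_mul k l x (hc k) (hc l)
  have hid : cfc (fun t : ℝ => t) x = x := cfc_id' ℝ x
  have hspec : ∀ t ∈ spectrum ℝ x, |t * t - t| ≤ ε := fun t ht => by
    have h1 := norm_apply_le_norm_cfc (fun t : ℝ => t * t - t) x ht (hc _) hx
    have h2 : cfc (fun t : ℝ => t * t - t) x = x * x - x := by
      rw [cfc_sub (fun t : ℝ => t * t) (fun t => t) x (hc _) (hc _), hmul, hid]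
    rw [h2] at h1
    exact h1.trans hxε
  set k : ℝ → ℝ := fun t => if 1 / 2 < t then t⁻¹ else 0 with hk
  have hkk : ∀ t, t * k t = if 1 / 2 < t then 1 else 0 := fun t => by
    simp only [hk]
    split_ifs with h
    · exact mul_inv_cancel₀ (by linarith)
    · simp
  have h1 : x * cfc k x = cfc (fun t => t * k t) x := by rw [hmul, hid]
  refine ⟨cfc k x, ?_, ?_, ?_⟩
  · rw [h1]
    refine ⟨?_, cfc_predicate _ x⟩
    change _ * _ = _
    rw [← hmul]
    congr 1
    funext t
    rw [hkk]
    split_ifs <;> simp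
  · exact (Commute.cfc_real (Commute.refl x) k).symm
  · rw [h1]
    have h2 : cfc (fun t : ℝ => t * k t - t) x = cfc (fun t => t * k t) x - x := by
      rw [cfc_sub (fun t : ℝ => t * k t) (fun t => t) x (hc _) (hc _), hid]
    rw [← h2]
    refine norm_cfc_le (by linarith) fun t ht => ?_
    have h3 := hspec t ht
    have h4 : |t| * |t - 1| ≤ ε := by
      rw [← abs_mul, mul_sub, mul_one]; exact h3
    -- From `|t| |t - 1| ≤ ε`: above `1/2` the first factor exceeds `1/2`, so `|t - 1| ≤ 2ε`;
    -- otherwise the second factor is at least `1/2`, so `|t| ≤ 2ε`.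
    rw [hkk, Real.norm_eq_abs]
    split_ifs with h
    · rw [abs_sub_comm]
      rw [abs_of_pos (by linarith : 0 < t)] at h4
      nlinarith [abs_nonneg (t - 1)]
    · rw [zero_sub, abs_neg]
      rw [abs_of_neg (by linarith : t - 1 < 0)] at h4
      nlinarith [abs_nonneg t]

end FiniteDimensional

/-- An increasing sequence of finite-dimensional star subalgebras with dense union. -/
structure IsAFChain {A : Type*} [CStarAlgebra A] (S : ℕ → StarSubalgebra ℂ A) : Prop where
  mono : Monotone S
  fin : ∀ j, FiniteDimensional ℂ (S j)
  dense : Dense (⋃ j, (S j : Set A))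

namespace IsAFChain

variable {A : Type*} [CStarAlgebra A] {S : ℕ → StarSubalgebra ℂ A}

theorem isClosed (hS : IsAFChain S) (j : ℕ) : IsClosed (S j : Set A) := by
  have := hS.fin j
  exact Submodule.closed_of_finiteDimensional (Subalgebra.toSubmodule (S j).toSubalgebra)

theorem exists_approx (hS : IsAFChain S) (a : A) {ε : ℝ} (hε : 0 < ε) (N : ℕ) :
    ∃ i, N ≤ i ∧ ∃ x ∈ S i, ‖x - a‖ < ε := by
  obtain ⟨x, hx, hd⟩ := Metric.dense_iff.mp hS.dense a ε hε
  obtain ⟨i, hi⟩ := Set.mem_iUnion.mp hd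
  exact ⟨max N i, le_max_left _ _, x, hS.mono (le_max_right _ _) hi, by
    simpa [dist_eq_norm] using hx⟩

/-- A nearby element of some stage has finite spectrum, so adding a suitable small positive scalar
makes it invertible. -/
theorem exists_isUnit_near (hS : IsAFChain S) (a : A) {ε : ℝ} (hε : 0 < ε) :
    ∃ x : A, IsUnit x ∧ ‖x - a‖ < ε := by
  obtain ⟨i, -, x, hx, hxa⟩ := hS.exists_approx a (half_pos hε) 0
  have := hS.fin i
  have hfin : ((fun t : ℝ => (-t : ℂ)) ⁻¹' spectrum ℂ (⟨x, hx⟩ : S i)).Finite :=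
    (spectrum_finite_of_finiteDimensional _).preimage
      (fun s _ t _ h => by simpa using h)
  obtain ⟨t, ht, htn⟩ := (Set.Ioo_infinite (half_pos (half_pos hε))).exists_notMem_finite hfin
  have hu : IsUnit (algebraMap ℂ (S i) (-t : ℂ) - ⟨x, hx⟩) := by
    simpa [spectrum.mem_iff] using htn
  have hu' := (hu.map (S i).subtype).neg
  refine ⟨_, hu', ?_⟩
  have h1 : -((S i).subtype (algebraMap ℂ (S i) (-t : ℂ) - ⟨x, hx⟩)) - a
      = (x - a) + algebraMap ℂ A t := by
    have : (S i).subtype (algebraMap ℂ (S i) (-t : ℂ)) = algebraMap ℂ A (-t : ℂ) := rfl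
    rw [map_sub, this, map_neg]
    change -(-algebraMap ℂ A t - x) - a = _
    abel
  rw [h1]
  cases subsingleton_or_nontrivial A
  · rw [Subsingleton.elim (x - a + algebraMap ℂ A t) 0, norm_zero]; exact hε
  calc ‖x - a + algebraMap ℂ A t‖ ≤ ‖x - a‖ + ‖algebraMap ℂ A t‖ := norm_add_le _ _
    _ < ε / 2 + ε / 2 := by
      rw [norm_algebraMap', Complex.norm_real, Real.norm_of_nonneg ht.1.le]
      linarith [ht.2, half_lt_self (half_pos hε)]
    _ = ε := add_halves ε

theorem projEquiv_one_sub (hS : IsAFChain S) {e f : A} (he : IsStarProjection e)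
    (hf : IsStarProjection f) (h : ProjEquiv e f) : ProjEquiv (1 - e) (1 - f) := by
  obtain ⟨v, h1, h2⟩ := h
  obtain ⟨x, hx, hxv⟩ := hS.exists_isUnit_near v one_pos
  exact ProjEquiv.one_sub_of_isUnit he hf h1 h2 hx hxv

/-- The radius `1/3` gives `‖x‖ ≤ 4/3`, and `(4/3 + 1) / 3 = 7/9 < 1`. -/
theorem norm_star_mul_self_sub_lt {x v : A} (hv : ‖v‖ ≤ 1) (h : ‖x - v‖ < 1 / 3) :
    ‖star x * x - star v * v‖ < 1 := by
  have h1 : star x * x - star v * v = star x * (x - v) + star (x - v) * v := by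
    rw [star_sub, mul_sub, sub_mul]; abel
  have h2 : ‖x‖ ≤ 4 / 3 := by
    have := norm_add_le (x - v) v
    rw [sub_add_cancel] at this
    linarith
  calc ‖star x * x - star v * v‖ ≤ ‖star x‖ * ‖x - v‖ + ‖star (x - v)‖ * ‖v‖ := by
        rw [h1]; grw [norm_add_le, norm_mul_le, norm_mul_le]
    _ < 1 := by
        rw [norm_star, norm_star]
        nlinarith [norm_nonneg (x - v), norm_nonneg v, norm_nonneg x]

theorem isStarProjection_mk {j : ℕ} {e : A} (he : IsStarProjection e) (hj : e ∈ S j) :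
    IsStarProjection (⟨e, hj⟩ : S j) :=
  ⟨Subtype.ext he.isIdempotentElem, Subtype.ext he.isSelfAdjoint⟩

/-- An approximant of `v` from a stage is compressed between `f` and `e`. Polar decomposition is
then performed inside the stage, which is a C*-algebra because it is closed. -/
theorem exists_partialIsometry_mem (hS : IsAFChain S) {e f : A} (he : IsStarProjection e)
    (hf : IsStarProjection f) {j : ℕ} (hej : e ∈ S j) (hfj : f ∈ S j) (h : ProjEquiv e f) :
    ∃ i, j ≤ i ∧ ∃ w ∈ S i, star w * w = e ∧ w * star w = f := by
  obtain ⟨v, h1, h2⟩ := h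
  obtain ⟨i, hi, x, hx, hxv⟩ := hS.exists_approx v (by norm_num : (0 : ℝ) < 1 / 3) j
  have := hS.isClosed i
  have hei := hS.mono hi hej
  have hfi := hS.mono hi hfj
  have he2 : e * e = e := he.isIdempotentElem
  have hf2 : f * f = f := hf.isIdempotentElem
  have hvn : ‖v‖ ≤ 1 := by
    have h := CStarRing.norm_star_mul_self (x := v)
    rw [h1] at h
    nlinarith [norm_nonneg v, he.norm_le_one']
  have hd : ‖f * x * e - v‖ < 1 / 3 := by
    have : f * x * e - v = f * (x - v) * e := by
      rw [mul_sub, sub_mul, eq_mul_of_mul_star_self_eq hf h2, mul_eq_of_star_mul_self_eq he h1]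
    rw [this]
    exact (norm_mul_mul_le_of_proj he hf).trans_lt hxv
  have hxi : f * x * e ∈ S i := mul_mem (mul_mem hfi hx) hei
  have hE := projEquiv_of_norm_lt (x := (⟨f * x * e, hxi⟩ : S i))
    (isStarProjection_mk he hei) (isStarProjection_mk hf hfi)
    (Subtype.ext (by change f * (f * x * e) = _; rw [← mul_assoc, ← mul_assoc, hf2]))
    (Subtype.ext (by change f * x * e * e = _; rw [mul_assoc, he2]))
    (by
      change ‖star (f * x * e) * (f * x * e) - e‖ < 1
      rw [← h1]
      exact norm_star_mul_self_sub_lt hvn (by rwa [h1]))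
    (by
      change ‖f * x * e * star (f * x * e) - f‖ < 1
      have := norm_star_mul_self_sub_lt (x := star (f * x * e)) (v := star v)
        (by rwa [norm_star]) (by rwa [← star_sub, norm_star])
      rwa [star_star, star_star, h2] at this)
  obtain ⟨w, h3, h4⟩ := hE
  exact ⟨i, hi, w, w.2, congrArg Subtype.val h3, congrArg Subtype.val h4⟩

/-- An approximant of `f` is made self-adjoint, compressed by `q`, and rounded to a spectral
projection of its stage. Since `g` is within distance `1` of `f`, so is `q - g` of `q - f`; this
gives both equivalences. -/
theorem exists_proj_mem (hS : IsAFChain S) {q f : A} (hq : IsStarProjection q)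
    (hf : IsStarProjection f) {j : ℕ} (hqj : q ∈ S j) (hfq : f * q = f) :
    ∃ i, j ≤ i ∧ ∃ g ∈ S i, IsStarProjection g ∧ g * q = g ∧ ProjEquiv f g ∧
      ProjEquiv (q - f) (q - g) := by
  obtain ⟨i, hi, x₀, hx₀, hd₀⟩ := hS.exists_approx f (by norm_num : (0 : ℝ) < 1 / 16) j
  have hq1 := hq.isSelfAdjoint.star_eq
  have hq2 : q * q = q := hq.isIdempotentElem
  have hf1 := hf.isSelfAdjoint.star_eq
  have hf2 : f * f = f := hf.isIdempotentElem
  have hqf : q * f = f := by simpa [hq1, hf1] using congrArg star hfq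
  have := hS.isClosed i
  have := hS.fin i
  have hqi := hS.mono hi hqj
  set y : A := (1 / 2 : ℂ) • (x₀ + star x₀) with hy
  have hyi : y ∈ S i := SMulMemClass.smul_mem _ (add_mem hx₀ (star_mem hx₀))
  have hys : star y = y := by
    simp [hy, add_comm]
  have hyd : ‖y - f‖ < 1 / 16 := by
    have : y - f = (1 / 2 : ℂ) • ((x₀ - f) + star (x₀ - f)) := by
      rw [star_sub, hf1, hy]
      module
    rw [this, norm_smul]
    have h1 := norm_add_le (x₀ - f) (star (x₀ - f))
    rw [norm_star] at h1
    have : ‖(1 / 2 : ℂ)‖ = 1 / 2 := by norm_num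
    rw [this]
    linarith
  set x : A := q * y * q with hx
  have hxi : x ∈ S i := mul_mem (mul_mem hqi hyi) hqi
  have hxs : star x = x := by simp [hx, hq1, hys, mul_assoc]
  have hxd : ‖x - f‖ < 1 / 16 := by
    have : x - f = q * (y - f) * q := by rw [mul_sub, sub_mul, hqf, hfq]
    rw [this]
    exact (norm_mul_mul_le_of_proj hq hq).trans_lt hyd
  -- The radius `1/16` yields `(17/16 + 1 + 1) / 16 = 49/256 < 1/5`. Rounding then moves `x` by at
  -- most `2/5`, and `2/5 + 1/16 < 1`.
  have hxx : ‖x * x - x‖ ≤ 1 / 5 := by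
    have h1 : x * x - x = x * (x - f) + (x - f) * f + (f - x) := by
      rw [mul_sub, sub_mul, hf2]; abel
    have h2 : ‖x‖ ≤ 17 / 16 := by
      have := norm_add_le (x - f) f
      rw [sub_add_cancel] at this
      linarith [hf.norm_le_one']
    have h3 : ‖x * x - x‖ ≤ ‖x‖ * ‖x - f‖ + ‖x - f‖ * ‖f‖ + ‖f - x‖ := by
      rw [h1]; grw [norm_add_le, norm_add_le, norm_mul_le x (x - f), norm_mul_le (x - f) f]
    rw [norm_sub_rev f x] at h3
    nlinarith [norm_nonneg (x - f), norm_nonneg f, norm_nonneg x, hf.norm_le_one']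
  obtain ⟨h, hg, hcomm, hgd⟩ := exists_isStarProjection_near (x := (⟨x, hxi⟩ : S i))
    (Subtype.ext hxs) (by norm_num : (1 / 5 : ℝ) < 1 / 4) hxx
  have hgp : IsStarProjection (x * h) :=
    ⟨congrArg Subtype.val hg.isIdempotentElem, congrArg Subtype.val hg.isSelfAdjoint⟩
  have hgq : x * (h : A) * q = x * h := by
    rw [show x * (h : A) = h * x from congrArg Subtype.val hcomm, hx]
    simp only [mul_assoc, hq2]
  have hgd' : ‖x * (h : A) - x‖ ≤ 2 * (1 / 5) := hgd
  have hfg : ‖f - x * h‖ < 1 := by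
    have := norm_add_le (f - x) (x - x * h)
    rw [sub_add_sub_cancel, norm_sub_rev f x, norm_sub_rev x (x * h)] at this
    linarith
  refine ⟨i, hi, x * h, mul_mem hxi h.2, hgp, hgq, projEquiv_of_norm_sub_lt hf hgp hfg,
    projEquiv_of_norm_sub_lt (hf.sub_of_mul_eq_left hq hfq) (hgp.sub_of_mul_eq_left hq hgq) ?_⟩
  rwa [sub_sub_sub_cancel_left, norm_sub_rev]

/-- An orthogonal family of projections with sum in the union of the chain can be replaced by an
equivalent one inside a member of the chain. -/
theorem exists_orthogonal_family_mem (hS : IsAFChain S) {ι : Type*} (s : Finset ι) :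
    ∀ (f : ι → A) {q : A} {j : ℕ}, IsStarProjection q → q ∈ S j →
      (∀ k ∈ s, IsStarProjection (f k)) → (∀ k ∈ s, ∀ l ∈ s, k ≠ l → f k * f l = 0) →
      ∑ k ∈ s, f k = q →
      ∃ i, j ≤ i ∧ ∃ g : ι → A, (∀ k ∈ s, g k ∈ S i ∧ IsStarProjection (g k) ∧
        ProjEquiv (f k) (g k)) ∧ (∀ k ∈ s, ∀ l ∈ s, k ≠ l → g k * g l = 0) ∧
        ∑ k ∈ s, g k = q := by
  classical
  induction s using Finset.induction_on with
  | empty =>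
    intro f q j hq hqj _ _ hsum
    exact ⟨j, le_rfl, f, by simp, by simp, hsum⟩
  | insert a s ha ih =>
    intro f q j hq hqj hf horth hsum
    have hfa := hf a (Finset.mem_insert_self a s)
    have hfs : ∀ k ∈ s, IsStarProjection (f k) := fun k hk => hf k (Finset.mem_insert_of_mem hk)
    have hos : ∀ k ∈ s, ∀ l ∈ s, k ≠ l → f k * f l = 0 := fun k hk l hl =>
      horth k (Finset.mem_insert_of_mem hk) l (Finset.mem_insert_of_mem hl)
    rw [Finset.sum_insert ha] at hsum
    have hfaq : f a * q = f a := by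
      rw [← hsum, mul_add, hfa.isIdempotentElem, Finset.mul_sum, Finset.sum_eq_zero, add_zero]
      exact fun k hk => horth a (Finset.mem_insert_self a s) k (Finset.mem_insert_of_mem hk)
        fun h => ha (h ▸ hk)
    have hs : ∑ k ∈ s, f k = q - f a := by rw [← hsum]; abel
    -- The projection `f a` is replaced by `g` in the chain. The partial isometry `w` from `q - f a`
    -- to `q - g` carries the remaining projections under `q - g`, where the induction hypothesis
    -- takes over.
    obtain ⟨i, hij, g, hgi, hg, hgq, hfg, w, hw1, hw2⟩ := hS.exists_proj_mem hq hfa hqj hfaq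
    have hqg : q * g = g := by
      simpa [hq.isSelfAdjoint.star_eq, hg.isSelfAdjoint.star_eq] using congrArg star hgq
    have hwf : ∀ k ∈ s, star w * w * f k = f k := fun k hk => by
      rw [hw1, ← hs, Finset.sum_mul, Finset.sum_eq_single_of_mem k hk,
        (hfs k hk).isIdempotentElem]
      exact fun l hl hlk => hos l hl k hk hlk
    have hprod : ∀ k, ∀ l ∈ s, w * f k * star w * (w * f l * star w)
        = w * (f k * f l) * star w := fun k l hl => by
      calc w * f k * star w * (w * f l * star w) = w * f k * (star w * w * f l) * star w := by
            simp only [mul_assoc]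
        _ = _ := by rw [hwf l hl]; simp only [mul_assoc]
    have hf' : ∀ k ∈ s, IsStarProjection (w * f k * star w) := fun k hk => by
      refine ⟨?_, ?_⟩
      · change _ * _ = _
        rw [hprod k k hk, (hfs k hk).isIdempotentElem]
      · simp [IsSelfAdjoint, (hfs k hk).isSelfAdjoint.star_eq, mul_assoc]
    obtain ⟨i', hii, g', hg', ho', hs'⟩ := ih (fun k => w * f k * star w) (q := q - g)
      (hg.sub_of_mul_eq_left hq hgq) (sub_mem (hS.mono hij hqj) hgi) hf'
      (fun k hk l hl hkl => by rw [hprod k l hl, hos k hk l hl hkl, mul_zero, zero_mul])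
      (by rw [← Finset.sum_mul, ← Finset.mul_sum, hs, ← hw1, ← hw2]
          have := eq_mul_of_mul_star_self_eq (hg.sub_of_mul_eq_left hq hgq) hw2
          rw [← mul_assoc, mul_assoc, hw2, (hg.sub_of_mul_eq_left hq hgq).isIdempotentElem])
    have hg'g : ∀ k ∈ s, g' k * g = 0 := fun k hk => by
      have h1 : g' k * (q - g) = g' k := by
        rw [← hs', Finset.mul_sum, Finset.sum_eq_single_of_mem k hk,
          (hg' k hk).2.1.isIdempotentElem]
        exact fun l hl hlk => ho' k hk l hl hlk.symm
      rw [← h1, mul_assoc, sub_mul, hqg, hg.isIdempotentElem, sub_self, mul_zero]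
    have hgg' : ∀ k ∈ s, g * g' k = 0 := fun k hk => by
      simpa [hg.isSelfAdjoint.star_eq, (hg' k hk).2.1.isSelfAdjoint.star_eq]
        using congrArg star (hg'g k hk)
    have hne : ∀ k ∈ s, k ≠ a := fun k hk h => ha (h ▸ hk)
    refine ⟨i', hij.trans hii, Function.update g' a g, ?_, ?_, ?_⟩
    · intro k hk
      rcases Finset.mem_insert.mp hk with rfl | hk
      · rw [Function.update_self]
        exact ⟨hS.mono hii hgi, hg, hfg⟩
      · rw [Function.update_of_ne (hne k hk)]
        refine ⟨(hg' k hk).1, (hg' k hk).2.1, ProjEquiv.trans (hfs k hk) (hg' k hk).2.1 ?_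
          (hg' k hk).2.2⟩
        refine ⟨w * f k, ?_, ?_⟩ <;>
          rw [star_mul, (hfs k hk).isSelfAdjoint.star_eq]
        · rw [mul_assoc, ← mul_assoc (star w), hwf k hk, (hfs k hk).isIdempotentElem]
        · rw [mul_assoc, ← mul_assoc (f k), (hfs k hk).isIdempotentElem, mul_assoc]
    · intro k hk l hl hkl
      rcases Finset.mem_insert.mp hk with hk | hk <;> rcases Finset.mem_insert.mp hl with hl | hl
      · exact absurd (hk.trans hl.symm) hkl
      · rw [hk, Function.update_self, Function.update_of_ne (hne l hl)]
        exact hgg' l hl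
      · rw [hl, Function.update_self, Function.update_of_ne (hne k hk)]
        exact hg'g k hk
      · rw [Function.update_of_ne (hne k hk), Function.update_of_ne (hne l hl)]
        exact ho' k hk l hl hkl
    · rw [Finset.sum_insert ha, Function.update_self,
        Finset.sum_congr rfl fun k hk => Function.update_of_ne (hne k hk) g g', hs']
      abel

end IsAFChain

/-! ### Matrix units in finite-dimensional C*-algebras -/

/-- A system of partial isometries whose products `u i * star (u j)`, for `r i = r j`, form a
system of matrix units. The map `r` selects a representative in every block. -/
structure IsMatrixUnits {ι A : Type*} [Fintype ι] [Ring A] [StarRing A] (r : ι → ι) (u : ι → A) :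
    Prop where
  idem : ∀ i, r (r i) = r i
  star_mul_self : ∀ i, star (u i) * u i = u (r i)
  star_mul_of_ne : ∀ i j, i ≠ j → star (u i) * u j = 0
  sum_mul_star : ∑ i, u i * star (u i) = 1

namespace IsMatrixUnits

variable {ι A : Type*} [Fintype ι] [CStarAlgebra A] {r : ι → ι} {u : ι → A}

theorem isStarProjection_rep (h : IsMatrixUnits r u) (i : ι) : IsStarProjection (u (r i)) := by
  have h1 : star (u (r i)) = u (r i) := by rw [← h.star_mul_self i]; simp
  refine ⟨?_, h1⟩
  have := h.star_mul_self (r i)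
  rwa [h.idem, h1] at this

theorem mul_rep (h : IsMatrixUnits r u) (i : ι) : u i * u (r i) = u i :=
  mul_eq_of_star_mul_self_eq (h.isStarProjection_rep i) (h.star_mul_self i)

theorem isStarProjection_diag (h : IsMatrixUnits r u) (i : ι) :
    IsStarProjection (u i * star (u i)) :=
  isStarProjection_mul_star_self (h.isStarProjection_rep i) (h.star_mul_self i)

theorem rep_mul_star (h : IsMatrixUnits r u) (i : ι) : u (r i) * star (u i) = star (u i) := by
  simpa [(h.isStarProjection_rep i).isSelfAdjoint.star_eq] using congrArg star (h.mul_rep i)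

/-- The initial projections `u (r i)` and `u (r j)` of different blocks are orthogonal. -/
theorem mul_star_of_ne (h : IsMatrixUnits r u) {i j : ι} (hij : r i ≠ r j) :
    u i * star (u j) = 0 := by
  rw [← h.mul_rep i, ← h.rep_mul_star j, mul_assoc, ← mul_assoc (u (r i)),
    ← (h.isStarProjection_rep i).isSelfAdjoint.star_eq, h.star_mul_of_ne _ _ hij, zero_mul,
    mul_zero]

theorem unit_mul_unit (h : IsMatrixUnits r u) {i j : ι} (hij : r i = r j) (l : ι) :
    u i * star (u j) * (u j * star (u l)) = u i * star (u l) := by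
  rw [mul_assoc, ← mul_assoc (star (u j)), h.star_mul_self, ← mul_assoc, ← hij, h.mul_rep]

theorem unit_mul_unit_of_ne (h : IsMatrixUnits r u) (i l : ι) {j k : ι} (hjk : j ≠ k) :
    u i * star (u j) * (u k * star (u l)) = 0 := by
  rw [mul_assoc, ← mul_assoc (star (u j)), h.star_mul_of_ne j k hjk, zero_mul, mul_zero]

end IsMatrixUnits

/-- The matrices that are supported on the blocks of `r`. -/
def blockMatrices {ι : Type*} [Fintype ι] [DecidableEq ι] (r : ι → ι) :
    StarSubalgebra ℂ (Matrix ι ι ℂ) where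
  carrier := {m | ∀ i j, r i ≠ r j → m i j = 0}
  mul_mem' {a b} ha hb i j hij := by
    rw [Matrix.mul_apply]
    refine Finset.sum_eq_zero fun k _ => ?_
    by_cases hik : r i = r k
    · rw [hb k j (hik ▸ hij), mul_zero]
    · rw [ha i k hik, zero_mul]
  add_mem' {a b} ha hb i j hij := by simp [ha i j hij, hb i j hij]
  algebraMap_mem' c i j hij := by
    rw [Matrix.algebraMap_matrix_apply, if_neg fun h => hij (congrArg r h)]
  star_mem' {a} ha i j hij := by
    simp [Matrix.star_apply, ha j i (Ne.symm hij)]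

namespace IsMatrixUnits

variable {ι A : Type*} [Fintype ι] [DecidableEq ι] [CStarAlgebra A] {r : ι → ι} {u : ι → A}

theorem sum_mul_sum_units (h : IsMatrixUnits r u) (x y : blockMatrices r) :
    (∑ i, ∑ j, (x : Matrix ι ι ℂ) i j • (u i * star (u j))) *
      (∑ i, ∑ j, (y : Matrix ι ι ℂ) i j • (u i * star (u j))) =
    ∑ i, ∑ j, ((x * y : blockMatrices r) : Matrix ι ι ℂ) i j • (u i * star (u j)) := by
  rw [Finset.sum_mul]
  refine Finset.sum_congr rfl fun i _ => ?_
  rw [Finset.sum_mul]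
  have h1 : ∀ j, (x : Matrix ι ι ℂ) i j • (u i * star (u j)) *
      (∑ i, ∑ j, (y : Matrix ι ι ℂ) i j • (u i * star (u j))) =
      ∑ l, ((x : Matrix ι ι ℂ) i j * (y : Matrix ι ι ℂ) j l) • (u i * star (u l)) := fun j => by
    rw [Finset.mul_sum, Finset.sum_eq_single j]
    · rw [Finset.mul_sum]
      refine Finset.sum_congr rfl fun l _ => ?_
      rw [smul_mul_smul_comm]
      by_cases hij : r i = r j
      · rw [h.unit_mul_unit hij]
      · rw [x.2 i j hij, zero_mul, zero_smul, zero_smul]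
    · intro k _ hk
      rw [Finset.mul_sum]
      refine Finset.sum_eq_zero fun l _ => ?_
      rw [smul_mul_smul_comm, h.unit_mul_unit_of_ne i l hk.symm, smul_zero]
    · simp
  rw [Finset.sum_congr rfl fun j _ => h1 j, Finset.sum_comm]
  refine Finset.sum_congr rfl fun l _ => ?_
  rw [← Finset.sum_smul]
  rfl

/-- The star homomorphism determined by a system of matrix units. -/
def hom (h : IsMatrixUnits r u) : blockMatrices r →⋆ₐ[ℂ] A where
  toFun x := ∑ i, ∑ j, (x : Matrix ι ι ℂ) i j • (u i * star (u j))
  map_one' := by simp [Matrix.one_apply, ite_smul, h.sum_mul_star]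
  map_mul' x y := (h.sum_mul_sum_units x y).symm
  map_zero' := by simp
  map_add' x y := by simp [add_smul, Finset.sum_add_distrib]
  commutes' c := by
    have : ∀ i j, ((algebraMap ℂ (blockMatrices r) c : blockMatrices r) : Matrix ι ι ℂ) i j =
        if i = j then c else 0 := fun i j => Matrix.algebraMap_matrix_apply
    simp only [this, ite_smul, zero_smul, Finset.sum_ite_eq, Finset.mem_univ, if_true,
      ← Finset.smul_sum, h.sum_mul_star]
    exact (Algebra.algebraMap_eq_smul_one c).symm
  map_star' x := by
    simp only [star_sum, star_smul, star_mul, star_star]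
    rw [Finset.sum_comm]
    rfl

theorem hom_apply (h : IsMatrixUnits r u) (x : blockMatrices r) :
    h.hom x = ∑ i, ∑ j, (x : Matrix ι ι ℂ) i j • (u i * star (u j)) := rfl

/-- The matrix unit of position `(i, j)`. -/
def single (r : ι → ι) {i j : ι} (hij : r i = r j) : blockMatrices r :=
  ⟨Matrix.single i j 1, fun k l hkl => by
    rw [Matrix.single_apply, if_neg]
    rintro ⟨rfl, rfl⟩
    exact hkl hij⟩

theorem hom_single (h : IsMatrixUnits r u) {i j : ι} (hij : r i = r j) :
    h.hom (single r hij) = u i * star (u j) := by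
  rw [hom_apply, Finset.sum_eq_single i, Finset.sum_eq_single j]
  · simp [single]
  · intro l _ hl; simp [single, hl.symm]
  · simp
  · intro l _ hl
    exact Finset.sum_eq_zero fun k _ => by simp [single, hl.symm]
  · simp

/-- Multiplying by `star (u i)` and `u j` isolates the entry `x i j` as the coefficient of the
nonzero projection `u (r i)`. -/
theorem hom_injective (h : IsMatrixUnits r u) (hu : ∀ i, u i ≠ 0) :
    Function.Injective h.hom := by
  rw [injective_iff_map_eq_zero]
  intro x hx
  ext i j
  by_cases hij : r i = r j
  · have h1 : star (u i) * h.hom x * u j = (x : Matrix ι ι ℂ) i j • u (r i) := by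
      rw [hom_apply, Finset.mul_sum, Finset.sum_mul, Finset.sum_eq_single i]
      · rw [Finset.mul_sum, Finset.sum_mul, Finset.sum_eq_single j]
        · rw [mul_smul_comm, smul_mul_assoc, ← mul_assoc, mul_assoc, h.star_mul_self,
            h.star_mul_self, ← hij, (h.isStarProjection_rep i).isIdempotentElem]
        · intro l _ hl
          rw [mul_smul_comm, smul_mul_assoc, ← mul_assoc, mul_assoc, h.star_mul_of_ne l j hl,
            mul_zero, smul_zero]
        · simp
      · intro l _ hl
        rw [Finset.mul_sum, Finset.sum_mul]
        refine Finset.sum_eq_zero fun k _ => ?_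
        rw [mul_smul_comm, ← mul_assoc, h.star_mul_of_ne i l hl.symm, zero_mul, smul_zero, zero_mul]
      · simp
    rw [hx, mul_zero, zero_mul] at h1
    exact (smul_eq_zero.mp h1.symm).resolve_right (hu _)
  · exact x.2 i j hij

/-- A system of matrix units that spans the algebra and has no zero element. -/
theorem hom_bijective (h : IsMatrixUnits r u) (hu : ∀ i, u i ≠ 0)
    (hspan : Submodule.span ℂ (Set.range fun p : ι × ι => u p.1 * star (u p.2)) = ⊤) :
    Function.Bijective h.hom := by
  refine ⟨h.hom_injective hu, fun x => ?_⟩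
  have hx : x ∈ Submodule.span ℂ (Set.range fun p : ι × ι => u p.1 * star (u p.2)) :=
    hspan ▸ Submodule.mem_top
  have hle : Submodule.span ℂ (Set.range fun p : ι × ι => u p.1 * star (u p.2)) ≤
      LinearMap.range (h.hom : blockMatrices r →ₗ[ℂ] A) := by
    rw [Submodule.span_le]
    rintro _ ⟨⟨i, j⟩, rfl⟩
    by_cases hij : r i = r j
    · exact ⟨single r hij, h.hom_single hij⟩
    · simp only [h.mul_star_of_ne hij]
      exact zero_mem _
  exact hle hx

/-- Two systems of matrix units with the same block structure are related by a homomorphism. -/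
theorem exists_hom {B : Type*} [CStarAlgebra B] {v : ι → B} (h : IsMatrixUnits r u)
    (hu : ∀ i, u i ≠ 0)
    (hspan : Submodule.span ℂ (Set.range fun p : ι × ι => u p.1 * star (u p.2)) = ⊤)
    (hv : IsMatrixUnits r v) :
    ∃ θ : A →⋆ₐ[ℂ] B, ∀ i j, θ (u i * star (u j)) = v i * star (v j) := by
  let e := StarAlgEquiv.ofBijective h.hom (h.hom_bijective hu hspan)
  refine ⟨hv.hom.comp (e.symm : A →⋆ₐ[ℂ] blockMatrices r), fun i j => ?_⟩
  by_cases hij : r i = r j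
  · have : e.symm (u i * star (u j)) = single r hij := by
      rw [StarAlgEquiv.symm_apply_eq]
      exact (h.hom_single hij).symm
    change hv.hom (e.symm (u i * star (u j))) = _
    rw [this, hv.hom_single]
  · rw [h.mul_star_of_ne hij, hv.mul_star_of_ne hij, map_zero]

end IsMatrixUnits

/-! ### Minimal projections and existence of matrix units -/

section Minimal

variable {F : Type*} [CStarAlgebra F] [FiniteDimensional ℂ F]

/-- Otherwise each spectral projection of `x`, cut down by `e`, is `0` or `e`, and the finite
spectral decomposition of `x = x * e` makes `x` a scalar multiple of `e`. -/
theorem exists_proj_lt {e x : F} (he : IsStarProjection e) (hx : IsSelfAdjoint x)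
    (hex : e * x = x) (hne : ∀ c : ℂ, x ≠ c • e) :
    ∃ g : F, IsStarProjection g ∧ g * e = g ∧ g ≠ 0 ∧ g ≠ e := by
  by_contra! hcon
  have hc := continuousOn_spectrum_of_finiteDimensional x
  have hxe : x * e = x := by
    simpa [hx.star_eq, he.isSelfAdjoint.star_eq] using congrArg star hex
  obtain ⟨T, hT⟩ : ∃ T : Finset ℝ, ∀ t ∈ spectrum ℝ x, t ∈ T :=
    ⟨(spectrum_real_finite_of_finiteDimensional x).toFinset, fun t ht => by simpa using ht⟩
  set p : ℝ → F := fun s => cfc (fun t : ℝ => if t = s then (1 : ℝ) else 0) x with hp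
  have hpp : ∀ s, IsStarProjection (p s) := fun s => by
    refine ⟨?_, cfc_predicate _ x⟩
    change _ * _ = _
    rw [hp, ← cfc_mul _ _ x (hc _) (hc _)]
    congr 1
    funext t
    split_ifs <;> simp
  have hcomm : ∀ s, Commute (p s) e := fun s =>
    Commute.cfc_real (show Commute x e by rw [Commute, SemiconjBy, hex, hxe]) _
  have hsum : x = ∑ s ∈ T, s • p s := by
    have h1 : ∀ s ∈ T, s • p s =
        cfc (fun t : ℝ => s • (if t = s then (1 : ℝ) else 0)) x := fun s _ =>
      (cfc_smul s _ x (hc _)).symm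
    rw [Finset.sum_congr rfl h1, ← cfc_sum _ x T fun _ _ => hc _]
    conv_lhs => rw [← cfc_id' ℝ x]
    refine cfc_congr fun t ht => ?_
    simp [hT t ht]
  have hpe : ∀ s, ∃ c : ℂ, s • p s * e = c • e := fun s => by
    have h1 := (hpp s).mul he (hcomm s)
    by_cases h0 : p s * e = 0
    · exact ⟨0, by rw [smul_mul_assoc, h0, smul_zero, zero_smul]⟩
    · refine ⟨s, ?_⟩
      rw [smul_mul_assoc, hcon _ h1 (by rw [mul_assoc, he.isIdempotentElem]) h0]
      exact (RCLike.real_smul_eq_coe_smul (K := ℂ) s e)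
  choose c hc' using hpe
  refine hne (∑ s ∈ T, c s) ?_
  have h2 : x * e = ∑ s ∈ T, s • p s * e := by rw [← Finset.sum_mul, ← hsum]
  rw [← hxe, h2, Finset.sum_smul]
  exact Finset.sum_congr rfl fun s _ => hc' s

/-- By `exists_proj_lt`, self-adjoint elements of the corner of a minimal projection are scalar. The
general case follows by splitting into real and imaginary parts. -/
theorem exists_smul_of_minimal {e : F} (he : IsStarProjection e)
    (hmin : ∀ g : F, IsStarProjection g → g * e = g → g = 0 ∨ g = e) (x : F) :
    ∃ c : ℂ, e * x * e = c • e := by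
  have he1 := he.isSelfAdjoint.star_eq
  have he2 : e * e = e := he.isIdempotentElem
  have key : ∀ y : F, IsSelfAdjoint y → e * y = y → ∃ c : ℂ, y = c • e := fun y hy hey => by
    by_contra! hcon
    obtain ⟨g, hg, hge, h0, h1⟩ := exists_proj_lt he hy hey hcon
    exact (hmin g hg hge).elim h0 h1
  have hy : e * (e * x * e) = e * x * e := by rw [← mul_assoc, ← mul_assoc, he2]
  have hy' : e * star (e * x * e) = star (e * x * e) := by
    simp only [star_mul, he1, ← mul_assoc, he2]
  generalize e * x * e = y at hy hy' ⊢
  obtain ⟨a, ha⟩ := key (y + star y) (by simp [IsSelfAdjoint, add_comm])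
    (by rw [mul_add, hy, hy'])
  obtain ⟨b, hb⟩ := key (Complex.I • (y - star y))
    (by simp only [IsSelfAdjoint, star_smul, star_sub, star_star, Complex.star_def,
          Complex.conj_I]; module)
    (by rw [mul_smul_comm, mul_sub, hy, hy'])
  -- This inverts the splitting: `y` is half of `y + star y` minus `i/2` times `i (y - star y)`.
  refine ⟨1 / 2 * a - Complex.I / 2 * b, ?_⟩
  rw [sub_smul, mul_smul, mul_smul, ← ha, ← hb, smul_smul]
  have : Complex.I / 2 * Complex.I = -1 / 2 := by
    rw [div_mul_eq_mul_div, Complex.I_mul_I]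
  rw [this]
  module

/-- A finite orthogonal set of nonzero projections with sum `1`. -/
structure IsProjPartition (s : Finset F) : Prop where
  proj : ∀ e ∈ s, IsStarProjection e
  ne_zero : ∀ e ∈ s, e ≠ 0
  orth : ∀ e ∈ s, ∀ f ∈ s, e ≠ f → e * f = 0
  sum : ∑ e ∈ s, e = 1

/-- Nonzero orthogonal projections are linearly independent. -/
theorem IsProjPartition.card_le {s : Finset F} (hs : IsProjPartition s) :
    s.card ≤ Module.finrank ℂ F := by
  have hli : LinearIndependent ℂ (fun e : s => (e : F)) := by
    rw [linearIndependent_iff']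
    intro t g hg i hi
    have h := congrArg (fun y => (i : F) * y) hg
    simp only [Finset.mul_sum, mul_zero] at h
    rw [Finset.sum_eq_single_of_mem i hi, mul_smul_comm,
      (hs.proj i i.2).isIdempotentElem] at h
    · exact (smul_eq_zero.mp h).resolve_right (hs.ne_zero i i.2)
    · intro j _ hj
      rw [mul_smul_comm, hs.orth i i.2 j j.2 fun h => hj (Subtype.ext h.symm), smul_zero]
  simpa using hli.fintype_card_le_finrank

open Classical in
theorem IsProjPartition.split {s : Finset F} (hs : IsProjPartition s) {e g : F} (hes : e ∈ s)
    (hg : IsStarProjection g) (hge : g * e = g) (h0 : g ≠ 0) (h1 : g ≠ e) :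
    ∃ s' : Finset F, IsProjPartition s' ∧ s'.card = s.card + 1 := by
  have he := hs.proj e hes
  have hg2 : g * g = g := hg.isIdempotentElem
  have he2 : e * e = e := he.isIdempotentElem
  have heg : e * g = g := by
    simpa [hg.isSelfAdjoint.star_eq, he.isSelfAdjoint.star_eq] using congrArg star hge
  have hd := hg.sub_of_mul_eq_left he hge
  have hde : (e - g) * e = e - g := by rw [sub_mul, he2, hge]
  have hed : e * (e - g) = e - g := by rw [mul_sub, he2, heg]
  have hgd : g * (e - g) = 0 := by rw [mul_sub, hge, hg2, sub_self]
  have hdg : (e - g) * g = 0 := by rw [sub_mul, heg, hg2, sub_self]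
  have hd0 : e - g ≠ 0 := fun h => h1 (sub_eq_zero.mp h).symm
  have ho1 : ∀ a : F, a * e = a → ∀ f ∈ s.erase e, a * f = 0 := fun a ha f hf => by
    rw [← ha, mul_assoc, hs.orth e hes f (Finset.mem_of_mem_erase hf)
      (Finset.ne_of_mem_erase hf).symm, mul_zero]
  have ho2 : ∀ a : F, e * a = a → ∀ f ∈ s.erase e, f * a = 0 := fun a ha f hf => by
    rw [← ha, ← mul_assoc, hs.orth f (Finset.mem_of_mem_erase hf) e hes
      (Finset.ne_of_mem_erase hf), zero_mul]
  have hn1 : e - g ∉ s.erase e := fun h => hd0 (by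
    rw [← hd.isIdempotentElem.eq]; exact ho1 _ hde _ h)
  have hn2 : g ∉ s.erase e := fun h => h0 (by rw [← hg2]; exact ho1 _ hge _ h)
  have hn3 : g ≠ e - g := fun h => h0 (by rw [← hg2]; rwa [← h] at hgd)
  have hn4 : g ∉ insert (e - g) (s.erase e) := by simp [hn3, hn2]
  refine ⟨insert g (insert (e - g) (s.erase e)), ⟨?_, ?_, ?_, ?_⟩, ?_⟩
  · intro f hf
    rcases Finset.mem_insert.mp hf with rfl | hf
    · exact hg
    · rcases Finset.mem_insert.mp hf with rfl | hf
      · exact hd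
      · exact hs.proj f (Finset.mem_of_mem_erase hf)
  · intro f hf
    rcases Finset.mem_insert.mp hf with rfl | hf
    · exact h0
    · rcases Finset.mem_insert.mp hf with rfl | hf
      · exact hd0
      · exact hs.ne_zero f (Finset.mem_of_mem_erase hf)
  · intro a ha b hb hab
    simp only [Finset.mem_insert] at ha hb
    rcases ha with ha | ha | ha <;> rcases hb with hb | hb | hb
    · exact absurd (ha.trans hb.symm) hab
    · rw [ha, hb, hgd]
    · rw [ha]; exact ho1 g hge b hb
    · rw [ha, hb, hdg]
    · exact absurd (ha.trans hb.symm) hab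
    · rw [ha]; exact ho1 _ hde b hb
    · rw [hb]; exact ho2 g heg a ha
    · rw [hb]; exact ho2 _ hed a ha
    · exact hs.orth a (Finset.mem_of_mem_erase ha) b (Finset.mem_of_mem_erase hb) hab
  · rw [Finset.sum_insert hn4, Finset.sum_insert hn1, ← add_assoc, add_sub_cancel,
      Finset.add_sum_erase s (fun e => e) hes, hs.sum]
  · rw [Finset.card_insert_of_notMem hn4, Finset.card_insert_of_notMem hn1,
      Finset.card_erase_add_one hes]

/-- If every partition had a non-minimal member, repeated splitting would produce partitions larger
than the dimension. -/
theorem exists_minimal_projPartition (F : Type*) [CStarAlgebra F] [FiniteDimensional ℂ F] :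
    ∃ s : Finset F, IsProjPartition s ∧
      ∀ e ∈ s, ∀ g : F, IsStarProjection g → g * e = g → g = 0 ∨ g = e := by
  by_contra! hcon
  have h : ∀ n : ℕ, ∃ s : Finset F, IsProjPartition s ∧ n ≤ s.card := fun n => by
    induction n with
    | zero =>
      by_cases h : (1 : F) = 0
      · exact ⟨∅, ⟨by simp, by simp, by simp, by simp [h]⟩, Nat.zero_le _⟩
      · exact ⟨{1}, ⟨by simp, by simpa using h, by simp, by simp⟩, Nat.zero_le _⟩
    | succ n ih =>
      obtain ⟨s, hs, hn⟩ := ih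
      obtain ⟨e, he, g, hg, hge, h0, h1⟩ := hcon s hs
      obtain ⟨s', hs', hc⟩ := hs.split he hg hge h0 h1
      exact ⟨s', hs', by omega⟩
  obtain ⟨s, hs, hn⟩ := h (Module.finrank ℂ F + 1)
  have := hs.card_le
  omega

/-- For `y = f * x * e` the products `star y * y` and `y * star y` are scalar multiples of `e` and
`f`, nonzero by the C*-identity, so they are invertible in the corners. -/
theorem exists_partialIsometry_of_ne_zero {e f x : F} (he : IsStarProjection e)
    (hf : IsStarProjection f) (hme : ∀ x : F, ∃ c : ℂ, e * x * e = c • e)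
    (hmf : ∀ x : F, ∃ c : ℂ, f * x * f = c • f) (hx : f * x * e ≠ 0) : ProjEquiv e f := by
  have he1 := he.isSelfAdjoint.star_eq
  have hf1 := hf.isSelfAdjoint.star_eq
  have he2 : e * e = e := he.isIdempotentElem
  have hf2 : f * f = f := hf.isIdempotentElem
  have key : ∀ (p : F) (c : ℂ), p * p = p → c • p ≠ 0 → IsUnit (c • p + (1 - p)) :=
    fun p c hp hc => by
      have hc0 : c ≠ 0 := fun h => hc (by rw [h, zero_smul])
      have h1 : ∀ a b : ℂ, a * b = 1 → (a • p + (1 - p)) * (b • p + (1 - p)) = 1 :=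
        fun a b hab => mul_add_one_sub_eq_one hp (by rw [mul_smul_comm, hp])
          (by rw [smul_mul_assoc, hp]) (by rw [mul_smul_comm, hp]) (by rw [smul_mul_assoc, hp])
          (by rw [smul_mul_smul_comm, hp, hab, one_smul])
      exact isUnit_iff_exists.mpr ⟨c⁻¹ • p + (1 - p), h1 _ _ (mul_inv_cancel₀ hc0),
        h1 _ _ (inv_mul_cancel₀ hc0)⟩
  obtain ⟨c, hc⟩ := hme (star x * f * x)
  obtain ⟨d, hd⟩ := hmf (x * e * star x)
  have h1 : star (f * x * e) * (f * x * e) = c • e := by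
    rw [← hc]
    simp only [star_mul, he1, hf1, mul_assoc]
    rw [← mul_assoc f f, hf2]
  have h2 : f * x * e * star (f * x * e) = d • f := by
    rw [← hd]
    simp only [star_mul, he1, hf1, mul_assoc]
    rw [← mul_assoc e e, he2]
  refine projEquiv_of_isUnit (x := f * x * e) he hf (by rw [← mul_assoc, ← mul_assoc, hf2])
    (by rw [mul_assoc, he2]) ?_ ?_
  · rw [h1]
    refine key e c he2 fun h => hx ?_
    rwa [h, CStarRing.star_mul_self_eq_zero_iff] at h1
  · rw [h2]
    refine key f d hf2 fun h => hx ?_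
    rwa [h, CStarRing.mul_star_self_eq_zero_iff] at h2

/-- Every finite-dimensional C*-algebra is spanned by a system of matrix units. -/
theorem exists_isMatrixUnits (F : Type*) [CStarAlgebra F] [FiniteDimensional ℂ F] :
    ∃ (n : ℕ) (r : Fin n → Fin n) (u : Fin n → F), IsMatrixUnits r u ∧ (∀ i, u i ≠ 0) ∧
      Submodule.span ℂ (Set.range fun p : Fin n × Fin n => u p.1 * star (u p.2)) = ⊤ := by
  classical
  obtain ⟨s, hs, hmin⟩ := exists_minimal_projPartition F
  set e : Fin s.card → F := fun i => (s.equivFin.symm i : F) with he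
  have hmem : ∀ i, e i ∈ s := fun i => (s.equivFin.symm i).2
  have hproj : ∀ i, IsStarProjection (e i) := fun i => hs.proj _ (hmem i)
  have horth : ∀ i j, i ≠ j → e i * e j = 0 := fun i j hij =>
    hs.orth _ (hmem i) _ (hmem j) fun h => hij (s.equivFin.symm.injective (Subtype.ext h))
  have hsum : ∑ i, e i = 1 := by
    rw [← hs.sum, ← Finset.sum_coe_sort s]
    exact s.equivFin.symm.sum_comp (fun x : s => (x : F))
  have hm : ∀ i, ∀ x : F, ∃ c : ℂ, e i * x * e i = c • e i := fun i =>
    exists_smul_of_minimal (hproj i) (hmin _ (hmem i))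
  -- The blocks are the equivalence classes of minimal projections, with one representative `r i`
  -- chosen in each.
  let R : Setoid (Fin s.card) := 
    { r := fun i j => ProjEquiv (e i) (e j)
      iseqv := ⟨fun i => .refl (hproj i), fun h => h.symm,
        fun {i _ k} h h' => h.trans (hproj i) (hproj k) h'⟩ }
  set r : Fin s.card → Fin s.card := fun i => (Quotient.mk R i).out with hr
  have hri : ∀ i, ProjEquiv (e (r i)) (e i) := fun i => Quotient.mk_out (s := R) i
  have hreq : ∀ i j, ProjEquiv (e i) (e j) → r i = r j := fun i j h => by
    simp only [hr]
    rw [Quotient.sound (s := R) h]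
  have hrr : ∀ i, r (r i) = r i := fun i => hreq _ _ (hri i)
  choose v hv1 hv2 using hri
  -- At a representative the partial isometry must be the projection itself, because `IsMatrixUnits`
  -- asks for `star (u i) * u i = u (r i)`; an arbitrary `v i` need not satisfy this.
  set u : Fin s.card → F := fun i => if r i = i then e i else v i with hu
  have hu1 : ∀ i, star (u i) * u i = e (r i) := fun i => by
    simp only [hu]
    split_ifs with h
    · rw [(hproj i).isSelfAdjoint.star_eq, (hproj i).isIdempotentElem, h]
    · exact hv1 i
  have hu2 : ∀ i, u i * star (u i) = e i := fun i => by
    simp only [hu]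
    split_ifs with h
    · rw [(hproj i).isSelfAdjoint.star_eq, (hproj i).isIdempotentElem]
    · exact hv2 i
  have hur : ∀ i, u (r i) = e (r i) := fun i => by simp only [hu, hrr, if_true]
  have heu : ∀ i, e i * u i = u i := fun i => eq_mul_of_mul_star_self_eq (hproj i) (hu2 i)
  have hue : ∀ i, star (u i) * e i = star (u i) := fun i => by
    simpa [(hproj i).isSelfAdjoint.star_eq] using congrArg star (heu i)
  refine ⟨s.card, r, u, ⟨hrr, fun i => by rw [hu1, hur], fun i j hij => ?_, ?_⟩, ?_, ?_⟩
  · rw [← hue i, ← heu j, mul_assoc, ← mul_assoc (e i), horth i j hij, zero_mul, mul_zero]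
  · simp only [hu2, hsum]
  · intro i h
    have := hu2 i
    rw [h, zero_mul] at this
    exact hs.ne_zero _ (hmem i) this.symm
  · rw [eq_top_iff]
    intro x _
    have hx : x = ∑ i, ∑ j, e i * x * e j := by
      simp_rw [← Finset.mul_sum, hsum, mul_one, ← Finset.sum_mul, hsum, one_mul]
    rw [hx]
    refine Submodule.sum_mem _ fun i _ => Submodule.sum_mem _ fun j _ => ?_
    by_cases h0 : e i * x * e j = 0
    · rw [h0]; exact zero_mem _
    have hij : r i = r j := hreq _ _
      (exists_partialIsometry_of_ne_zero (hproj j) (hproj i) (hm j) (hm i) h0).symm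
    -- Since `i` and `j` share a block, `star (u i) * x * u j` lies in the corner of the minimal
    -- projection `e (r i)`, hence is a scalar multiple of it.
    obtain ⟨c, hc⟩ := hm (r i) (star (u i) * x * u j)
    have : e i * x * e j = c • (u i * star (u j)) := by
      have h1 : u i * e (r i) = u i := mul_eq_of_star_mul_self_eq (hproj _) (hu1 i)
      have h2 : u j * e (r j) = u j := mul_eq_of_star_mul_self_eq (hproj _) (hu1 j)
      have h3 : e (r j) * star (u j) = star (u j) := by
        simpa [(hproj (r j)).isSelfAdjoint.star_eq] using congrArg star h2
      calc e i * x * e j = u i * star (u i) * x * (u j * star (u j)) := by rw [hu2, hu2]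
        _ = u i * e (r i) * star (u i) * x * (u j * (e (r j) * star (u j))) := by rw [h1, h3]
        _ = u i * (e (r i) * (star (u i) * x * u j) * e (r i)) * star (u j) := by
          rw [hij]; simp only [mul_assoc]
        _ = _ := by rw [hc, mul_smul_comm, smul_mul_assoc, h1]
    rw [this]
    exact Submodule.smul_mem _ _ (Submodule.subset_span ⟨(i, j), rfl⟩)

end Minimal

/-! ### Classification of AF algebras by traces -/

namespace IsMatrixUnits

variable {ι A : Type*} [Fintype ι] [CStarAlgebra A] {r : ι → ι} {u u' : ι → A}

theorem map {B : Type*} [CStarAlgebra B] (h : IsMatrixUnits r u) (θ : A →⋆ₐ[ℂ] B) :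
    IsMatrixUnits r (fun i => θ (u i)) where
  idem := h.idem
  star_mul_self i := by rw [← map_star, ← map_mul, h.star_mul_self]
  star_mul_of_ne i j hij := by rw [← map_star, ← map_mul, h.star_mul_of_ne i j hij, map_zero]
  sum_mul_star := by
    simp only [← map_star, ← map_mul, ← map_sum, h.sum_mul_star, map_one]

/-- Equivalences between representatives propagate along the blocks: the sum of the `u' i * w (r i)
* star (u i)` sends `u j` to `u' j * w (r j)`. With `conj_one`, applied in both directions, it is a
unitary conjugating one system into the other. -/
theorem conj_unit (h : IsMatrixUnits r u) (h' : IsMatrixUnits r u') {w : ι → A}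
    (hw1 : ∀ i, star (w i) * w i = u (r i)) (hw2 : ∀ i, w i * star (w i) = u' (r i)) (j k : ι) :
    (∑ i, u' i * w (r i) * star (u i)) * (u j * star (u k)) *
      star (∑ i, u' i * w (r i) * star (u i)) = u' j * star (u' k) := by
  have h1 : ∀ j, (∑ i, u' i * w (r i) * star (u i)) * u j = u' j * w (r j) := fun j => by
    rw [Finset.sum_mul, Finset.sum_eq_single j]
    · rw [mul_assoc, h.star_mul_self, mul_assoc, ← h.idem j,
        mul_eq_of_star_mul_self_eq (h.isStarProjection_rep (r j)) (by rw [hw1, h.idem]), h.idem]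
    · intro i _ hi
      rw [mul_assoc, h.star_mul_of_ne i j hi, mul_zero]
    · simp
  by_cases hjk : r j = r k
  · have h2 := congrArg star (h1 k)
    rw [star_mul] at h2
    rw [mul_assoc, mul_assoc, h2, ← mul_assoc, h1, star_mul, mul_assoc, ← mul_assoc (w (r j)),
      hjk, hw2, h'.idem, h'.rep_mul_star]
  · rw [h.mul_star_of_ne hjk, h'.mul_star_of_ne hjk, mul_zero, zero_mul]

theorem conj_one (h : IsMatrixUnits r u) (h' : IsMatrixUnits r u') {w : ι → A}
    (hw1 : ∀ i, star (w i) * w i = u (r i)) (hw2 : ∀ i, w i * star (w i) = u' (r i)) :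
    (∑ i, u' i * w (r i) * star (u i)) * star (∑ i, u' i * w (r i) * star (u i)) = 1 := by
  have h1 : (∑ i, u' i * w (r i) * star (u i)) * 1 * star (∑ i, u' i * w (r i) * star (u i)) = 1 := by
    conv_lhs => rw [← h.sum_mul_star, Finset.mul_sum, Finset.sum_mul]
    rw [Finset.sum_congr rfl fun j _ => h.conj_unit h' hw1 hw2 j j, h'.sum_mul_star]
  rwa [mul_one] at h1

end IsMatrixUnits

theorem IsAFChain.exists_partialIsometries_mem {A : Type*} [CStarAlgebra A]
    {S : ℕ → StarSubalgebra ℂ A} (hS : IsAFChain S) {ι : Type*} [Fintype ι] {e f : ι → A}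
    (he : ∀ i, IsStarProjection (e i)) (hf : ∀ i, IsStarProjection (f i)) {j : ℕ}
    (hej : ∀ i, e i ∈ S j) (hfj : ∀ i, f i ∈ S j) (h : ∀ i, ProjEquiv (e i) (f i)) :
    ∃ k, j ≤ k ∧ ∃ w : ι → A, ∀ i, w i ∈ S k ∧ star (w i) * w i = e i ∧
      w i * star (w i) = f i := by
  choose k _ w hw hw1 hw2 using fun i =>
    hS.exists_partialIsometry_mem (he i) (hf i) (hej i) (hfj i) (h i)
  exact ⟨max j (Finset.univ.sup k), le_max_left _ _, w, fun i =>
    ⟨hS.mono ((Finset.le_sup (f := k) (Finset.mem_univ i)).trans (le_max_right _ _)) (hw i),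
      hw1 i, hw2 i⟩⟩

section Classification

variable {A B V : Type*} [CStarAlgebra A] [CStarAlgebra B] [AddCommGroup V] [Module ℂ V]

/-- A vector-valued trace that determines projections up to equivalence. -/
structure IsCompleteTrace (τ : A →ₗ[ℂ] V) : Prop where
  comm : ∀ a b, τ (a * b) = τ (b * a)
  complete : ∀ e f, IsStarProjection e → IsStarProjection f → τ e = τ f → ProjEquiv e f

/-- Every partition of the unit of `A` into projections has the same traces as such a partition
in `B`. -/
def TransfersPartitions (τA : A →ₗ[ℂ] V) (τB : B →ₗ[ℂ] V) : Prop :=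
  ∀ (n : ℕ) (e : Fin n → A), (∀ i, IsStarProjection (e i)) → (∀ i j, i ≠ j → e i * e j = 0) →
    ∑ i, e i = 1 → ∃ f : Fin n → B, (∀ i, IsStarProjection (f i)) ∧
      (∀ i j, i ≠ j → f i * f j = 0) ∧ ∑ i, f i = 1 ∧ ∀ i, τB (f i) = τA (e i)

variable {SA : ℕ → StarSubalgebra ℂ A} {SB : ℕ → StarSubalgebra ℂ B} {τA : A →ₗ[ℂ] V}
  {τB : B →ₗ[ℂ] V}

/-- Matrix units reduce the problem to projections. The diagonal units are transferred to a
partition in `B`, which is moved into the chain; within a block the traces agree, so completeness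
supplies partial isometries, again in the chain, and these form matrix units for the image. -/
theorem exists_tracePreserving_hom (hSA : IsAFChain SA) (hSB : IsAFChain SB)
    (hτA : IsCompleteTrace τA) (hτB : IsCompleteTrace τB) (hAB : TransfersPartitions τA τB)
    (n N : ℕ) :
    ∃ m, N ≤ m ∧ ∃ θ : SA n →⋆ₐ[ℂ] B, (∀ x, θ x ∈ SB m) ∧ ∀ x, τB (θ x) = τA x := by
  have := hSA.isClosed n
  have := hSA.fin n
  obtain ⟨l, r, u, hu, hu0, hspan⟩ := exists_isMatrixUnits (SA n)
  have huA := hu.map (SA n).subtype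
  set U : Fin l → A := fun i => (SA n).subtype (u i) with hU
  obtain ⟨f, hf, hfo, hf1, hfτ⟩ := hAB l (fun i => U i * star (U i)) huA.isStarProjection_diag
    (fun i j hij => huA.unit_mul_unit_of_ne i j hij) huA.sum_mul_star
  obtain ⟨k, hNk, g, hg, hgo, hg1⟩ := hSB.exists_orthogonal_family_mem Finset.univ f
    (IsStarProjection.one B) (one_mem (SB N)) (fun i _ => hf i)
    (fun i _ j _ hij => hfo i j hij) hf1
  replace hg := fun i => hg i (Finset.mem_univ i)
  have hτfg : ∀ e e' : B, ProjEquiv e e' → τB e = τB e' := by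
    rintro _ _ ⟨v, rfl, rfl⟩
    exact hτB.comm _ _
  have hτg : ∀ i, τB (g i) = τA (U i * star (U i)) := fun i => by
    rw [← hτfg _ _ (hg i).2.2, hfτ]
  have hτr : ∀ i, τB (g (r i)) = τB (g i) := fun i => by
    rw [hτg, hτg, hτA.comm, huA.star_mul_self, hτA.comm (U i), huA.star_mul_self, huA.idem]
  obtain ⟨m, hkm, v, hv⟩ := hSB.exists_partialIsometries_mem (e := fun i => g (r i)) (f := g)
    (fun i => (hg (r i)).2.1) (fun i => (hg i).2.1) (fun i => (hg (r i)).1) (fun i => (hg i).1)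
    (fun i => hτB.complete _ _ (hg (r i)).2.1 (hg i).2.1 (hτr i))
  set w : Fin l → B := fun i => if r i = i then g i else v i with hw
  have hw1 : ∀ i, star (w i) * w i = g (r i) := fun i => by
    simp only [hw]
    split_ifs with h
    · rw [(hg i).2.1.isSelfAdjoint.star_eq, (hg i).2.1.isIdempotentElem, h]
    · exact (hv i).2.1
  have hw2 : ∀ i, w i * star (w i) = g i := fun i => by
    simp only [hw]
    split_ifs with h
    · rw [(hg i).2.1.isSelfAdjoint.star_eq, (hg i).2.1.isIdempotentElem]
    · exact (hv i).2.2
  have hwr : ∀ i, w (r i) = g (r i) := fun i => by simp only [hw, hu.idem, if_true]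
  have hwm : ∀ i, w i ∈ SB m := fun i => by
    simp only [hw]
    split_ifs with h
    · exact hSB.mono hkm (hg i).1
    · exact (hv i).1
  have hwmu : IsMatrixUnits r w := by
    refine ⟨hu.idem, fun i => by rw [hw1, hwr], fun i j hij => ?_, by simp only [hw2]; exact hg1⟩
    have h1 := eq_mul_of_mul_star_self_eq (hg i).2.1 (hw2 i)
    have h2 := eq_mul_of_mul_star_self_eq (hg j).2.1 (hw2 j)
    have h3 : star (w i) * g i = star (w i) := by
      simpa [(hg i).2.1.isSelfAdjoint.star_eq] using congrArg star h1
    rw [← h3, ← h2, mul_assoc, ← mul_assoc (g i),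
      hgo i (Finset.mem_univ i) j (Finset.mem_univ j) hij, zero_mul, mul_zero]
  obtain ⟨θ, hθ⟩ := hu.exists_hom hu0 hspan hwmu
  have hmem : ∀ x : SA n, x ∈ Submodule.span ℂ
      (Set.range fun p : Fin l × Fin l => u p.1 * star (u p.2)) := fun x => hspan ▸ Submodule.mem_top
  refine ⟨m, hNk.trans hkm, θ, fun x => ?_, fun x => ?_⟩
  · induction hmem x using Submodule.span_induction with
    | mem x hx =>
      obtain ⟨⟨i, j⟩, rfl⟩ := hx
      rw [hθ]
      exact mul_mem (hwm i) (star_mem (hwm j))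
    | zero => rw [map_zero]; exact zero_mem _
    | add x y _ _ hx hy => rw [map_add]; exact add_mem hx hy
    | smul c x _ hx => rw [map_smul]; exact SMulMemClass.smul_mem c hx
  · induction hmem x using Submodule.span_induction with
    | mem x hx =>
      obtain ⟨⟨i, j⟩, rfl⟩ := hx
      rw [hθ]
      change _ = τA (U i * star (U j))
      -- Only diagonal units matter: an off-diagonal unit has trace zero on both sides, by the trace
      -- property.
      by_cases hij : i = j
      · rw [← hij, hw2, hτg]
      · rw [hτB.comm, hτA.comm, hwmu.star_mul_of_ne j i (Ne.symm hij),
          huA.star_mul_of_ne j i (Ne.symm hij), map_zero, map_zero]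
    | zero => rw [map_zero, map_zero]; exact (map_zero τA).symm
    | add x y _ _ hx hy => rw [map_add, map_add, hx, hy]; exact (map_add τA _ _).symm
    | smul c x _ hx => rw [map_smul, map_smul, hx]; exact (map_smul τA _ _).symm

/-- A homomorphism of a finite-dimensional subalgebra of `A` into a finite-dimensional subalgebra
of `B` has a left inverse on the latter. -/
theorem exists_tracePreserving_leftInverse (hSA : IsAFChain SA) (hSB : IsAFChain SB)
    (hτA : IsCompleteTrace τA) (hτB : IsCompleteTrace τB) (hBA : TransfersPartitions τB τA)
    {n m : ℕ} (θ : SA n →⋆ₐ[ℂ] B) (hθ : ∀ x, θ x ∈ SB m) (hθτ : ∀ x, τB (θ x) = τA x) (N : ℕ) :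
    ∃ k, N ≤ k ∧ ∃ ψ : SB m →⋆ₐ[ℂ] A, (∀ y, ψ y ∈ SA k) ∧ (∀ y, τA (ψ y) = τB y) ∧
      ∀ x : SA n, ψ ⟨θ x, hθ x⟩ = x := by
  have := hSA.isClosed n
  have := hSA.fin n
  have := hSB.isClosed m
  -- Any trace preserving `ψ₀` back to `A` is taken. The composite `ψ₀ ∘ θ` and the inclusion send
  -- the matrix units of `SA n` to two systems with equal traces, hence with equivalent
  -- representatives, and a unitary `W` from a later stage conjugates the first into the second.
  obtain ⟨k₀, hk₀, ψ₀, hψ₀, hψτ⟩ :=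
    exists_tracePreserving_hom hSB hSA hτB hτA hBA m (max N n)
  obtain ⟨l, r, u, hu, hu0, hspan⟩ := exists_isMatrixUnits (SA n)
  have huA := hu.map (SA n).subtype
  set U : Fin l → A := fun i => (SA n).subtype (u i) with hU
  let θ' : SA n →⋆ₐ[ℂ] SB m := θ.codRestrict (SB m) hθ
  have hu' := (hu.map θ').map ψ₀
  set U' : Fin l → A := fun i => ψ₀ (θ' (u i)) with hU'
  have hτU : ∀ x : SA n, τA (ψ₀ (θ' x)) = τA x := fun x => by rw [hψτ]; exact hθτ x
  have hUk : ∀ i, U i ∈ SA k₀ := fun i => hSA.mono ((le_max_right _ _).trans hk₀) (u i).2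
  obtain ⟨k, hk, w, hw⟩ := hSA.exists_partialIsometries_mem (e := fun i => U' (r i))
    (f := fun i => U (r i)) hu'.isStarProjection_rep huA.isStarProjection_rep
    (fun i => hψ₀ _) (fun i => hUk _) (fun i => hτA.complete _ _ (hu'.isStarProjection_rep i)
      (huA.isStarProjection_rep i) (hτU _))
  set W : A := ∑ i, U i * w (r i) * star (U' i) with hW
  have hWW : W * star W = 1 := hu'.conj_one huA (fun i => (hw i).2.1) (fun i => (hw i).2.2)
  have hWW' : star W * W = 1 := by
    have := huA.conj_one hu' (w := fun i => star (w i)) (fun i => by simpa using (hw i).2.2)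
      (fun i => by simpa using (hw i).2.1)
    rw [← this]
    simp only [hW, star_sum, star_mul, star_star, mul_assoc]
  have hWk : W ∈ SA k := sum_mem fun i _ =>
    mul_mem (mul_mem (hSA.mono hk (hUk i)) (hw _).1) (star_mem (hSA.mono hk (hψ₀ _)))
  let Wu : unitary A := ⟨W, hWW', hWW⟩
  have hWu : ∀ a : A, Unitary.conjStarAlgAut ℂ A Wu a = W * a * star W := fun a => rfl
  refine ⟨k, ((le_max_left _ _).trans hk₀).trans hk,
    ((Unitary.conjStarAlgAut ℂ A Wu : A ≃⋆ₐ[ℂ] A) : A →⋆ₐ[ℂ] A).comp ψ₀, fun y => ?_,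
    fun y => ?_, fun x => ?_⟩
  · change W * ψ₀ y * star W ∈ SA k
    exact mul_mem (mul_mem hWk (hSA.mono hk (hψ₀ y))) (star_mem hWk)
  · change τA (W * ψ₀ y * star W) = _
    rw [hτA.comm, ← mul_assoc, hWW', one_mul, hψτ]
  · change W * ψ₀ (θ' x) * star W = x
    have hx : x ∈ Submodule.span ℂ
      (Set.range fun p : Fin l × Fin l => u p.1 * star (u p.2)) := hspan ▸ Submodule.mem_top
    induction hx using Submodule.span_induction with
    | mem x hx =>
      obtain ⟨⟨i, j⟩, rfl⟩ := hx
      have := hu'.conj_unit huA (fun i => (hw i).2.1) (fun i => (hw i).2.2) i j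
      rw [map_mul, map_star, map_mul, map_star]
      exact this
    | zero => rw [map_zero, map_zero, mul_zero, zero_mul]; rfl
    | add x y _ _ hx hy =>
      rw [map_add, map_add, mul_add, add_mul, hx, hy]; rfl
    | smul c x _ hx =>
      rw [map_smul, map_smul, mul_smul_comm, smul_mul_assoc, hx]; rfl

end Classification

/-! ### Elliott's intertwining through graphs -/

section Intertwining

variable {A B V : Type*} [CStarAlgebra A] [CStarAlgebra B] [AddCommGroup V] [Module ℂ V]

/-- A trace preserving homomorphism between members of two chains of subalgebras. -/
structure ChainHom (SA : ℕ → StarSubalgebra ℂ A) (SB : ℕ → StarSubalgebra ℂ B)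
    (τA : A →ₗ[ℂ] V) (τB : B →ₗ[ℂ] V) where
  dom : ℕ
  cod : ℕ
  hom : SA dom →⋆ₐ[ℂ] B
  hom_mem : ∀ x, hom x ∈ SB cod
  trace_hom : ∀ x, τB (hom x) = τA x

variable {SA : ℕ → StarSubalgebra ℂ A} {SB : ℕ → StarSubalgebra ℂ B} {τA : A →ₗ[ℂ] V}
  {τB : B →ₗ[ℂ] V}

namespace ChainHom

/-- The graph of a chain homomorphism. -/
def graph (θ : ChainHom SA SB τA τB) : StarSubalgebra ℂ (A × B) :=
  ((SA θ.dom).subtype.prod θ.hom).range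

theorem mem_graph {θ : ChainHom SA SB τA τB} {p : A × B} :
    p ∈ θ.graph ↔ ∃ h : p.1 ∈ SA θ.dom, θ.hom ⟨p.1, h⟩ = p.2 := by
  constructor
  · rintro ⟨x, rfl⟩
    exact ⟨x.2, rfl⟩
  · rintro ⟨h, h'⟩
    exact ⟨⟨p.1, h⟩, Prod.ext rfl h'⟩

/-- With `ψ ∘ θ` and `θ' ∘ ψ` both inclusions, `θ' x = θ' (ψ (θ x)) = θ x`, so `θ'` extends `θ`;
moreover `y = θ' (ψ y)` puts the whole target stage of `θ` into the range of `θ'`. -/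
theorem exists_next (hSA : IsAFChain SA) (hSB : IsAFChain SB)
    (hτA : IsCompleteTrace τA) (hτB : IsCompleteTrace τB) (hAB : TransfersPartitions τA τB)
    (hBA : TransfersPartitions τB τA) (θ : ChainHom SA SB τA τB) :
    ∃ θ' : ChainHom SA SB τA τB, θ.dom < θ'.dom ∧ θ.cod < θ'.cod ∧ θ.graph ≤ θ'.graph ∧
      ∀ y ∈ SB θ.cod, ∃ x, (x, y) ∈ θ'.graph := by
  obtain ⟨k, hk, ψ, hψ, hψτ, hψθ⟩ := exists_tracePreserving_leftInverse hSA hSB hτA hτB hBA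
    θ.hom θ.hom_mem θ.trace_hom (θ.dom + 1)
  obtain ⟨m, hm, θ', hθ', hθτ, hθψ⟩ := exists_tracePreserving_leftInverse hSB hSA hτB hτA hAB
    ψ hψ hψτ (θ.cod + 1)
  refine ⟨⟨k, m, θ', hθ', hθτ⟩, hk, hm, fun p hp => ?_, fun y hy => ?_⟩
  · obtain ⟨h, hp⟩ := mem_graph.mp hp
    have hpk : p.1 ∈ SA k := hSA.mono (Nat.le_of_succ_le hk) h
    refine mem_graph.mpr ⟨hpk, ?_⟩
    rw [← hp]
    refine Eq.trans ?_ (hθψ ⟨θ.hom ⟨p.1, h⟩, θ.hom_mem _⟩)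
    change θ' _ = θ' _
    congr 1
    exact Subtype.ext (hψθ ⟨p.1, h⟩).symm
  · exact ⟨ψ ⟨y, hy⟩, mem_graph.mpr ⟨hψ _, hθψ ⟨y, hy⟩⟩⟩

/-- A left inverse makes the homomorphism injective, and injective star homomorphisms of C*-algebras
are isometric. -/
theorem norm_eq_of_mem_graph (hSA : IsAFChain SA) (hSB : IsAFChain SB)
    (hτA : IsCompleteTrace τA) (hτB : IsCompleteTrace τB)
    (hBA : TransfersPartitions τB τA) (θ : ChainHom SA SB τA τB) {p : A × B} (hp : p ∈ θ.graph) :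
    ‖p.1‖ = ‖p.2‖ := by
  obtain ⟨k, hk, ψ, hψ, hψτ, hψθ⟩ := exists_tracePreserving_leftInverse hSA hSB hτA hτB hBA
    θ.hom θ.hom_mem θ.trace_hom 0
  have := hSA.isClosed θ.dom
  have hinj : Function.Injective θ.hom := fun x y hxy => by
    apply Subtype.ext
    rw [← hψθ x, ← hψθ y]
    congr 1
    exact Subtype.ext hxy
  obtain ⟨h, hp⟩ := mem_graph.mp hp
  rw [← hp]
  exact (NonUnitalStarAlgHom.norm_map θ.hom hinj ⟨p.1, h⟩).symm

end ChainHom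

/-- A closed star subalgebra of a product of C*-algebras in which the two components have equal
norms and the components range over dense sets is the graph of an isomorphism. -/
theorem exists_starAlgEquiv_of_graph (G : StarSubalgebra ℂ (A × B))
    (hG : IsClosed (G : Set (A × B))) (hnorm : ∀ p ∈ G, ‖p.1‖ = ‖p.2‖)
    (hfst : Dense (Prod.fst '' (G : Set (A × B)))) (hsnd : Dense (Prod.snd '' (G : Set (A × B)))) :
    ∃ Φ : A ≃⋆ₐ[ℂ] B, ∀ a, (a, Φ a) ∈ G := by
  have hc : CompleteSpace G := hG.completeSpace_coe
  let F : G →⋆ₐ[ℂ] A := (StarAlgHom.fst ℂ A B).comp G.subtype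
  let E : G →⋆ₐ[ℂ] B := (StarAlgHom.snd ℂ A B).comp G.subtype
  -- The product carries the maximum norm, so equal component norms make both coordinate maps
  -- isometric on `G`. As `G` is complete, their dense ranges are closed, hence everything.
  have hF : Isometry F := AddMonoidHomClass.isometry_of_norm F fun p => by
    change ‖(p : A × B).1‖ = ‖(p : A × B)‖
    rw [Prod.norm_def, ← hnorm p p.2, max_self]
  have hE : Isometry E := AddMonoidHomClass.isometry_of_norm E fun p => by
    change ‖(p : A × B).2‖ = ‖(p : A × B)‖
    rw [Prod.norm_def, hnorm p p.2, max_self]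
  have hFr : Set.range F = Prod.fst '' (G : Set (A × B)) := by
    ext a; constructor
    · rintro ⟨p, rfl⟩; exact ⟨p, p.2, rfl⟩
    · rintro ⟨p, hp, rfl⟩; exact ⟨⟨p, hp⟩, rfl⟩
  have hEr : Set.range E = Prod.snd '' (G : Set (A × B)) := by
    ext a; constructor
    · rintro ⟨p, rfl⟩; exact ⟨p, p.2, rfl⟩
    · rintro ⟨p, hp, rfl⟩; exact ⟨⟨p, hp⟩, rfl⟩
  have hFs : Function.Surjective F := by
    rw [← Set.range_eq_univ, ← hF.isClosedEmbedding.isClosed_range.closure_eq, hFr]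
    exact hfst.closure_eq
  have hEs : Function.Surjective E := by
    rw [← Set.range_eq_univ, ← hE.isClosedEmbedding.isClosed_range.closure_eq, hEr]
    exact hsnd.closure_eq
  let F' := StarAlgEquiv.ofBijective F ⟨hF.injective, hFs⟩
  let E' := StarAlgEquiv.ofBijective E ⟨hE.injective, hEs⟩
  refine ⟨F'.symm.trans E', fun a => ?_⟩
  have h1 : ((F'.symm a : G) : A × B).1 = a := F'.apply_symm_apply a
  have h2 : (a, (F'.symm.trans E') a) = ((F'.symm a : G) : A × B) := Prod.ext h1.symm rfl
  rw [h2]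
  exact (F'.symm a).2

/-- Elliott's theorem, in terms of traces that determine projections up to equivalence. -/
theorem exists_starAlgEquiv_of_traces [TopologicalSpace V] [T2Space V]
    (hSA : IsAFChain SA) (hSB : IsAFChain SB) (hτA : IsCompleteTrace τA)
    (hτB : IsCompleteTrace τB) (hAB : TransfersPartitions τA τB)
    (hBA : TransfersPartitions τB τA) (hcA : Continuous τA) (hcB : Continuous τB) :
    ∃ Φ : A ≃⋆ₐ[ℂ] B, ∀ a, τB (Φ a) = τA a := by
  obtain ⟨m, -, θ, hθ, hθτ⟩ := exists_tracePreserving_hom hSA hSB hτA hτB hAB 0 0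
  choose next hdom hcod hgr hsur using
    ChainHom.exists_next hSA hSB hτA hτB hAB hBA
  let s : ℕ → ChainHom SA SB τA τB := fun k => Nat.rec ⟨0, m, θ, hθ, hθτ⟩ (fun _ => next) k
  have hs : ∀ k, s (k + 1) = next (s k) := fun k => rfl
  have hsdom : ∀ k, k ≤ (s k).dom := fun k => by
    induction k with
    | zero => exact Nat.zero_le _
    | succ k ih => rw [hs]; exact Nat.succ_le_of_lt (ih.trans_lt (hdom _))
  have hscod : ∀ k, k ≤ (s k).cod := fun k => by
    induction k with
    | zero => exact Nat.zero_le _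
    | succ k ih => rw [hs]; exact Nat.succ_le_of_lt (ih.trans_lt (hcod _))
  have hmono : Monotone fun k => (s k).graph := monotone_nat_of_le_succ fun k => hgr (s k)
  -- The graphs increase, so their supremum is their union. Equality of norms and of traces are
  -- closed conditions and pass from the union to its closure.
  set G : StarSubalgebra ℂ (A × B) := ⨆ k, (s k).graph with hG
  have hGm : ∀ p, p ∈ G ↔ ∃ k, p ∈ (s k).graph := fun p => by
    rw [← SetLike.mem_coe, hG, StarSubalgebra.coe_iSup_of_directed hmono.directed_le]
    simp
  have hGc : (G.topologicalClosure : Set (A × B)) = closure (G : Set (A × B)) :=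
    G.topologicalClosure_coe
  have hGcl : IsClosed (G.topologicalClosure : Set (A × B)) := by rw [hGc]; exact isClosed_closure
  have hnorm : ∀ p ∈ G.topologicalClosure, ‖p.1‖ = ‖p.2‖ := fun p hp => by
    rw [← SetLike.mem_coe, hGc] at hp
    refine closure_minimal (s := (G : Set (A × B))) (t := {p | ‖p.1‖ = ‖p.2‖}) (fun p hp => ?_)
      (isClosed_eq (by fun_prop) (by fun_prop)) hp
    obtain ⟨k, hk⟩ := (hGm p).mp hp
    exact (s k).norm_eq_of_mem_graph hSA hSB hτA hτB hBA hk
  have htr : ∀ p ∈ G.topologicalClosure, τB p.2 = τA p.1 := fun p hp => by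
    rw [← SetLike.mem_coe, hGc] at hp
    refine closure_minimal (s := (G : Set (A × B))) (t := {p | τB p.2 = τA p.1}) (fun p hp => ?_)
      (isClosed_eq (by fun_prop) (by fun_prop)) hp
    obtain ⟨k, hk⟩ := (hGm p).mp hp
    obtain ⟨h, h'⟩ := ChainHom.mem_graph.mp hk
    change τB p.2 = τA p.1
    rw [← h', (s k).trace_hom]
  -- Stage `k` has domain and target index at least `k`. Hence the first components exhaust the
  -- chain of `A`, and the second components that of `B`, since each target stage is covered one
  -- step later.
  obtain ⟨Φ, hΦ⟩ := exists_starAlgEquiv_of_graph G.topologicalClosure hGcl hnorm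
    (hSA.dense.mono fun a ha => by
      obtain ⟨k, hk⟩ := Set.mem_iUnion.mp ha
      have h := hSA.mono (hsdom k) hk
      exact ⟨(a, (s k).hom ⟨a, h⟩), StarSubalgebra.le_topologicalClosure _
        ((hGm _).mpr ⟨k, ChainHom.mem_graph.mpr ⟨h, rfl⟩⟩), rfl⟩)
    (hSB.dense.mono fun b hb => by
      obtain ⟨k, hk⟩ := Set.mem_iUnion.mp hb
      obtain ⟨x, hx⟩ := hsur (s k) b (hSB.mono (hscod k) hk)
      exact ⟨(x, b), StarSubalgebra.le_topologicalClosure _ ((hGm _).mpr ⟨k + 1, hx⟩), rfl⟩)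
  exact ⟨Φ, fun a => htr _ (hΦ a)⟩

end Intertwining

/-! ### Corners -/

section Corner

variable {C : Type*} [CStarAlgebra C]

/-- The corner `p C p` as a non-unital subalgebra. -/
def cornerSubalgebra {p : C} (hp : IsStarProjection p) : NonUnitalStarSubalgebra ℂ C where
  carrier := {x | p * x * p = x}
  add_mem' {a b} ha hb := by
    simp only [Set.mem_ofPred_eq] at *
    rw [mul_add, add_mul, ha, hb]
  zero_mem' := by simp
  mul_mem' {a b} ha hb := by
    simp only [Set.mem_ofPred_eq] at *
    have hpp : p * p = p := hp.isIdempotentElem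
    have h1 : p * a = a := by rw [← ha, ← mul_assoc, ← mul_assoc, hpp]
    have h2 : b * p = b := by rw [← hb, mul_assoc, hpp]
    rw [← mul_assoc, h1, mul_assoc, h2]
  smul_mem' c a ha := by
    simp only [Set.mem_ofPred_eq] at *
    rw [mul_smul_comm, smul_mul_assoc, ha]
  star_mem' {a} ha := by
    simp only [Set.mem_ofPred_eq] at *
    conv_rhs => rw [← ha]
    rw [star_mul, star_mul, hp.isSelfAdjoint.star_eq, mul_assoc]

theorem isClosed_cornerSubalgebra {p : C} (hp : IsStarProjection p) :
    IsClosed (cornerSubalgebra hp : Set C) :=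
  isClosed_eq (f := fun x => p * x * p) (by fun_prop) continuous_id

/-- The corner `p C p` as a unital algebra. -/
def Corner {p : C} (hp : IsStarProjection p) : Type _ := cornerSubalgebra hp

namespace Corner

variable {p : C} (hp : IsStarProjection p)

theorem mul_val (x : cornerSubalgebra hp) : p * (x : C) = x := by
  have hx : p * (x : C) * p = x := x.2
  have hpp : p * p = p := hp.isIdempotentElem
  rw [← hx, ← mul_assoc, ← mul_assoc, hpp]

theorem val_mul (x : cornerSubalgebra hp) : (x : C) * p = x := by
  have hx : p * (x : C) * p = x := x.2
  have hpp : p * p = p := hp.isIdempotentElem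
  rw [← hx, mul_assoc, hpp]

/-- The non-unital C*-algebra underlying a corner. -/
abbrev nonUnital : NonUnitalCStarAlgebra (cornerSubalgebra hp) :=
  NonUnitalStarSubalgebra.nonUnitalCStarAlgebra (cornerSubalgebra hp)
    (h_closed := isClosed_cornerSubalgebra hp)

instance : NormedRing (Corner hp) :=
  { (nonUnital hp).toNonUnitalNormedRing with
    one := ⟨p, by
      have hpp : p * p = p := hp.isIdempotentElem
      change p * p * p = p
      rw [hpp, hpp]⟩
    one_mul := fun x => Subtype.ext (mul_val hp x)
    mul_one := fun x => Subtype.ext (val_mul hp x) }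

instance : NormedAlgebra ℂ (Corner hp) :=
  letI : Module ℂ (Corner hp) := inferInstanceAs (Module ℂ (cornerSubalgebra hp))
  { (Algebra.ofModule (fun (r : ℂ) (x y : cornerSubalgebra hp) => smul_mul_assoc r x y)
      (fun (r : ℂ) (x y : cornerSubalgebra hp) => mul_smul_comm r x y) :
      Algebra ℂ (Corner hp)) with
    norm_smul_le := fun c (x : cornerSubalgebra hp) => norm_smul_le c x }

instance : StarRing (Corner hp) :=
  { (nonUnital hp).toStarRing with }

instance : CStarAlgebra (Corner hp) where
  toCompleteSpace := (nonUnital hp).toCompleteSpace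
  norm_mul_self_le := (nonUnital hp).norm_mul_self_le
  star_smul := (nonUnital hp).star_smul

/-- The inclusion of a corner. -/
def incl : Corner hp →⋆ₙₐ[ℂ] C where
  toFun x := x.1
  map_smul' _ _ := rfl
  map_zero' := rfl
  map_add' _ _ := rfl
  map_mul' _ _ := rfl
  map_star' _ := rfl

theorem incl_injective : Function.Injective (incl hp) := Subtype.val_injective

theorem mul_incl (x : Corner hp) : p * incl hp x = incl hp x := mul_val hp x

theorem incl_mul (x : Corner hp) : incl hp x * p = incl hp x := val_mul hp x

/-- An element of a corner. -/
def mk (x : C) (hx : p * x * p = x) : Corner hp := ⟨x, hx⟩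

@[simp] theorem incl_mk (x : C) (hx : p * x * p = x) : incl hp (mk hp x hx) = x := rfl

@[simp] theorem incl_one : incl hp 1 = p := rfl

theorem norm_incl (x : Corner hp) : ‖incl hp x‖ = ‖x‖ := rfl

theorem continuous_incl : Continuous (incl hp) := continuous_subtype_val

/-- The subalgebra of a corner determined by a subalgebra. -/
def sub (S : StarSubalgebra ℂ C) (hpS : p ∈ S) : StarSubalgebra ℂ (Corner hp) where
  carrier := {x | incl hp x ∈ S}
  mul_mem' {a b} ha hb := by
    simp only [Set.mem_ofPred_eq, map_mul] at *
    exact mul_mem ha hb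
  add_mem' {a b} ha hb := by
    simp only [Set.mem_ofPred_eq, map_add] at *
    exact add_mem ha hb
  algebraMap_mem' c := by
    simp only [Set.mem_ofPred_eq, Algebra.algebraMap_eq_smul_one, map_smul, incl_one]
    exact SMulMemClass.smul_mem c hpS
  star_mem' {a} ha := by
    simp only [Set.mem_ofPred_eq, map_star] at *
    exact star_mem ha

/-- Once `p` belongs to a stage, compressing an approximant by `p` stays in that stage and does not
increase the error. The index is shifted by `N` so that every stage contains `p`, the unit of the
corner. -/
theorem isAFChain {S : ℕ → StarSubalgebra ℂ C} (hS : IsAFChain S) {N : ℕ} (hN : p ∈ S N) :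
    IsAFChain fun j => sub hp (S (N + j)) (hS.mono (Nat.le_add_right N j) hN) where
  mono i j hij x hx := hS.mono (Nat.add_le_add_left hij N) hx
  fin j := by
    have := hS.fin (N + j)
    let f : sub hp (S (N + j)) (hS.mono (Nat.le_add_right N j) hN) →ₗ[ℂ] S (N + j) :=
      { toFun := fun x => ⟨incl hp x, x.2⟩
        map_add' := fun _ _ => rfl
        map_smul' := fun _ _ => rfl }
    refine FiniteDimensional.of_injective f fun x y h => Subtype.ext ?_
    have h' : incl hp x = incl hp y := congrArg (fun z : S (N + j) => (z : C)) h
    exact incl_injective hp h'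
  dense := by
    refine Metric.dense_iff.mpr fun x ε hε => ?_
    obtain ⟨i, hi, y, hy, hyx⟩ := hS.exists_approx (incl hp x) hε N
    have hpp : p * p = p := hp.isIdempotentElem
    have hz : p * (p * y * p) * p = p * y * p := by
      rw [← mul_assoc, ← mul_assoc, hpp, mul_assoc, hpp]
    obtain ⟨j, rfl⟩ := Nat.exists_eq_add_of_le hi
    have hpN := hS.mono hi hN
    refine ⟨mk hp (p * y * p) hz, ?_, Set.mem_iUnion.mpr ⟨j, mul_mem (mul_mem hpN hy) hpN⟩⟩
    rw [Metric.mem_ball, dist_eq_norm, ← norm_incl, map_sub, incl_mk]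
    have h1 : p * y * p - incl hp x = p * (y - incl hp x) * p := by
      rw [mul_sub, sub_mul, mul_incl, incl_mul]
    rw [h1]
    exact (norm_mul_mul_le_of_proj hp hp).trans_lt hyx

end Corner

end Corner

/-! ### Matrix algebras over AF algebras -/

section MatrixChain

variable {A : Type*} [CStarAlgebra A] {m : Type*} [Fintype m] [DecidableEq m]

/-- The C*-algebra of matrices over a C*-algebra. -/
instance matrixCStarAlgebra : CStarAlgebra (CStarMatrix m m A) :=
  letI : PartialOrder A := CStarAlgebra.spectralOrder A
  letI : StarOrderedRing A := CStarAlgebra.spectralOrderedRing A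
  CStarMatrix.instCStarAlgebra

/-- The star subalgebras of a C*-algebra. -/
abbrev StarSubalgebraOf (B : Type*) [CStarAlgebra B] : Type _ := StarSubalgebra ℂ B

/-- The matrices with entries in a star subalgebra. -/
def matrixSubalgebra (m : Type*) [Fintype m] [DecidableEq m] (S : StarSubalgebra ℂ A) :
    StarSubalgebraOf (CStarMatrix m m A) where
  carrier := {M | ∀ i j, M i j ∈ S}
  mul_mem' {a b} ha hb i j := by
    change (∑ k, a i k * b k j) ∈ S
    exact sum_mem fun k _ => mul_mem (ha i k) (hb k j)
  add_mem' {a b} ha hb i j := add_mem (ha i j) (hb i j)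
  algebraMap_mem' c i j := by
    change algebraMap ℂ (CStarMatrix m m A) c i j ∈ S
    rw [CStarMatrix.algebraMap_apply]
    split_ifs
    · exact algebraMap_mem S c
    · exact zero_mem S
  star_mem' {a} ha i j := star_mem (ha j i)

/-- Approximation is entrywise, because assembling entries into a matrix is continuous for the
C*-norm. -/
theorem IsAFChain.matrix {S : ℕ → StarSubalgebra ℂ A} (hS : IsAFChain S) (m : Type*) [Fintype m]
    [DecidableEq m] : IsAFChain fun j => matrixSubalgebra m (S j) where
  mono i j hij M hM k l := hS.mono hij (hM k l)
  fin j := by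
    have := hS.fin j
    let f : matrixSubalgebra m (S j) →ₗ[ℂ] (m → m → S j) :=
      { toFun := fun M k l => ⟨(M : CStarMatrix m m A) k l, M.2 k l⟩
        map_add' := fun _ _ => rfl
        map_smul' := fun _ _ => rfl }
    refine FiniteDimensional.of_injective f fun M N h => Subtype.ext ?_
    ext k l
    exact congrArg (fun g : m → m → S j => (g k l : A)) h
  dense := by
    refine Metric.dense_iff.mpr fun M ε hε => ?_
    let f : (m → m → A) → CStarMatrix m m A := fun N => CStarMatrix.ofMatrix (Matrix.of N)
    have hf : Continuous f :=
      (CStarMatrix.ofMatrixL (m := m) (n := m) (A := A)).continuous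
    obtain ⟨δ, hδ, h⟩ := Metric.continuous_iff.mp hf M ε hε
    choose k _ x hx hxd using fun p : m × m => hS.exists_approx (M p.1 p.2) hδ 0
    refine ⟨f fun i j => x (i, j), h _ ?_, Set.mem_iUnion.mpr ⟨Finset.univ.sup k, fun i j => ?_⟩⟩
    · refine (dist_pi_lt_iff hδ).mpr fun i => (dist_pi_lt_iff hδ).mpr fun j => ?_
      rw [dist_eq_norm]
      exact hxd (i, j)
    · exact hS.mono (Finset.le_sup (f := k) (Finset.mem_univ (i, j))) (hx (i, j))

end MatrixChain

/-! ### Cancellation -/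

section Cancellation

variable {A : Type*} [Ring A] [StarRing A] {k l m n : Type*} [Fintype k] [Fintype l] [Fintype m]
  [Fintype n]

theorem mvNEquiv_blockSum_zero_right {p : Matrix m m A} (hp : IsStarProjection p) (n : Type*)
    [Fintype n] : MvNEquiv p (blockSum p (0 : Matrix n n A)) := by
  have h1 : p.conjTranspose = p := hp.isSelfAdjoint
  have h2 : p * p = p := hp.isIdempotentElem
  refine ⟨Matrix.fromRows p 0, ?_, ?_⟩
  · rw [Matrix.conjTranspose_fromRows_eq_fromCols_conjTranspose, Matrix.fromCols_mul_fromRows]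
    simp [h1, h2]
  · rw [Matrix.conjTranspose_fromRows_eq_fromCols_conjTranspose, Matrix.fromRows_mul_fromCols]
    simp [h1, h2, blockSum]

theorem mvNEquiv_blockSum_zero_left {p : Matrix m m A} (hp : IsStarProjection p) (n : Type*)
    [Fintype n] : MvNEquiv p (blockSum (0 : Matrix n n A) p) := by
  have h1 : p.conjTranspose = p := hp.isSelfAdjoint
  have h2 : p * p = p := hp.isIdempotentElem
  refine ⟨Matrix.fromRows 0 p, ?_, ?_⟩
  · rw [Matrix.conjTranspose_fromRows_eq_fromCols_conjTranspose, Matrix.fromCols_mul_fromRows]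
    simp [h1, h2]
  · rw [Matrix.conjTranspose_fromRows_eq_fromCols_conjTranspose, Matrix.fromRows_mul_fromCols]
    simp [h1, h2, blockSum]

/-- The row with blocks `1 - p` and `p` implements the equivalence. -/
theorem mvNEquiv_one_sub_blockSum [DecidableEq m] {p : Matrix m m A} (hp : IsStarProjection p) :
    MvNEquiv (blockSum (1 - p) p) (1 : Matrix m m A) := by
  have h1 : p.conjTranspose = p := hp.isSelfAdjoint
  have h2 : p * p = p := hp.isIdempotentElem
  refine ⟨Matrix.fromCols (1 - p) p, ?_, ?_⟩
  · rw [Matrix.conjTranspose_fromCols_eq_fromRows_conjTranspose, Matrix.fromRows_mul_fromCols]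
    simp [h1, h2, blockSum, sub_mul, mul_sub]
  · rw [Matrix.conjTranspose_fromCols_eq_fromRows_conjTranspose, Matrix.fromCols_mul_fromRows]
    simp [h1, h2, sub_mul, mul_sub]

theorem one_sub_blockSum [DecidableEq m] [DecidableEq n] (p : Matrix m m A) (q : Matrix n n A) :
    1 - blockSum p q = blockSum (1 - p) (1 - q) := by
  ext (i | i) (j | j) <;> simp [blockSum, Matrix.one_apply]

/-- In a ring in which equivalent projections have equivalent complements, orthogonal summands
can be cancelled. -/
theorem MvNEquiv.cancel [DecidableEq l] [DecidableEq m] [DecidableEq n]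
    (hcompl : ∀ p q : Matrix ((m ⊕ n) ⊕ l) ((m ⊕ n) ⊕ l) A, IsStarProjection p →
      IsStarProjection q → MvNEquiv p q → MvNEquiv (1 - p) (1 - q))
    {p : Matrix m m A} {q : Matrix n n A} {r : Matrix l l A} (hp : IsStarProjection p)
    (hq : IsStarProjection q) (hr : IsStarProjection r)
    (h : MvNEquiv (_root_.blockSum p r) (_root_.blockSum q r)) : MvNEquiv p q := by
  -- Padding by zeros brings `p` and `q` to a common size, so that complements can be compared.
  have hp' := isStarProjection_blockSum hp (IsStarProjection.zero (Matrix n n A))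
  have hq' := isStarProjection_blockSum (IsStarProjection.zero (Matrix m m A)) hq
  have hpp := mvNEquiv_blockSum_zero_right hp n
  have hqq := mvNEquiv_blockSum_zero_left hq m
  set p' := _root_.blockSum p (0 : Matrix n n A)
  set q' := _root_.blockSum (0 : Matrix m m A) q
  have hpr := isStarProjection_blockSum hp' hr
  have hqr := isStarProjection_blockSum hq' hr
  have h1 : MvNEquiv (_root_.blockSum p' r) (_root_.blockSum q' r) :=
    (hpp.symm.blockSum (.refl hr)).trans hpr hqr
      (h.trans (isStarProjection_blockSum hp hr) hqr (hqq.blockSum (.refl hr)))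
  -- Complements are taken twice. Adding `r` to the complement of `p' ⊕ r` gives `(1 - p') ⊕ 1` up
  -- to equivalence, and the complement of the latter is `p' ⊕ 0`, from which `r` has disappeared.
  have h2 := hcompl _ _ hpr hqr h1
  have key : ∀ x : Matrix (m ⊕ n) (m ⊕ n) A, IsStarProjection x →
      MvNEquiv (_root_.blockSum (1 - _root_.blockSum x r) r)
        (_root_.blockSum (1 - x) (1 : Matrix l l A)) := fun x hx => by
    have h3 := isStarProjection_blockSum (isStarProjection_blockSum hx.one_sub hr.one_sub) hr
    have h4 := mvNEquiv_reindex h3 (Equiv.sumAssoc _ _ _)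
    rw [blockSum_assoc_reindex] at h4
    rw [one_sub_blockSum]
    exact h4.trans h3 (isStarProjection_blockSum hx.one_sub (.one _))
      ((MvNEquiv.refl hx.one_sub).blockSum (mvNEquiv_one_sub_blockSum hr))
  have hp1 := isStarProjection_blockSum hp'.one_sub (IsStarProjection.one (Matrix l l A))
  have hq1 := isStarProjection_blockSum hq'.one_sub (IsStarProjection.one (Matrix l l A))
  have h5 : MvNEquiv (_root_.blockSum (1 - p') (1 : Matrix l l A))
      (_root_.blockSum (1 - q') (1 : Matrix l l A)) :=
    (key p' hp').symm.trans hp1 hq1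
      ((h2.blockSum (.refl hr)).trans (isStarProjection_blockSum hpr.one_sub hr) hq1 (key q' hq'))
  have h6 := hcompl _ _ hp1 hq1 h5
  simp only [one_sub_blockSum, sub_sub_cancel, sub_self] at h6
  have hp0 := mvNEquiv_blockSum_zero_right hp' l
  have hq0 := mvNEquiv_blockSum_zero_right hq' l
  exact (hpp.trans hp (isStarProjection_blockSum hp' (.zero _)) hp0).trans hp hq
    (h6.trans (isStarProjection_blockSum hp' (.zero _)) hq
      (hq0.symm.trans (isStarProjection_blockSum hq' (.zero _)) hq hqq.symm))

end Cancellation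

/-! ### Equality in `K₀` of an AF algebra -/

section KZero

variable {A : Type*} [CStarAlgebra A] {S : ℕ → StarSubalgebra ℂ A}

theorem IsAFChain.mvNEquiv_one_sub (hS : IsAFChain S) {m : Type*} [Fintype m] [DecidableEq m]
    {p q : Matrix m m A} (hp : IsStarProjection p) (hq : IsStarProjection q)
    (h : MvNEquiv p q) : MvNEquiv (1 - p) (1 - q) :=
  (hS.matrix m).projEquiv_one_sub (e := CStarMatrix.ofMatrix p) (f := CStarMatrix.ofMatrix q)
    ⟨hp.isIdempotentElem, hp.isSelfAdjoint⟩ ⟨hq.isIdempotentElem, hq.isSelfAdjoint⟩ h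

/-- Equal classes in the Grothendieck group become equivalent after adding some projection `r`,
which is then cancelled. -/
theorem IsAFChain.mvNEquiv_of_cls_eq (hS : IsAFChain S) {p q : MatProj A}
    (h : KZero.cls p = KZero.cls q) : MvNEquiv p.val q.val := by
  obtain ⟨⟨c, hc'⟩, hc⟩ :=
    (AddLocalization.addMonoidOf (⊤ : AddSubmonoid (ProjClass A))).eq_iff_exists.mp h
  induction c using Quotient.inductionOn with
  | h r =>
    have h1 : MvNEquiv (r.add p).val (r.add q).val := Quotient.exact hc
    have h2 : ∀ s : MatProj A, MvNEquiv (_root_.blockSum s.val r.val) (r.add s).val := fun s =>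
      (MatProj.blockSum_equiv_add s r).trans (isStarProjection_blockSum s.isProj r.isProj)
        (r.add s).isProj (MatProj.add_comm_equiv s r)
    have hp := isStarProjection_blockSum p.isProj r.isProj
    have hq := isStarProjection_blockSum q.isProj r.isProj
    exact MvNEquiv.cancel (fun _ _ h1 h2 => hS.mvNEquiv_one_sub h1 h2) p.isProj q.isProj r.isProj
      ((h2 p).trans hp hq (h1.trans (r.add p).isProj hq (h2 q).symm))

end KZero

/-! ### The vector of traces of a projection -/

section TraceVector

variable {A : Type*} [CStarAlgebra A] {n : ℕ} {k l m : Type*} [Fintype k] [Fintype l] [Fintype m]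

/-- The linear map with the extremal traces as coordinates. -/
def extremalTraces (φ : Fin n ≃ ExtremalTrace A) : A →ₗ[ℂ] (Fin n → ℂ) :=
  LinearMap.pi fun i => ((φ i).1 : A →ₗ[ℂ] ℂ)

theorem continuous_extremalTraces (φ : Fin n ≃ ExtremalTrace A) :
    Continuous (extremalTraces φ) :=
  continuous_pi fun i => (φ i).1.continuous

theorem extremalTraces_mul_comm (φ : Fin n ≃ ExtremalTrace A) (a b : A) :
    extremalTraces φ (a * b) = extremalTraces φ (b * a) :=
  funext fun i => (φ i).2.1.1 a b

/-- The values of the extremal traces on a matrix. -/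
def traceVector (φ : Fin n ≃ ExtremalTrace A) (m : Type*) [Fintype m] :
    Matrix m m A →ₗ[ℂ] (Fin n → ℂ) :=
  extremalTraces φ ∘ₗ Matrix.traceLinearMap m ℂ A

variable (φ : Fin n ≃ ExtremalTrace A)

theorem traceVector_apply (x : Matrix m m A) (i : Fin n) :
    traceVector φ m x i = matTrace ((φ i).1 : A →ₗ[ℂ] ℂ) x := rfl

theorem traceVector_eq_sum (x : Matrix m m A) :
    traceVector φ m x = ∑ i, extremalTraces φ (x i i) := by
  change extremalTraces φ (∑ i, x i i) = _
  rw [map_sum]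

theorem traceVector_mul_comm (a : Matrix m k A) (b : Matrix k m A) :
    traceVector φ m (a * b) = traceVector φ k (b * a) := by
  simp only [traceVector_eq_sum, Matrix.mul_apply, map_sum]
  rw [Finset.sum_comm]
  exact Finset.sum_congr rfl fun i _ => Finset.sum_congr rfl fun j _ =>
    extremalTraces_mul_comm φ _ _

theorem MvNEquiv.traceVector_eq {p : Matrix m m A} {q : Matrix k k A} (h : MvNEquiv p q) :
    traceVector φ m p = traceVector φ k q := by
  obtain ⟨v, rfl, rfl⟩ := h
  exact traceVector_mul_comm φ _ _

theorem traceVector_blockSum (p : Matrix m m A) (q : Matrix k k A) :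
    traceVector φ (m ⊕ k) (blockSum p q) = traceVector φ m p + traceVector φ k q := by
  simp [traceVector_eq_sum, blockSum]

/-- The real parts of the values of the extremal traces on a matrix. -/
def realTraceVector (x : Matrix m m A) : Fin n → ℝ := fun i => (traceVector φ m x i).re

open scoped ComplexOrder in
theorem traceVector_nonneg {p : Matrix m m A} (hp : IsStarProjection p) (i : Fin n) :
    0 ≤ traceVector φ m p i := by
  have h1 : p.conjTranspose = p := hp.isSelfAdjoint
  have h2 : p * p = p := hp.isIdempotentElem
  rw [← h2]
  nth_rw 1 [← h1]
  rw [traceVector_eq_sum, Finset.sum_apply]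
  refine Finset.sum_nonneg fun j _ => ?_
  rw [Matrix.mul_apply, map_sum, Finset.sum_apply]
  exact Finset.sum_nonneg fun j _ => (φ i).2.1.2.1 _

/-- Traces of projections are nonnegative, so taking real parts loses nothing. -/
theorem ofReal_realTraceVector {p : Matrix m m A} (hp : IsStarProjection p) (i : Fin n) :
    (realTraceVector φ p i : ℂ) = traceVector φ m p i := by
  have h := (Complex.le_def.mp (traceVector_nonneg φ hp i)).2
  exact Complex.ext (Complex.ofReal_re _) ((Complex.ofReal_im _).trans h)

theorem traceVector_eq_iff {p : Matrix m m A} {q : Matrix k k A} (hp : IsStarProjection p)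
    (hq : IsStarProjection q) :
    traceVector φ m p = traceVector φ k q ↔ realTraceVector φ p = realTraceVector φ q :=
  ⟨fun h => funext fun i => congrArg Complex.re (congrFun h i), fun h => funext fun i => by
    rw [← ofReal_realTraceVector φ hp, ← ofReal_realTraceVector φ hq, h]⟩

theorem MvNEquiv.realTraceVector_eq {p : Matrix m m A} {q : Matrix k k A} (h : MvNEquiv p q) :
    realTraceVector φ p = realTraceVector φ q :=
  funext fun i => congrArg Complex.re (congrFun (h.traceVector_eq φ) i)

theorem realTraceVector_blockSum (p : Matrix m m A) (q : Matrix k k A) :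
    realTraceVector φ (blockSum p q) = realTraceVector φ p + realTraceVector φ q := by
  funext i
  simp [realTraceVector, traceVector_blockSum]

theorem realTraceVector_blockDiagonal [DecidableEq l] (p : Matrix m m A) :
    realTraceVector φ (Matrix.blockDiagonal fun _ : l => p) =
      Fintype.card l • realTraceVector φ p := by
  funext i
  simp [realTraceVector, traceVector, Matrix.trace_blockDiagonal, -nsmul_eq_mul,
    Complex.re_nsmul]

theorem traceVector_blockDiagonal' {ι : Type*} [Fintype ι] [DecidableEq ι] {s : ι → Type*}
    [∀ i, Fintype (s i)] (p : ∀ i, Matrix (s i) (s i) A) :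
    traceVector φ _ (Matrix.blockDiagonal' p) = ∑ i, traceVector φ _ (p i) := by
  simp [traceVector, Matrix.trace_blockDiagonal']

theorem gammaMap_cls (p : MatProj A) : gammaMap φ (KZero.cls p) = realTraceVector φ p.val := by
  funext i
  exact DFunLike.congr_fun (Algebra.GrothendieckAddGroup.lift.symm_apply_apply
    (traceOnClasses ((φ i).1 : A →ₗ[ℂ] ℂ) (φ i).2.1.1)) (ProjClass.mk p)

theorem exists_matProj {p : Matrix m m A} (hp : IsStarProjection p) :
    ∃ q : MatProj A, MvNEquiv p q.val :=
  ⟨⟨_, _, isStarProjection_reindex hp (Fintype.equivFin m)⟩, mvNEquiv_reindex hp _⟩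

theorem KZero.exists_sub (g : KZero A) : ∃ p q : MatProj A, g = KZero.cls p - KZero.cls q := by
  induction g using AddLocalization.ind with
  | H y =>
    obtain ⟨x, ⟨y, hy⟩⟩ := y
    induction x, y using Quotient.inductionOn₂ with
    | h p q =>
      refine ⟨p, q, ?_⟩
      have h := Algebra.GrothendieckAddGroup.mk_sub_mk (ProjClass.mk p) (ProjClass.mk q) 0 0
      change _ = AddLocalization.mk (ProjClass.mk p) 0 - AddLocalization.mk (ProjClass.mk q) 0
      rw [h]
      simp
      rfl

theorem realTraceVector_mem_range {p : Matrix m m A} (hp : IsStarProjection p) :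
    realTraceVector φ p ∈ (gammaMap φ).range := by
  obtain ⟨q, hq⟩ := exists_matProj hp
  exact ⟨KZero.cls q, by rw [gammaMap_cls, hq.realTraceVector_eq φ]⟩

end TraceVector

/-! ### Projections over an algebra with embedded `K₀` -/

namespace IsEmbeddingOn

variable {A : Type*} [CStarAlgebra A] {n : ℕ} {φ : Fin n ≃ ExtremalTrace A}
  {C : Set (Fin n → ℝ)} {S : ℕ → StarSubalgebra ℂ A} {k l m : Type*} [Fintype k] [Fintype l]
  [Fintype m]

/-- Injectivity of `Γ` turns equal trace vectors into equal classes, and cancellation turns equal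
classes into equivalence. -/
theorem mvNEquiv (hΓ : IsEmbeddingOn φ C) (hS : IsAFChain S) {p : Matrix m m A}
    {q : Matrix k k A} (hp : IsStarProjection p) (hq : IsStarProjection q)
    (h : realTraceVector φ p = realTraceVector φ q) : MvNEquiv p q := by
  obtain ⟨p', hp'⟩ := exists_matProj hp
  obtain ⟨q', hq'⟩ := exists_matProj hq
  have h1 : KZero.cls p' = KZero.cls q' := hΓ.1 (by
    rw [gammaMap_cls, gammaMap_cls, ← hp'.realTraceVector_eq φ, h, hq'.realTraceVector_eq φ])
  exact hp'.trans hp hq ((hS.mvNEquiv_of_cls_eq h1).trans p'.isProj hq hq'.symm)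

theorem realTraceVector_mem (hΓ : IsEmbeddingOn φ C) {p : Matrix m m A}
    (hp : IsStarProjection p) : realTraceVector φ p ∈ C := by
  obtain ⟨q, hq⟩ := exists_matProj hp
  rw [hq.realTraceVector_eq φ, ← gammaMap_cls]
  exact (hΓ.2.1 _).mp ⟨q, rfl⟩

theorem exists_realTraceVector_eq (hΓ : IsEmbeddingOn φ C) {x : Fin n → ℝ} (hx : x ∈ C)
    (hx' : x ∈ (gammaMap φ).range) : ∃ q : MatProj A, realTraceVector φ q.val = x := by
  obtain ⟨g, rfl⟩ := hx'
  obtain ⟨q, rfl⟩ := (hΓ.2.1 g).mpr hx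
  exact ⟨q, (gammaMap_cls φ q).symm⟩

/-- Every projection is equivalent to a subprojection of a multiple of a projection with
strictly positive traces. -/
theorem exists_subordinate (hΓ : IsEmbeddingOn φ C) (hS : IsAFChain S)
    (hC : ∀ x : Fin n → ℝ, (∀ i, 0 < x i) → x ∈ C) {p : Matrix k k A} {q : Matrix m m A}
    (hp : IsStarProjection p) (hq : IsStarProjection q) (hpos : ∀ i, 0 < realTraceVector φ p i) :
    ∃ (l : ℕ) (v : Matrix (k × Fin l) m A), v.conjTranspose * v = q ∧
      Matrix.blockDiagonal (fun _ : Fin l => p) * v = v ∧ v * q = v := by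
  have h1 : p.conjTranspose = p := hp.isSelfAdjoint
  have h2 : p * p = p := hp.isIdempotentElem
  have h3 : q.conjTranspose = q := hq.isSelfAdjoint
  have h4 : q * q = q := hq.isIdempotentElem
  -- A multiplicity `l` beyond all these ratios makes `l` times the vector of `p` minus that of `q`
  -- strictly positive. The difference is then realised by a projection `r`, and `q ⊕ r` is
  -- equivalent to the sum of `l` copies of `p`.
  choose l' hl' using fun i => exists_nat_gt (realTraceVector φ q i / realTraceVector φ p i)
  set l := Finset.univ.sup l'
  have hl : ∀ i, 0 < (l • realTraceVector φ p - realTraceVector φ q) i := fun i => by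
    have h5 : (l' i : ℝ) ≤ l := Nat.cast_le.mpr (Finset.le_sup (Finset.mem_univ i))
    have h6 := (div_lt_iff₀ (hpos i)).mp ((hl' i).trans_le h5)
    simpa using h6
  obtain ⟨r, hr⟩ := hΓ.exists_realTraceVector_eq (hC _ hl)
    (sub_mem (nsmul_mem (realTraceVector_mem_range φ hp) l) (realTraceVector_mem_range φ hq))
  have hP : IsStarProjection (Matrix.blockDiagonal fun _ : Fin l => p) :=
    ⟨by rw [IsIdempotentElem, ← Matrix.blockDiagonal_mul, h2], by
      change Matrix.conjTranspose _ = _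
      rw [Matrix.blockDiagonal_conjTranspose, h1]⟩
  obtain ⟨V, hV1, hV2⟩ := hΓ.mvNEquiv hS (isStarProjection_blockSum hq r.isProj) hP (by
    rw [realTraceVector_blockSum, hr, realTraceVector_blockDiagonal, Fintype.card_fin]
    abel)
  have h7 : blockSum q r.val * Matrix.fromRows q (0 : Matrix (Fin r.size) m A) =
      Matrix.fromRows q 0 := by
    rw [blockSum, Matrix.fromBlocks_mul_fromRows]
    simp [h4]
  let W : Matrix (m ⊕ Fin r.size) m A := Matrix.fromRows q 0
  have h8 : (V * W).conjTranspose * (V * W) = q := by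
    rw [Matrix.conjTranspose_mul, Matrix.mul_assoc, ← Matrix.mul_assoc _ V, hV1, h7,
      Matrix.conjTranspose_fromRows_eq_fromCols_conjTranspose, Matrix.fromCols_mul_fromRows]
    simp [h3, h4]
  have h9 : W * q = W := by
    rw [Matrix.fromRows_mul, h4, Matrix.zero_mul]
  refine ⟨l, V * W, h8, ?_, by rw [Matrix.mul_assoc, h9]⟩
  rw [← hV2, Matrix.mul_assoc, ← Matrix.mul_assoc _ V, hV1, h7]

/-- A partition of the traces of a projection lifts to a partition of the projection. -/
theorem exists_partition (hΓ : IsEmbeddingOn φ C) (hS : IsAFChain S) {ι : Type*} [Fintype ι]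
    (q : ι → MatProj A) {p : Matrix k k A} (hp : IsStarProjection p)
    (h : traceVector φ k p = ∑ i, traceVector φ _ (q i).val) :
    ∃ f : ι → Matrix k k A, (∀ i, IsStarProjection (f i)) ∧ (∀ i j, i ≠ j → f i * f j = 0) ∧
      ∑ i, f i = p ∧ (∀ i, p * f i * p = f i) ∧
      ∀ i, traceVector φ k (f i) = traceVector φ _ (q i).val := by
  classical
  -- The sum `E` of the `q i` has the traces of `p`, hence is equivalent to it. The partial isometry
  -- carries the diagonal summands `G i` of `E` to the required partition of `p`.
  set E := Matrix.blockDiagonal' fun i => (q i).val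
  let G : ι → Matrix (Σ i, Fin (q i).size) (Σ i, Fin (q i).size) A := fun i =>
    Matrix.blockDiagonal' (Pi.single i (q i).val)
  have hGs : ∀ i, (G i).conjTranspose = G i := fun i => by
    rw [Matrix.blockDiagonal'_conjTranspose]
    congr 1
    funext j
    obtain rfl | hj := eq_or_ne j i
    · rw [Pi.single_eq_same]
      exact (q j).isProj.isSelfAdjoint
    · rw [Pi.single_eq_of_ne hj, Matrix.conjTranspose_zero]
  have hG2 : ∀ i, G i * G i = G i := fun i => by
    rw [← Matrix.blockDiagonal'_mul]
    congr 1
    funext j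
    obtain rfl | hj := eq_or_ne j i
    · rw [Pi.single_eq_same]
      exact (q j).isProj.isIdempotentElem
    · rw [Pi.single_eq_of_ne hj, Matrix.zero_mul]
  have hG0 : ∀ i j, i ≠ j → G i * G j = 0 := fun i j hij => by
    rw [← Matrix.blockDiagonal'_mul, ← Matrix.blockDiagonal'_zero]
    congr 1
    funext x
    obtain rfl | hj := eq_or_ne x i
    · rw [Pi.single_eq_of_ne hij, Matrix.mul_zero, Pi.zero_apply]
    · rw [Pi.single_eq_of_ne hj, Matrix.zero_mul, Pi.zero_apply]
  have hGE : ∑ i, G i = E := by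
    have := map_sum (Matrix.blockDiagonal'AddMonoidHom (fun i => Fin (q i).size)
      (fun i => Fin (q i).size) A) (fun i => Pi.single i (q i).val) Finset.univ
    rw [Finset.univ_sum_single] at this
    exact this.symm
  have hE : IsStarProjection E :=
    ⟨by
      rw [IsIdempotentElem, ← Matrix.blockDiagonal'_mul]
      exact congrArg Matrix.blockDiagonal' (funext fun i => (q i).isProj.isIdempotentElem), by
      change Matrix.conjTranspose _ = _
      rw [Matrix.blockDiagonal'_conjTranspose]
      exact congrArg Matrix.blockDiagonal' (funext fun i => (q i).isProj.isSelfAdjoint)⟩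
  have hGE1 : ∀ i, G i * E = G i := fun i => by
    rw [← hGE, Finset.mul_sum, Finset.sum_eq_single i (fun j _ hj => hG0 i j hj.symm) (by simp),
      hG2]
  have hGE2 : ∀ i, E * G i = G i := fun i => by
    rw [← hGE, Finset.sum_mul, Finset.sum_eq_single i (fun j _ hj => hG0 j i hj) (by simp), hG2]
  obtain ⟨v, hv1, hv2⟩ := hΓ.mvNEquiv hS hE hp ((traceVector_eq_iff φ hE hp).mp (by
    rw [h, traceVector_blockDiagonal']))
  have hmul : ∀ x y : Matrix (Σ i, Fin (q i).size) (Σ i, Fin (q i).size) A,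
      v * x * v.conjTranspose * (v * y * v.conjTranspose) = v * (x * E * y) * v.conjTranspose :=
    fun x y => by
      rw [← hv1]
      simp only [Matrix.mul_assoc]
  have hpE : v * E * v.conjTranspose = p := by
    rw [← hv1, ← Matrix.mul_assoc, hv2, Matrix.mul_assoc, hv2]
    exact hp.isIdempotentElem
  obtain ⟨f, hf⟩ : ∃ f : ι → Matrix k k A, ∀ i, f i = v * G i * v.conjTranspose := ⟨_, fun _ => rfl⟩
  refine ⟨f, fun i => ⟨?_, ?_⟩, fun i j hij => ?_, ?_, fun i => ?_, fun i => ?_⟩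
  · rw [IsIdempotentElem, hf, hmul, hGE1, hG2]
  · change Matrix.conjTranspose _ = _
    simp only [hf, Matrix.conjTranspose_mul, Matrix.conjTranspose_conjTranspose, hGs,
      Matrix.mul_assoc]
  · rw [hf, hf, hmul, hGE1, hG0 i j hij, Matrix.mul_zero, Matrix.zero_mul]
  · rw [Finset.sum_congr rfl fun i _ => hf i, ← Matrix.sum_mul, ← Matrix.mul_sum, hGE, hpE]
  · rw [hf, ← hpE, hmul, hmul, Matrix.mul_assoc E, hGE2, hGE2, hGE1, hGE1]
  · rw [hf, Matrix.mul_assoc, traceVector_mul_comm, Matrix.mul_assoc, hv1, hGE1,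
      traceVector_blockDiagonal',
      Finset.sum_eq_single i (fun j _ hj => by rw [Pi.single_eq_of_ne hj, map_zero]) (by simp),
      Pi.single_eq_same]

end IsEmbeddingOn

/-! ### Corner embeddings -/

section CornerEmbedding

variable {A : Type*} [CStarAlgebra A] {n : ℕ} {φ : Fin n ≃ ExtremalTrace A}
  {C : Set (Fin n → ℝ)} {S : ℕ → StarSubalgebra ℂ A} {k m : Type*} [Fintype k] [Fintype m]

/-- The partial isometry into `l` copies of `p` is cut into its `l` row blocks. In this form it
shows both that `p` is full and that `q` can be moved into matrices over the corner of `p`. -/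
theorem IsEmbeddingOn.exists_subordinate_family (hΓ : IsEmbeddingOn φ C) (hS : IsAFChain S)
    (hC : ∀ x : Fin n → ℝ, (∀ i, 0 < x i) → x ∈ C) {p : Matrix k k A} {q : Matrix m m A}
    (hp : IsStarProjection p) (hq : IsStarProjection q) (hpos : ∀ i, 0 < realTraceVector φ p i) :
    ∃ (l : ℕ) (v : Fin l → Matrix k m A), ∑ x, (v x).conjTranspose * v x = q ∧
      (∀ x, p * v x = v x) ∧ ∀ x, v x * q = v x := by
  obtain ⟨l, v, h1, h2, h3⟩ := hΓ.exists_subordinate hS hC hp hq hpos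
  refine ⟨l, fun x => Matrix.of fun a j => v (a, x) j, ?_, fun x => ?_, fun x => ?_⟩
  · rw [← h1]
    ext i j
    simp only [Matrix.sum_apply, Matrix.mul_apply, Matrix.conjTranspose_apply, Matrix.of_apply]
    rw [Fintype.sum_prod_type_right]
  · ext a j
    have h := congrFun (congrFun h2 (a, x)) j
    rw [Matrix.mul_apply, Fintype.sum_prod_type] at h
    simpa [Matrix.mul_apply, Matrix.blockDiagonal_apply] using h
  · ext a j
    exact congrFun (congrFun h3 (a, x)) j

/-- A star isomorphism onto the corner of a matrix algebra by a projection. -/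
structure IsCornerEmbedding {B : Type*} [Ring B] [StarRing B] [Algebra ℂ B] (p : Matrix k k A)
    (Ψ : B →⋆ₙₐ[ℂ] Matrix k k A) : Prop where
  isProj : IsStarProjection p
  injective : Function.Injective Ψ
  exists_eq : ∀ x, p * x * p = x → ∃ b, Ψ b = x
  mul_mul : ∀ b, p * Ψ b * p = Ψ b

namespace IsCornerEmbedding

variable {B : Type*} [CStarAlgebra B] {p : Matrix k k A} {Ψ : B →⋆ₙₐ[ℂ] Matrix k k A}

/-- As `p` itself is a value of `Ψ`, it absorbs `Ψ 1`; so `Ψ 1 = p * Ψ 1 * p = p`. -/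
theorem map_one (h : IsCornerEmbedding p Ψ) : Ψ 1 = p := by
  have hpp : p * p = p := h.isProj.isIdempotentElem
  obtain ⟨e, he⟩ := h.exists_eq p (by rw [hpp, hpp])
  have h1 : p * Ψ 1 = p := by rw [← he, ← map_mul, mul_one]
  rw [← h.mul_mul, h1, hpp]

theorem mul_map (h : IsCornerEmbedding p Ψ) (b : B) : p * Ψ b = Ψ b := by
  rw [← h.map_one, ← map_mul, one_mul]

theorem map_mul' (h : IsCornerEmbedding p Ψ) (b : B) : Ψ b * p = Ψ b := by
  rw [← h.map_one, ← map_mul, mul_one]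

theorem isStarProjection_iff (h : IsCornerEmbedding p Ψ) {e : B} :
    IsStarProjection (Ψ e) ↔ IsStarProjection e :=
  ⟨fun he => ⟨h.injective (by rw [map_mul]; exact he.isIdempotentElem),
    h.injective (by rw [map_star]; exact he.isSelfAdjoint)⟩, fun he =>
    ⟨by rw [IsIdempotentElem, ← map_mul, he.isIdempotentElem.eq], by
      rw [IsSelfAdjoint, ← map_star, he.isSelfAdjoint.star_eq]⟩⟩

theorem projEquiv (h : IsCornerEmbedding p Ψ) {e f : B} (he : IsStarProjection e)
    (hf : IsStarProjection f) (hef : MvNEquiv (Ψ e) (Ψ f)) : ProjEquiv e f := by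
  obtain ⟨v, h1, h2⟩ := hef
  have he' : Ψ e * Ψ e = Ψ e := by rw [← map_mul, he.isIdempotentElem.eq]
  have hf' : Ψ f * Ψ f = Ψ f := by rw [← map_mul, hf.isIdempotentElem.eq]
  -- The element equals both `Ψ f * v` and `v * Ψ e`, which puts it in the corner and lets it lift
  -- to `B`.
  have hw : p * (v * (v.conjTranspose * v)) * p = v * (v.conjTranspose * v) := by
    have h3 : v * (v.conjTranspose * v) = Ψ f * v := by rw [← h2, Matrix.mul_assoc]
    rw [h3, ← Matrix.mul_assoc p, h.mul_map, ← h3, h1, Matrix.mul_assoc, h.map_mul']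
  obtain ⟨w, hw⟩ := h.exists_eq _ hw
  refine ⟨w, h.injective ?_, h.injective ?_⟩
  · rw [map_mul, map_star, hw, h1]
    change (v * Ψ e).conjTranspose * (v * Ψ e) = Ψ e
    have h4 : (Ψ e).conjTranspose = Ψ e := by rw [← h1]; simp
    rw [Matrix.conjTranspose_mul, h4, Matrix.mul_assoc, ← Matrix.mul_assoc _ v, h1, he', he']
  · rw [map_mul, map_star, hw, ← Matrix.mul_assoc, h2]
    change (Ψ f * v) * (Ψ f * v).conjTranspose = Ψ f
    have h4 : (Ψ f).conjTranspose = Ψ f := by rw [← h2]; simp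
    rw [Matrix.conjTranspose_mul, h4, Matrix.mul_assoc, ← Matrix.mul_assoc v, h2, hf', hf']

/-- The trace on a corner induced by the extremal traces and a linear map. -/
def traceOf (φ : Fin n ≃ ExtremalTrace A) (Ψ : B →⋆ₙₐ[ℂ] Matrix k k A)
    (K : (Fin n → ℂ) →ₗ[ℂ] (Fin n → ℂ)) : B →ₗ[ℂ] (Fin n → ℂ) where
  toFun b := K (traceVector φ k (Ψ b))
  map_add' a b := by simp only [map_add]
  map_smul' c a := by simp only [map_smul, RingHom.id_apply]

theorem traceOf_apply (K : (Fin n → ℂ) →ₗ[ℂ] (Fin n → ℂ)) (b : B) :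
    traceOf φ Ψ K b = K (traceVector φ k (Ψ b)) := rfl

theorem isCompleteTrace (h : IsCornerEmbedding p Ψ) (hΓ : IsEmbeddingOn φ C) (hS : IsAFChain S)
    {K : (Fin n → ℂ) →ₗ[ℂ] (Fin n → ℂ)} (hK : Function.Injective K) :
    IsCompleteTrace (traceOf φ Ψ K) where
  comm a b := by
    rw [traceOf_apply, traceOf_apply, map_mul Ψ, map_mul Ψ, traceVector_mul_comm]
  complete e f he hf hef := by
    have he' := h.isStarProjection_iff.mpr he
    have hf' := h.isStarProjection_iff.mpr hf
    exact h.projEquiv he hf (hΓ.mvNEquiv hS he' hf' ((traceVector_eq_iff φ he' hf').mp (hK hef)))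

/-- The traces of the given partition are realised by projections `q i`. Injectivity of `K` shows
that their trace vectors add up to that of `p`, and `exists_partition` places them inside the
corner. -/
theorem transfersPartitions (h : IsCornerEmbedding p Ψ) (hΓ : IsEmbeddingOn φ C)
    (hS : IsAFChain S) {K : (Fin n → ℂ) →ₗ[ℂ] (Fin n → ℂ)} (hK : Function.Injective K)
    {B' : Type*} [CStarAlgebra B'] {τ : B' →ₗ[ℂ] (Fin n → ℂ)}
    (hτ : ∀ e, IsStarProjection e → ∃ q : MatProj A, K (traceVector φ _ q.val) = τ e)
    (h1 : K (traceVector φ k p) = τ 1) : TransfersPartitions τ (traceOf φ Ψ K) := by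
  intro N e he _ hsum
  choose q hq using fun i => hτ (e i) (he i)
  obtain ⟨f, hf1, hf2, hf3, hf4, hf5⟩ := hΓ.exists_partition hS q h.isProj (hK (by
    rw [h1, ← hsum, map_sum, map_sum]
    exact (Finset.sum_congr rfl fun i _ => hq i).symm))
  choose g hg using fun i => h.exists_eq (f i) (hf4 i)
  refine ⟨g, fun i => h.isStarProjection_iff.mp (by rw [hg]; exact hf1 i), fun i j hij =>
    h.injective ?_, h.injective ?_, fun i => ?_⟩
  · rw [map_mul, hg, hg, hf2 i j hij, map_zero]
  · rw [map_sum, h.map_one, ← hf3]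
    exact Finset.sum_congr rfl fun i _ => hg i
  · rw [traceOf_apply, hg, hf5, hq]

end IsCornerEmbedding

/-- The inclusion of an algebra as matrices of size one. -/
def unitMatrix (A : Type*) [CStarAlgebra A] : A →⋆ₙₐ[ℂ] Matrix Unit Unit A where
  toFun a := Matrix.of fun _ _ => a
  map_smul' _ _ := rfl
  map_zero' := rfl
  map_add' _ _ := rfl
  map_mul' a b := by
    ext
    simp [Matrix.mul_apply]
  map_star' _ := rfl

theorem isCornerEmbedding_unitMatrix : IsCornerEmbedding 1 (unitMatrix A) where
  isProj := .one _
  injective a b h := congrFun (congrFun h ()) ()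
  exists_eq x _ := ⟨x () (), rfl⟩
  mul_mul b := by rw [Matrix.one_mul, Matrix.mul_one]

theorem traceVector_unitMatrix (a : A) :
    traceVector φ Unit (unitMatrix A a) = extremalTraces φ a := by
  rw [traceVector_eq_sum]
  exact Fintype.sum_unique _

/-- The identity map from the C*-algebra of matrices to the ring of matrices. -/
def cstarMatrixHom (A k : Type*) [CStarAlgebra A] [Fintype k] [DecidableEq k] :
    CStarMatrix k k A →⋆ₙₐ[ℂ] Matrix k k A where
  toFun x := x
  map_smul' _ _ := rfl
  map_zero' := rfl
  map_add' _ _ := rfl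
  map_mul' _ _ := rfl
  map_star' _ := rfl

theorem isCornerEmbedding_incl [DecidableEq k] {p : CStarMatrix k k A} (hp : IsStarProjection p) :
    IsCornerEmbedding (cstarMatrixHom A k p) ((cstarMatrixHom A k).comp (Corner.incl hp)) where
  isProj := ⟨hp.isIdempotentElem, hp.isSelfAdjoint⟩
  injective := Corner.incl_injective hp
  exists_eq x hx := ⟨Corner.mk hp x hx, rfl⟩
  mul_mul b := by
    change p * Corner.incl hp b * p = Corner.incl hp b
    rw [Corner.mul_incl, Corner.incl_mul]

theorem continuous_traceVector [DecidableEq k] :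
    Continuous fun x : CStarMatrix k k A => traceVector φ k (cstarMatrixHom A k x) := by
  simp only [traceVector_eq_sum]
  refine continuous_finsetSum _ fun i _ => (continuous_extremalTraces φ).comp ?_
  have hf : Continuous fun x : CStarMatrix k k A => (CStarMatrix.ofMatrix.symm x : Matrix k k A) :=
    (CStarMatrix.ofMatrixL (m := k) (n := k) (A := A)).symm.continuous
  exact (continuous_apply_apply (ρ := fun _ _ : k => A) i i).comp hf

end CornerEmbedding

/-! ### Amplification of a corner embedding -/

section Amplify

variable {A : Type*} [CStarAlgebra A] {n : ℕ} {φ : Fin n ≃ ExtremalTrace A}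
  {C : Set (Fin n → ℝ)} {S : ℕ → StarSubalgebra ℂ A} {k m : Type*} [Fintype k] [Fintype m]

/-- The map on matrices induced by a homomorphism into matrices. -/
def amplify (Φ : A →⋆ₙₐ[ℂ] Matrix k k A) (x : Matrix m m A) : Matrix (m × k) (m × k) A :=
  Matrix.of fun i j => Φ (x i.1 j.1) i.2 j.2

variable (Φ : A →⋆ₙₐ[ℂ] Matrix k k A)

theorem amplify_mul (x y : Matrix m m A) : amplify Φ (x * y) = amplify Φ x * amplify Φ y := by
  ext ⟨i, s⟩ ⟨j, t⟩
  simp only [amplify, Matrix.of_apply, Matrix.mul_apply, Fintype.sum_prod_type, map_sum, map_mul,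
    Matrix.sum_apply]

theorem amplify_conjTranspose (x : Matrix m m A) :
    amplify Φ x.conjTranspose = (amplify Φ x).conjTranspose := by
  ext ⟨i, s⟩ ⟨j, t⟩
  simp only [amplify, Matrix.of_apply, Matrix.conjTranspose_apply, map_star, Matrix.star_apply]

theorem amplify_injective {Φ : A →⋆ₙₐ[ℂ] Matrix k k A} (hΦ : Function.Injective Φ) :
    Function.Injective (amplify (m := m) Φ) := fun x y h => by
  ext i j
  refine hΦ ?_
  ext s t
  exact congrFun (congrFun h (i, s)) (j, t)

theorem isStarProjection_amplify {q : Matrix m m A} (hq : IsStarProjection q) :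
    IsStarProjection (amplify Φ q) :=
  ⟨by rw [IsIdempotentElem, ← amplify_mul, hq.isIdempotentElem.eq], by
    change Matrix.conjTranspose _ = _
    rw [← amplify_conjTranspose]
    exact congrArg _ hq.isSelfAdjoint⟩

theorem isStarProjection_of_amplify {Φ : A →⋆ₙₐ[ℂ] Matrix k k A} (hΦ : Function.Injective Φ)
    {q : Matrix m m A} (hq : IsStarProjection (amplify Φ q)) : IsStarProjection q :=
  ⟨amplify_injective hΦ (by rw [amplify_mul]; exact hq.isIdempotentElem),
    amplify_injective hΦ (by
      change amplify Φ q.conjTranspose = _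
      rw [amplify_conjTranspose]
      exact hq.isSelfAdjoint)⟩

theorem traceVector_amplify (x : Matrix m m A) :
    traceVector φ (m × k) (amplify Φ x) = ∑ i, traceVector φ k (Φ (x i i)) := by
  simp only [traceVector_eq_sum, Fintype.sum_prod_type]
  rfl

end Amplify

/-! ### The two implications -/

namespace IsEmbeddingOn

variable {A : Type*} [CStarAlgebra A] {n : ℕ} {φ : Fin n ≃ ExtremalTrace A}
  {C : Set (Fin n → ℝ)} {S : ℕ → StarSubalgebra ℂ A} {M : Matrix (Fin n) (Fin n) ℝ}

theorem realTraceVector_one (φ : Fin n ≃ ExtremalTrace A) :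
    realTraceVector φ (1 : Matrix Unit Unit A) = 1 := by
  funext i
  have h : extremalTraces φ (1 : A) i = 1 := (φ i).2.1.2.2
  simp [realTraceVector, traceVector_eq_sum, h]

theorem ofReal_vecMul_realTraceVector {m : Type*} [Fintype m] {q : Matrix m m A}
    (hq : IsStarProjection q) (j : Fin n) :
    ((Matrix.vecMul (realTraceVector φ q) M j : ℝ) : ℂ) =
      Matrix.vecMul (traceVector φ m q) (M.map Complex.ofReal) j := by
  simp [Matrix.vecMul, dotProduct, ofReal_realTraceVector φ hq]

/-- Amplification by `Φ` multiplies trace vectors of projections by `M`, which gives one inclusion.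
The other needs every projection to be equivalent to an amplified one. -/
theorem image_range_eq_of_mem_fundamentalGroup (hΓ : IsEmbeddingOn φ C) (hS : IsAFChain S)
    (hC : ∀ x : Fin n → ℝ, (∀ i, 0 < x i) → x ∈ C)
    (hpos : ∀ x : Fin n → ℝ, (∀ i, 0 < x i) → ∀ i, 0 < Matrix.vecMul x M i)
    (h : M.map Complex.ofReal ∈ fundamentalGroup φ) :
    (fun x : Fin n → ℝ => Matrix.vecMul x M) '' Set.range (gammaMap φ) =
      Set.range (gammaMap φ) := by
  obtain ⟨k, p, Φ, hp, -, ⟨hinj, hrange⟩, htr⟩ := h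
  have hcorner : IsCornerEmbedding p Φ :=
    { isProj := hp
      injective := hinj
      exists_eq := fun x hx => by
        have : x ∈ Set.range Φ := by rw [hrange]; exact hx
        exact this
      mul_mul := fun b => by
        have : Φ b ∈ {x | p * x * p = x} := by rw [← hrange]; exact ⟨b, rfl⟩
        exact this }
  have hΦ : ∀ a, traceVector φ _ (Φ a) =
      Matrix.vecMul (extremalTraces φ a) (M.map Complex.ofReal) := fun a => by
    funext j
    have h1 := LinearMap.congr_fun (htr j) a
    rw [traceVector_apply]
    refine h1.trans ?_
    simp [Matrix.vecMul, dotProduct, extremalTraces, mul_comm]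
  have hamp : ∀ {m : Type} [Fintype m] {q : Matrix m m A}, IsStarProjection q →
      realTraceVector φ (amplify Φ q) = Matrix.vecMul (realTraceVector φ q) M := fun hq => by
    funext j
    refine Complex.ofReal_injective ?_
    rw [ofReal_realTraceVector φ (isStarProjection_amplify Φ hq),
      ofReal_vecMul_realTraceVector hq, traceVector_amplify, traceVector_eq_sum,
      Finset.sum_congr rfl fun i _ => hΦ _, ← Matrix.sum_vecMul]
  -- Because `Φ 1 = p`, the trace vector of `p` is the image under `M` of the all-ones vector.
  have hppos : ∀ i, 0 < realTraceVector φ p i := fun i => by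
    have h1 : realTraceVector φ p = Matrix.vecMul (1 : Fin n → ℝ) M := by
      rw [← realTraceVector_one φ]
      funext j
      refine Complex.ofReal_injective ?_
      rw [ofReal_realTraceVector φ hp, ofReal_vecMul_realTraceVector (.one _),
        ← hcorner.map_one, hΦ, ← traceVector_unitMatrix,
        isCornerEmbedding_unitMatrix.map_one]
    rw [h1]
    exact hpos 1 (fun _ => one_pos) i
  have hsurj : ∀ q : MatProj A, ∃ c : MatProj A,
      Matrix.vecMul (realTraceVector φ c.val) M = realTraceVector φ q.val := fun q => by
    obtain ⟨l, v, h1, h2, h3⟩ := hΓ.exists_subordinate_family hS hC hp q.isProj hppos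
    have h4 : ∀ x, (v x).conjTranspose * p = (v x).conjTranspose := fun x => by
      conv_rhs => rw [← h2 x, Matrix.conjTranspose_mul]
      rw [show p.conjTranspose = p from hp.isSelfAdjoint]
    -- Stacking the `v x` gives `V` with `V* V = q`. The blocks of `V V*` lie in the corner of `p`,
    -- hence in the range of `Φ`, so `V V*` is the amplification of a matrix over `A`, a projection
    -- since `Φ` is injective.
    choose c hc using fun x y => hcorner.exists_eq (v x * (v y).conjTranspose) (by
      rw [← Matrix.mul_assoc, h2, Matrix.mul_assoc, h4])
    let V : Matrix (Fin l × Fin k) (Fin q.size) A := Matrix.of fun i j => v i.1 i.2 j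
    have hV1 : V.conjTranspose * V = q.val := by
      rw [← h1]
      ext i j
      simp only [V, Matrix.sum_apply, Matrix.mul_apply, Matrix.conjTranspose_apply,
        Matrix.of_apply, Fintype.sum_prod_type]
    have hV2 : V * V.conjTranspose = amplify Φ (Matrix.of c) := by
      ext ⟨x, i⟩ ⟨y, j⟩
      simp only [amplify, Matrix.of_apply, hc]
      rfl
    have hV3 : V * q.val = V := by
      ext ⟨x, i⟩ j
      exact congrFun (congrFun (h3 x) i) j
    have hproj : IsStarProjection (amplify Φ (Matrix.of c)) := by
      rw [← hV2]
      refine ⟨?_, ?_⟩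
      · rw [IsIdempotentElem, Matrix.mul_assoc, ← Matrix.mul_assoc _ V, hV1, ← Matrix.mul_assoc,
          hV3]
      · change Matrix.conjTranspose _ = _
        simp
    have hc' := isStarProjection_of_amplify hinj hproj
    refine ⟨⟨l, Matrix.of c, hc'⟩, ?_⟩
    rw [← hamp hc']
    exact (MvNEquiv.realTraceVector_eq φ ⟨V, hV1, hV2⟩).symm
  apply Set.Subset.antisymm
  · rintro _ ⟨_, ⟨g, rfl⟩, rfl⟩
    obtain ⟨a, b, rfl⟩ := KZero.exists_sub g
    simp only [map_sub, gammaMap_cls, Matrix.sub_vecMul, ← hamp a.isProj, ← hamp b.isProj]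
    exact sub_mem (realTraceVector_mem_range φ (isStarProjection_amplify Φ a.isProj))
      (realTraceVector_mem_range φ (isStarProjection_amplify Φ b.isProj))
  · rintro _ ⟨g, rfl⟩
    obtain ⟨a, b, rfl⟩ := KZero.exists_sub g
    obtain ⟨a', ha⟩ := hsurj a
    obtain ⟨b', hb⟩ := hsurj b
    refine ⟨_, ⟨KZero.cls a' - KZero.cls b', rfl⟩, ?_⟩
    simp only [map_sub, gammaMap_cls, Matrix.sub_vecMul, ha, hb]

/-- Elliott's theorem is applied to `A`, with its trace vector multiplied by `M`, and to the corner
of a projection whose trace vector is `(1, …, 1)M`. -/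
theorem mem_fundamentalGroup_of_image_range_eq (hΓ : IsEmbeddingOn φ C) (hS : IsAFChain S)
    (hC : ∀ x : Fin n → ℝ, (∀ i, 0 < x i) → x ∈ C)
    (hpos : ∀ x : Fin n → ℝ, (∀ i, 0 < x i) → ∀ i, 0 < Matrix.vecMul x M i)
    (hMC : ∀ x : Fin n → ℝ, Matrix.vecMul x M ∈ C ↔ x ∈ C) (hM : IsUnit M)
    (h : (fun x : Fin n → ℝ => Matrix.vecMul x M) '' Set.range (gammaMap φ) =
      Set.range (gammaMap φ)) :
    M.map Complex.ofReal ∈ fundamentalGroup φ := by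
  have hrange : ∀ {x}, x ∈ (gammaMap φ).range → Matrix.vecMul x M ∈ (gammaMap φ).range :=
    fun {x} hx => by
      have : Matrix.vecMul x M ∈ Set.range (gammaMap φ) := by
        rw [← h]
        exact ⟨x, hx, rfl⟩
      exact this
  have hrange' : ∀ {y}, y ∈ (gammaMap φ).range →
      ∃ x ∈ (gammaMap φ).range, Matrix.vecMul x M = y := fun {y} hy => by
    have : y ∈ (fun x : Fin n → ℝ => Matrix.vecMul x M) '' Set.range (gammaMap φ) := by
      rw [h]
      exact hy
    exact this
  set K : (Fin n → ℂ) →ₗ[ℂ] (Fin n → ℂ) := Matrix.vecMulLinear (M.map Complex.ofReal)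
  have hK : Function.Injective K :=
    Matrix.vecMul_injective_of_isUnit (hM.map (Complex.ofRealHom.mapMatrix))
  have hKr : ∀ {m : Type} [Fintype m] {q : Matrix m m A} {m' : Type} [Fintype m']
      {q' : Matrix m' m' A}, IsStarProjection q → IsStarProjection q' →
      Matrix.vecMul (realTraceVector φ q) M = realTraceVector φ q' →
      K (traceVector φ m q) = traceVector φ m' q' := fun hq hq' hqq => by
    funext j
    rw [← ofReal_realTraceVector φ hq', ← hqq]
    exact (ofReal_vecMul_realTraceVector hq j).symm
  have h1pos : ∀ i, 0 < Matrix.vecMul (1 : Fin n → ℝ) M i := hpos 1 fun _ => one_pos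
  obtain ⟨r, hr⟩ := hΓ.exists_realTraceVector_eq (hC _ h1pos)
    (hrange (by rw [← realTraceVector_one φ]; exact realTraceVector_mem_range φ (.one _)))
  -- An equivalent projection inside a finite stage is needed for the corner to inherit a chain.
  obtain ⟨N, -, p, hpN, hp, -, hrp, -⟩ := (hS.matrix (Fin r.size)).exists_proj_mem
    (q := (1 : CStarMatrix (Fin r.size) (Fin r.size) A))
    (f := CStarMatrix.ofMatrix r.val) (j := 0) (.one _)
    ⟨r.isProj.isIdempotentElem, r.isProj.isSelfAdjoint⟩ (one_mem _) (mul_one _)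
  set P : Matrix (Fin r.size) (Fin r.size) A := cstarMatrixHom A (Fin r.size) p
  set Ψ := (cstarMatrixHom A (Fin r.size)).comp (Corner.incl hp)
  have hΨ : IsCornerEmbedding P Ψ := isCornerEmbedding_incl hp
  have hP : realTraceVector φ P = Matrix.vecMul 1 M := by
    rw [← hr]
    exact (MvNEquiv.realTraceVector_eq φ hrp).symm
  have hKP : K (traceVector φ Unit 1) = traceVector φ _ P :=
    hKr (.one _) hΨ.isProj (by rw [realTraceVector_one φ, hP])
  have hu : IsCornerEmbedding 1 (unitMatrix A) := isCornerEmbedding_unitMatrix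
  obtain ⟨Θ, hΘ⟩ := exists_starAlgEquiv_of_traces hS (Corner.isAFChain hp (hS.matrix _) hpN)
    (hu.isCompleteTrace hΓ hS hK)
    (hΨ.isCompleteTrace hΓ hS (K := LinearMap.id) Function.injective_id)
    -- From `A` to the corner, trace vectors are multiplied by `M` and stay in the cone and in
    -- `Γ(K₀)`. In the other direction, handled next, they are pulled back by `M`, which needs the
    -- image of `Γ(K₀)` to be all of `Γ(K₀)`.
    (hΨ.transfersPartitions hΓ hS (K := LinearMap.id) Function.injective_id (fun e he => by
      have he' := hu.isStarProjection_iff.mpr he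
      obtain ⟨q, hq⟩ := hΓ.exists_realTraceVector_eq ((hMC _).mpr (hΓ.realTraceVector_mem he'))
        (hrange (realTraceVector_mem_range φ he'))
      exact ⟨q, (hKr he' q.isProj hq.symm).symm⟩)
      (by rw [IsCornerEmbedding.traceOf_apply, hu.map_one, hKP]; rfl))
    (hu.transfersPartitions hΓ hS hK (fun e he => by
      have he' := hΨ.isStarProjection_iff.mpr he
      obtain ⟨x, hx, hxe⟩ := hrange' (realTraceVector_mem_range φ he')
      obtain ⟨q, hq⟩ := hΓ.exists_realTraceVector_eq
        ((hMC x).mp (by rw [hxe]; exact hΓ.realTraceVector_mem he')) hx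
      exact ⟨q, hKr q.isProj he' (by rw [hq, hxe])⟩)
      (by rw [IsCornerEmbedding.traceOf_apply, hΨ.map_one, hKP]; rfl))
    (by
      change Continuous fun a => K (traceVector φ Unit (unitMatrix A a))
      simp only [traceVector_unitMatrix]
      exact (LinearMap.continuous_of_finiteDimensional K).comp (continuous_extremalTraces φ))
    (continuous_traceVector.comp (Corner.continuous_incl hp))
  refine ⟨r.size, P, Ψ.comp (Θ : A →⋆ₙₐ[ℂ] Corner hp), hΨ.isProj, ?_, ⟨?_, ?_⟩, fun j => ?_⟩
  · obtain ⟨l, v, h1, h2, -⟩ := hΓ.exists_subordinate_family hS hC hΨ.isProj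
      (.one (Matrix (Fin r.size) (Fin r.size) A)) (by rw [hP]; exact h1pos)
    -- The unit is a finite sum of terms `v* p v`, so it lies in the ideal generated by the
    -- projection.
    rw [← TwoSidedIdeal.one_mem_iff, ← h1]
    refine sum_mem fun x _ => ?_
    rw [← h2 x]
    exact TwoSidedIdeal.mul_mem_left _ _ _ (TwoSidedIdeal.mul_mem_right _ _ _
      (TwoSidedIdeal.subset_span rfl))
  · exact hΨ.injective.comp Θ.injective
  · ext x
    constructor
    · rintro ⟨a, rfl⟩
      exact hΨ.mul_mul _
    · intro hx
      obtain ⟨b, rfl⟩ := hΨ.exists_eq x hx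
      obtain ⟨a, rfl⟩ := Θ.surjective b
      exact ⟨a, rfl⟩
  · ext a
    have h1 := congrFun (hΘ a) j
    rw [IsCornerEmbedding.traceOf_apply, IsCornerEmbedding.traceOf_apply,
      traceVector_unitMatrix] at h1
    refine Eq.trans h1 ?_
    simp [K, Matrix.vecMul, dotProduct, extremalTraces, mul_comm]

end IsEmbeddingOn

/-! ### Monomial matrices -/

section Monomial

variable {n : ℕ} {d : Fin n → ℝ} {σ : Equiv.Perm (Fin n)}

theorem vecMul_diagonal_mul_permMatrix (x : Fin n → ℝ) (j : Fin n) :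
    Matrix.vecMul x (Matrix.diagonal d * σ.permMatrix ℝ) j = x (σ.symm j) * d (σ.symm j) := by
  rw [← Matrix.vecMul_vecMul, Matrix.vecMul_permMatrix]
  simp [Matrix.vecMul_diagonal]

theorem isUnit_diagonal_mul_permMatrix (hd : ∀ i, 0 < d i) :
    IsUnit (Matrix.diagonal d * σ.permMatrix ℝ) := by
  rw [Matrix.isUnit_iff_isUnit_det, Matrix.det_mul, Matrix.det_diagonal, Matrix.det_permutation]
  refine IsUnit.mul (Finset.prod_ne_zero_iff.mpr fun i _ => (hd i).ne').isUnit ?_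
  rcases Int.units_eq_one_or (Equiv.Perm.sign σ) with h | h <;> simp [h]

end Monomial

theorem mainTheorem8 {A : Type*} [CStarAlgebra A] (hA : IsAFAlgebra A) (n : ℕ)
    (hn : Module.rank ℂ (traceSpace A) = n)
    (φ : Fin n ≃ ExtremalTrace A)
    (hΓ : IsEmbeddingOn φ (strictCone n) ∨ IsEmbeddingOn φ (coordinatewiseCone n))
    (d : Fin n → ℝ) (hd : ∀ i, 0 < d i) (σ : Equiv.Perm (Fin n))
    (D U : Matrix (Fin n) (Fin n) ℝ) (hD : D = Matrix.diagonal d) (hU : U = σ.permMatrix ℝ) :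
    (fun x : Fin n → ℝ => Matrix.vecMul x (D * U)) '' Set.range (gammaMap φ) =
        Set.range (gammaMap φ) ↔
      (D * U).map Complex.ofReal ∈ fundamentalGroup φ := by
  subst hD hU
  obtain ⟨S, h1, h2, h3⟩ := hA
  have hS : IsAFChain S := ⟨h1, h2, h3⟩
  have hpos : ∀ x : Fin n → ℝ,
      (∀ i, 0 < x i) ↔ ∀ i, 0 < Matrix.vecMul x (Matrix.diagonal d * σ.permMatrix ℝ) i :=
    fun x => by
      refine ⟨fun h i => ?_, fun h i => ?_⟩
      · rw [vecMul_diagonal_mul_permMatrix]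
        exact mul_pos (h _) (hd _)
      -- Coordinate `σ i` of the image is coordinate `i` of `x` scaled by `d i`.
      · have := h (σ i)
        rw [vecMul_diagonal_mul_permMatrix, σ.symm_apply_apply] at this
        exact (mul_pos_iff_of_pos_right (hd i)).mp this
  have hunit := isUnit_diagonal_mul_permMatrix (σ := σ) hd
  -- Only two properties of the cone enter: it contains the strictly positive vectors, and
  -- membership is unchanged by the matrix in both directions. Both orders are thus treated at once.
  have main : ∀ C : Set (Fin n → ℝ), (∀ x : Fin n → ℝ, (∀ i, 0 < x i) → x ∈ C) →
      (∀ x, Matrix.vecMul x (Matrix.diagonal d * σ.permMatrix ℝ) ∈ C ↔ x ∈ C) →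
      IsEmbeddingOn φ C → ((fun x : Fin n → ℝ =>
        Matrix.vecMul x (Matrix.diagonal d * σ.permMatrix ℝ)) '' Set.range (gammaMap φ) =
        Set.range (gammaMap φ) ↔
      (Matrix.diagonal d * σ.permMatrix ℝ).map Complex.ofReal ∈ fundamentalGroup φ) :=
    fun C hC hMC h =>
      ⟨h.mem_fundamentalGroup_of_image_range_eq hS hC (fun x => (hpos x).mp) hMC hunit,
        h.image_range_eq_of_mem_fundamentalGroup hS hC fun x => (hpos x).mp⟩
  obtain hΓ | hΓ := hΓ
  · refine main _ (fun x hx => Or.inl hx) (fun x => or_congr (hpos x).symm ?_) hΓ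
    refine ⟨fun hx => ?_, ?_⟩
    · exact Matrix.vecMul_injective_of_isUnit hunit (hx.trans (Matrix.zero_vecMul _).symm)
    · rintro rfl
      exact Matrix.zero_vecMul _
  · refine main _ (fun x hx i => (hx i).le) (fun x => ?_) hΓ
    refine ⟨fun h i => ?_, fun h i => ?_⟩
    · have := h (σ i)
      rw [vecMul_diagonal_mul_permMatrix, σ.symm_apply_apply] at this
      exact (mul_nonneg_iff_of_pos_right (hd i)).mp this
    · rw [vecMul_diagonal_mul_permMatrix]
      exact mul_nonneg (h _) (hd _).le

end
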